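/- \textbf{Setting.} Let $\Omega\subset\mathbb R^2$ be a bounded domain with smooth boundary $\Gamma$ and outward unit normal $\nu$; let $\frac{d}{ds}=\nu_1\partial_2-\nu_2\partial_1$ be the tangential derivative (derivative with respect to arclength, $\Omega$ on the left) and $A=\begin{bmatrix}0&-1\\1&0\end{bmatrix}$. Let $\lambda,\mu$ be real with $\mu>0$, $\lambda+\mu>0$; let $\nu_p,\nu_u,B,\rho_s,\rho_f,\rho_a,\phi,\kappa,\omega$ be real with $-1<\nu_p<\nu_u<\frac12$, $B,\rho_s,\rho_f,\kappa,\omega>0$, $\rho_a\ge 0$, $0<\phi<1$; and put $$\rho=(1-\phi)\rho_s+\phi\rho_f,\quad \alpha=\frac{3(\nu_u-\nu_p)}{B(1-2\nu_p)(1+\nu_u)},\quad R=\frac{2\phi^2\mu B^2(1-2\nu_p)(1+\nu_u)^2}{9(\nu_u-\nu_p)(1-2\nu_u)},$$ $$\beta=\frac{\omega\phi^2\rho_f\kappa}{i\phi^2+\omega\kappa(\rho_a+\phi\rho_f)},\quad q=\frac{\omega^2\phi^2\rho_f}{\beta R},\quad \gamma=-\frac{i\omega\rho_f(\alpha-\beta)}{\beta},\quad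 \epsilon=\frac{i\omega\gamma(\alpha-\beta)}{q(\lambda+2\mu)},$$ $$k_p=\omega\sqrt{\frac{\rho-\beta\rho_f}{\lambda+2\mu}},\qquad k_s=\omega\sqrt{\frac{\rho-\beta\rho_f}{\mu}}\qquad(\text{principal roots}).$$ Let $k_1,k_2\in\mathbb C$ satisfy $\operatorname{Im}k_1,\operatorname{Im}k_2\ge0$, $k_1^2+k_2^2=q(1+\epsilon)+k_p^2$, $k_1^2k_2^2=qk_p^2$ and $k_1^2\ne k_2^2$. Let $\gamma_k(x,y)=\frac i4H_0^{(1)}(k|x-y|)$ and $$E_{11}=\frac1\mu\gamma_{k_s}I+\frac1{(\rho-\beta\rho_f)\omega^2}\nabla_x\nabla_x^\top\Big[\gamma_{k_s}-\frac{k_p^2-k_2^2}{k_1^2-k_2^2}\gamma_{k_1}+\frac{k_p^2-k_1^2}{k_1^2-k_2^2}\gamma_{k_2}\Big],$$ $$E_{12}=\frac{i\omega\gamma}{(\lambda+2\mu)(k_1^2-k_2^2)}\nabla_x[\gamma_{k_1}-\gamma_{k_2}],\qquad E_{21}=-\frac{\gamma}{(\lambda+2\mu)(k_1^2-k_2^2)}\nabla_x[\gamma_{k_1}-\gamma_{k_2}],$$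 $$E_{22}=\frac{i\rho_f\omega}{\beta(k_1^2-k_2^2)}\big[(k_p^2-k_1^2)\gamma_{k_1}-(k_p^2-k_2^2)\gamma_{k_2}\big],\qquad E=\begin{bmatrix}E_{11}&E_{12}\\E_{21}^\top&E_{22}\end{bmatrix}.$$ With $T(\partial,\nu)u=2\mu\partial_\nu u+\lambda\nu\nabla\cdot u+\mu\nu^\perp(\partial_2u_1-\partial_1u_2)$, $\nu^\perp=(-\nu_2,\nu_1)^\top$, put $$\widetilde T(\partial,\nu)=\begin{bmatrix}T(\partial,\nu)&-\alpha\nu\\-i\omega\beta\nu^\top&\frac{i\beta}{\omega\rho_f}\partial_\nu\end{bmatrix},\qquad \widetilde T^*(\partial,\nu)=\begin{bmatrix}T(\partial,\nu)&-i\omega\alpha\nu\\-\beta\nu^\top&\frac{i\beta}{\omega\rho_f}\partial_\nu\end{bmatrix}.$$ The hypersingular operator is $$N(\psi)(x)=\int_\Gamma\widetilde T(\partial_x,\nu_x)\big(\widetilde T^*(\partial_y,\nu_y)E(x,y)\big)^\top\psi(y)\,ds_y,\qquad x\in\Gamma,$$ in the sense of the Hadamard finite part (integrate over $|x-y|>\delta$,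 discard the terms in $\delta^{-1}$ and $\log\delta$, let $\delta\to0^+$). Writing $\psi=(u^\top,p)^\top$ with $u$ having two components and $p$ scalar, let $N_2$, acting on $p$ with values in $\mathbb C^2$, be the $(1,2)$ block of $N$. \textbf{Lemma.} For every $p\in C^1(\Gamma)$ the function $N_2(p)$ exists on $\Gamma$, the functions $N_2^2(\frac{dp}{ds})$ and $N_2^3(p)$ are differentiable along $\Gamma$, and $$N_2(p)=N_2^1(p)+\frac{d}{ds}N_2^2\Big(\frac{dp}{ds}\Big)+\frac{d}{ds}N_2^3(p)\quad\text{on }\Gamma,$$ where \begin{align*} N_2^1(p)(x)={}&\beta\int_\Gamma\nu_x\nabla_x^\top\Big[(\gamma_{k_s}-\gamma_{k_1})-\frac{k_2^2-q}{k_1^2-k_2^2}(\gamma_{k_1}-\gamma_{k_2})\Big]\nu_y\,p(y)\,ds_y\\ &-\beta\int_\Gamma\big[\partial_{\nu_x}\gamma_{k_s}\,\nu_y-\alpha\nu_xE_{12}^\top\nu_y\big]p(y)\,ds_y\\ &+\frac{i\beta\gamma}{\rho_f\omega(k_1^2-k_2^2)}\int_\Gamma\partial_{\nu_y}\big[k_1^2\gamma_{k_1}-k_2^2\gamma_{k_2}\big]\nu_x\,p(y)\,ds_y\\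 &+\frac{\alpha}{k_1^2-k_2^2}\int_\Gamma\partial_{\nu_y}\big[(k_p^2-k_1^2)\gamma_{k_1}-(k_p^2-k_2^2)\gamma_{k_2}\big]\nu_x\,p(y)\,ds_y,\\ N_2^2(p)(x)={}&-\frac{2i\mu\beta\gamma}{\rho_f\omega(\lambda+2\mu)(k_1^2-k_2^2)}\int_\Gamma\nabla_x[\gamma_{k_1}-\gamma_{k_2}]\,p(y)\,ds_y,\\ N_2^3(p)(x)={}&-\beta\int_\Gamma A\big[2\mu E_{11}-\gamma_{k_s}I\big]\nu_y\,p(y)\,ds_y\\ &-\frac{2i\mu\beta\gamma}{\rho_f\omega(\lambda+2\mu)(k_1^2-k_2^2)}\int_\Gamma\big[k_1^2\gamma_{k_1}-k_2^2\gamma_{k_2}\big]A\nu_y\,p(y)\,ds_y, \end{align*} all kernels being evaluated at $(x,y)$. The kernels of $N_2^1,N_2^2,N_2^3$ are weakly singular on $\Gamma$: continuous for $x\ne y$ and bounded by $C|x-y|^{-\theta}$ with some $C$ and some $0\le\theta<1$. -/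

import Mathlib

open Filter Topology MeasureTheory
open scoped ContDiff

noncomputable section

namespace Poroelastic

/-- The Euclidean plane. -/
abbrev Plane : Type := EuclideanSpace ℝ (Fin 2)

/-! ### The Hankel function and the Helmholtz fundamental solution -/

/-- The Bessel function `J₀`, by its (everywhere convergent) power series. -/
def besselJ0 (z : ℂ) : ℂ :=
  ∑' m : ℕ, (-1 : ℂ) ^ m * (z ^ 2 / 4) ^ m / ((m.factorial : ℂ)) ^ 2

/-- The Bessel function `Y₀` (principal branch of the logarithm), by its classical series. -/
def besselY0 (z : ℂ) : ℂ :=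
  (2 / (Real.pi : ℂ)) *
    ((Complex.log (z / 2) + (Real.eulerMascheroniConstant : ℂ)) * besselJ0 z -
      ∑' m : ℕ, (-1 : ℂ) ^ m * ((harmonic m : ℚ) : ℂ) * (z ^ 2 / 4) ^ m /
        ((m.factorial : ℂ)) ^ 2)

/-- The Hankel function of the first kind and order zero, `H₀⁽¹⁾ = J₀ + i Y₀`. -/
def hankelH0 (z : ℂ) : ℂ := besselJ0 z + Complex.I * besselY0 z

/-- The fundamental solution `γ_k(x, y) = (i/4) H₀⁽¹⁾(k |x - y|)` of the Helmholtz equation. -/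
def helmholtz (k : ℂ) (x y : Plane) : ℂ :=
  Complex.I / 4 * hankelH0 (k * ((‖x - y‖ : ℝ) : ℂ))

/-! ### First order differential operators in the plane -/

/-- The partial derivative `∂ᵢ f` of a complex valued function at `x`. -/
def pd (i : Fin 2) (f : Plane → ℂ) (x : Plane) : ℂ :=
  fderiv ℝ f x (EuclideanSpace.single i (1 : ℝ))

/-- The gradient `∇ f`. -/
def grad (f : Plane → ℂ) (x : Plane) : Fin 2 → ℂ := fun i => pd i f x

/-- The derivative `n · ∇ f` in the (real) direction `n`. -/
def dirDeriv (n : Plane) (f : Plane → ℂ) (x : Plane) : ℂ := ∑ i, ((n i : ℝ) : ℂ) * pd i f x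

/-- A real vector regarded as a complex one. -/
def cvec (n : Plane) : Fin 2 → ℂ := fun i => ((n i : ℝ) : ℂ)

/-- The matrix `A` with rows `(0, -1)` and `(1, 0)`. -/
def rotA : Matrix (Fin 2) (Fin 2) ℂ := !![0, -1; 1, 0]

/-! ### The parameters of the poroelastic medium -/

/-- Physical parameters of the medium and the frequency `ω`. -/
structure Params where
  lam : ℝ
  mu : ℝ
  /-- Poisson ratio -/
  nuP : ℝ
  /-- undrained Poisson ratio -/
  nuU : ℝ
  /-- Skempton coefficient -/
  B : ℝ
  /-- solid density -/
  rhoS : ℝ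
  /-- fluid density -/
  rhoF : ℝ
  /-- apparent mass density -/
  rhoA : ℝ
  /-- porosity -/
  phi : ℝ
  /-- permeability -/
  kappa : ℝ
  /-- frequency -/
  omega : ℝ
  mu_pos : 0 < mu
  lam_add_mu_pos : 0 < lam + mu
  nuP_gt : -1 < nuP
  nuP_lt_nuU : nuP < nuU
  nuU_lt : nuU < 1 / 2
  B_pos : 0 < B
  rhoS_pos : 0 < rhoS
  rhoF_pos : 0 < rhoF
  rhoA_nonneg : 0 ≤ rhoA
  phi_pos : 0 < phi
  phi_lt_one : phi < 1
  kappa_pos : 0 < kappa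
  omega_pos : 0 < omega

namespace Params

variable (P : Params)

/-- The bulk density `ρ`. -/
def rho : ℝ := (1 - P.phi) * P.rhoS + P.phi * P.rhoF

/-- The compressibility `α`. -/
def alpha : ℝ := 3 * (P.nuU - P.nuP) / (P.B * (1 - 2 * P.nuP) * (1 + P.nuU))

/-- The constitutive coefficient `R`. -/
def R : ℝ :=
  2 * P.phi ^ 2 * P.mu * P.B ^ 2 * (1 - 2 * P.nuP) * (1 + P.nuU) ^ 2 /
    (9 * (P.nuU - P.nuP) * (1 - 2 * P.nuU))

/-- `β = ω φ² ρ_f κ / (i φ² + ω κ (ρ_a + φ ρ_f))`. -/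
def beta : ℂ :=
  ((P.omega * P.phi ^ 2 * P.rhoF * P.kappa : ℝ) : ℂ) /
    (Complex.I * ((P.phi ^ 2 : ℝ) : ℂ) +
      ((P.omega * P.kappa * (P.rhoA + P.phi * P.rhoF) : ℝ) : ℂ))

/-- `q = ω² φ² ρ_f / (β R)`. -/
def q : ℂ := ((P.omega ^ 2 * P.phi ^ 2 * P.rhoF : ℝ) : ℂ) / (P.beta * (P.R : ℂ))

/-- `γ = - i ω ρ_f (α - β) / β`. -/
def gam : ℂ :=
  -(Complex.I * (P.omega : ℂ) * (P.rhoF : ℂ) * ((P.alpha : ℂ) - P.beta)) / P.beta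

/-- `ε = i ω γ (α - β) / (q (λ + 2 μ))`. -/
def eps : ℂ :=
  Complex.I * (P.omega : ℂ) * P.gam * ((P.alpha : ℂ) - P.beta) /
    (P.q * ((P.lam + 2 * P.mu : ℝ) : ℂ))

/-- The compressional wave number `k_p = ω √((ρ - β ρ_f) / (λ + 2 μ))` (principal root). -/
def kp : ℂ :=
  (P.omega : ℂ) *
    (((P.rho : ℂ) - P.beta * (P.rhoF : ℂ)) / ((P.lam + 2 * P.mu : ℝ) : ℂ)) ^ (1 / 2 : ℂ)

/-- The shear wave number `k_s = ω √((ρ - β ρ_f) / μ)` (principal root). -/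
def ks : ℂ :=
  (P.omega : ℂ) * (((P.rho : ℂ) - P.beta * (P.rhoF : ℂ)) / (P.mu : ℂ)) ^ (1 / 2 : ℂ)

/-- `k₁, k₂` are the roots, with nonnegative imaginary part, of the characteristic system
`k₁² + k₂² = q (1 + ε) + k_p²`, `k₁² k₂² = q k_p²`. -/
def IsWavePair (k₁ k₂ : ℂ) : Prop :=
  0 ≤ k₁.im ∧ 0 ≤ k₂.im ∧
    k₁ ^ 2 + k₂ ^ 2 = P.q * (1 + P.eps) + P.kp ^ 2 ∧
    k₁ ^ 2 * k₂ ^ 2 = P.q * P.kp ^ 2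

/-! ### The fundamental solution `E(x, y)` -/

/-- The function `γ_{k_s} - (k_p²-k₂²)/(k₁²-k₂²) γ_{k₁} + (k_p²-k₁²)/(k₁²-k₂²) γ_{k₂}`. -/
def psi (k₁ k₂ : ℂ) (x y : Plane) : ℂ :=
  helmholtz P.ks x y
    - (P.kp ^ 2 - k₂ ^ 2) / (k₁ ^ 2 - k₂ ^ 2) * helmholtz k₁ x y
    + (P.kp ^ 2 - k₁ ^ 2) / (k₁ ^ 2 - k₂ ^ 2) * helmholtz k₂ x y

/-- The block `E₁₁`. -/
def E11 (k₁ k₂ : ℂ) (x y : Plane) : Matrix (Fin 2) (Fin 2) ℂ :=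
  (1 / (P.mu : ℂ) * helmholtz P.ks x y) • (1 : Matrix (Fin 2) (Fin 2) ℂ)
    + (1 / (((P.rho : ℂ) - P.beta * (P.rhoF : ℂ)) * (P.omega : ℂ) ^ 2)) •
      Matrix.of fun i j => pd i (fun x' => pd j (fun x'' => P.psi k₁ k₂ x'' y) x') x

/-- The block `E₁₂`, a (column) vector. -/
def E12 (k₁ k₂ : ℂ) (x y : Plane) : Fin 2 → ℂ :=
  (Complex.I * (P.omega : ℂ) * P.gam /
      (((P.lam + 2 * P.mu : ℝ) : ℂ) * (k₁ ^ 2 - k₂ ^ 2))) •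
    grad (fun x' => helmholtz k₁ x' y - helmholtz k₂ x' y) x

/-- The block `E₂₁`, a (column) vector; it enters `E` transposed. -/
def E21 (k₁ k₂ : ℂ) (x y : Plane) : Fin 2 → ℂ :=
  (-(P.gam / (((P.lam + 2 * P.mu : ℝ) : ℂ) * (k₁ ^ 2 - k₂ ^ 2)))) •
    grad (fun x' => helmholtz k₁ x' y - helmholtz k₂ x' y) x

/-- The block `E₂₂`. -/
def E22 (k₁ k₂ : ℂ) (x y : Plane) : ℂ :=
  Complex.I * (P.rhoF : ℂ) * (P.omega : ℂ) / (P.beta * (k₁ ^ 2 - k₂ ^ 2)) *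
    ((P.kp ^ 2 - k₁ ^ 2) * helmholtz k₁ x y - (P.kp ^ 2 - k₂ ^ 2) * helmholtz k₂ x y)

/-- The fundamental solution `E(x, y)`; the index type `Fin 2 ⊕ Unit` lists the two
displacement components and the pressure component. -/
def E (k₁ k₂ : ℂ) (x y : Plane) : Matrix (Fin 2 ⊕ Unit) (Fin 2 ⊕ Unit) ℂ :=
  Matrix.fromBlocks (P.E11 k₁ k₂ x y) (Matrix.of fun i _ => P.E12 k₁ k₂ x y i)
    (Matrix.of fun _ j => P.E21 k₁ k₂ x y j) (Matrix.of fun _ _ => P.E22 k₁ k₂ x y)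

/-! ### Traction and Neumann boundary operators -/

/-- `T(∂, n) u = 2 μ ∂ₙ u + λ n (∇·u) + μ n^⊥ (∂₂ u₁ - ∂₁ u₂)`, where `n^⊥ = (-n₂, n₁)`. -/
def traction (n : Plane) (u : Plane → Fin 2 → ℂ) (x : Plane) : Fin 2 → ℂ := fun i =>
  2 * (P.mu : ℂ) * dirDeriv n (fun z => u z i) x
    + (P.lam : ℂ) * cvec n i * (∑ j, pd j (fun z => u z j) x)
    + (P.mu : ℂ) * (![-(cvec n 1), cvec n 0] : Fin 2 → ℂ) i *
      (pd 1 (fun z => u z 0) x - pd 0 (fun z => u z 1) x)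

/-- The Neumann boundary operator `T̃(∂, n)` with rows
`(T(∂, n), -α n)` and `(-i ω β nᵀ, (i β / (ω ρ_f)) ∂ₙ)`. -/
def neumann (n : Plane) (U : Plane → Fin 2 ⊕ Unit → ℂ) (x : Plane) : Fin 2 ⊕ Unit → ℂ :=
  Sum.elim
    (fun i => P.traction n (fun z j => U z (Sum.inl j)) x i
      - (P.alpha : ℂ) * cvec n i * U x (Sum.inr ()))
    (fun _ => -(Complex.I * (P.omega : ℂ) * P.beta) * (∑ j, cvec n j * U x (Sum.inl j))
      + Complex.I * P.beta / ((P.omega : ℂ) * (P.rhoF : ℂ)) *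
        dirDeriv n (fun z => U z (Sum.inr ())) x)

/-- The adjoint Neumann boundary operator `T̃*(∂, n)` with rows
`(T(∂, n), -i ω α n)` and `(-β nᵀ, (i β / (ω ρ_f)) ∂ₙ)`. -/
def neumannAdj (n : Plane) (U : Plane → Fin 2 ⊕ Unit → ℂ) (x : Plane) : Fin 2 ⊕ Unit → ℂ :=
  Sum.elim
    (fun i => P.traction n (fun z j => U z (Sum.inl j)) x i
      - Complex.I * (P.omega : ℂ) * (P.alpha : ℂ) * cvec n i * U x (Sum.inr ()))
    (fun _ => -P.beta * (∑ j, cvec n j * U x (Sum.inl j))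
      + Complex.I * P.beta / ((P.omega : ℂ) * (P.rhoF : ℂ)) *
        dirDeriv n (fun z => U z (Sum.inr ())) x)

/-- The kernel `(T̃*(∂_y, ν_y) E(x, y))ᵀ` of the double-layer potential
(`T̃*` acts on each column of `E`). -/
def doubleLayerKernel (k₁ k₂ : ℂ) (x y ny : Plane) :
    Matrix (Fin 2 ⊕ Unit) (Fin 2 ⊕ Unit) ℂ :=
  Matrix.transpose (Matrix.of fun a b =>
    P.neumannAdj ny (fun y' l => P.E k₁ k₂ x y' l b) y a)

/-- The kernel `T̃(∂_x, ν_x) (T̃*(∂_y, ν_y) E(x, y))ᵀ` of the hypersingular operator `N`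
(`T̃` acts on each column). -/
def hypersingularKernel (k₁ k₂ : ℂ) (x nx y ny : Plane) :
    Matrix (Fin 2 ⊕ Unit) (Fin 2 ⊕ Unit) ℂ :=
  Matrix.of fun a b =>
    P.neumann nx (fun x' l => P.doubleLayerKernel k₁ k₂ x' y ny l b) x a

/-- The kernel of the block `N₂` (displacement rows, pressure column). -/
def kernelN2 (k₁ k₂ : ℂ) (x nx y ny : Plane) : Fin 2 → ℂ := fun i =>
  (P.hypersingularKernel k₁ k₂ x nx y ny).toBlocks₁₂ i ()

/-! ### The kernels of the regularized formulation -/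

/-- The kernel of `N₂¹`. -/
def kernelN21 (k₁ k₂ : ℂ) (x nx y ny : Plane) : Fin 2 → ℂ :=
  (P.beta * ∑ j, grad (fun x' =>
      (helmholtz P.ks x' y - helmholtz k₁ x' y)
        - (k₂ ^ 2 - P.q) / (k₁ ^ 2 - k₂ ^ 2) * (helmholtz k₁ x' y - helmholtz k₂ x' y)) x j
      * cvec ny j) • cvec nx
  - P.beta • (dirDeriv nx (fun x' => helmholtz P.ks x' y) x • cvec ny
      - ((P.alpha : ℂ) * ∑ j, P.E12 k₁ k₂ x y j * cvec ny j) • cvec nx)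
  + (Complex.I * P.beta * P.gam / ((P.rhoF : ℂ) * (P.omega : ℂ) * (k₁ ^ 2 - k₂ ^ 2)) *
      dirDeriv ny (fun y' =>
        k₁ ^ 2 * helmholtz k₁ x y' - k₂ ^ 2 * helmholtz k₂ x y') y) • cvec nx
  + ((P.alpha : ℂ) / (k₁ ^ 2 - k₂ ^ 2) *
      dirDeriv ny (fun y' =>
        (P.kp ^ 2 - k₁ ^ 2) * helmholtz k₁ x y'
          - (P.kp ^ 2 - k₂ ^ 2) * helmholtz k₂ x y') y) • cvec nx

/-- The constant `2 i μ β γ / (ρ_f ω (λ + 2 μ) (k₁² - k₂²))`. -/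
def constN2 (k₁ k₂ : ℂ) : ℂ :=
  2 * Complex.I * (P.mu : ℂ) * P.beta * P.gam /
    ((P.rhoF : ℂ) * (P.omega : ℂ) * ((P.lam + 2 * P.mu : ℝ) : ℂ) * (k₁ ^ 2 - k₂ ^ 2))

/-- The kernel of `N₂²` (it does not depend on the normals). -/
def kernelN22 (k₁ k₂ : ℂ) (x _nx y _ny : Plane) : Fin 2 → ℂ :=
  (-P.constN2 k₁ k₂) • grad (fun x' => helmholtz k₁ x' y - helmholtz k₂ x' y) x

/-- The kernel of `N₂³`. -/
def kernelN23 (k₁ k₂ : ℂ) (x _nx y ny : Plane) : Fin 2 → ℂ :=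
  (-P.beta) • (rotA *
      ((2 * (P.mu : ℂ)) • P.E11 k₁ k₂ x y
        - helmholtz P.ks x y • (1 : Matrix (Fin 2) (Fin 2) ℂ))).mulVec (cvec ny)
  - (P.constN2 k₁ k₂ * (k₁ ^ 2 * helmholtz k₁ x y - k₂ ^ 2 * helmholtz k₂ x y)) •
      rotA.mulVec (cvec ny)

end Params

/-! ### Smooth bounded domains and their boundaries -/

/-- A bounded domain `Ω` of the plane with smooth boundary `Γ = ∂Ω`.  The boundary is the
disjoint union of finitely many smooth simple closed curves, each given by a periodic
arclength parametrization that has `Ω` on its left. -/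
structure SmoothDomain where
  carrier : Set Plane
  isOpen : IsOpen carrier
  isConnected : IsConnected carrier
  isBounded : Bornology.IsBounded carrier
  /-- the number of boundary components -/
  num : ℕ
  /-- the lengths of the boundary components -/
  len : Fin num → ℝ
  len_pos : ∀ j, 0 < len j
  curve : Fin num → ℝ → Plane
  smooth : ∀ j, ContDiff ℝ ∞ (curve j)
  unit_speed : ∀ j t, ‖deriv (curve j) t‖ = 1
  periodic : ∀ j, Function.Periodic (curve j) (len j)
  injOn : ∀ j, Set.InjOn (curve j) (Set.Ico 0 (len j))
  disjoint : ∀ i j, i ≠ j → Disjoint (Set.range (curve i)) (Set.range (curve j))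
  frontier_eq : frontier carrier = ⋃ j, Set.range (curve j)
  outward : ∀ j t, ∀ᶠ h : ℝ in 𝓝[>] 0,
    curve j t + h • !₂[deriv (curve j) t 1, -(deriv (curve j) t 0)] ∉ closure carrier ∧
    curve j t - h • !₂[deriv (curve j) t 1, -(deriv (curve j) t 0)] ∈ carrier

namespace SmoothDomain

variable (D : SmoothDomain)

/-- The outward unit normal at the boundary point `curve j t`. -/
def normal (j : Fin D.num) (t : ℝ) : Plane :=
  !₂[deriv (D.curve j) t 1, -(deriv (D.curve j) t 0)]

/-- A function on `Γ`, written in the arclength coordinates: `f j t` is its value at the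
point `curve j t`. -/
abbrev BdryFun (F : Type) : Type := Fin D.num → ℝ → F

/-- A scalar function on `Γ` that is continuously differentiable along `Γ`. -/
def IsC1 (p : D.BdryFun ℂ) : Prop :=
  ∀ j, ContDiff ℝ 1 (p j) ∧ Function.Periodic (p j) (D.len j)

/-- The tangential derivative `d/ds`, the derivative with respect to arclength. -/
def tderiv {F : Type} [NormedAddCommGroup F] [NormedSpace ℝ F] (f : D.BdryFun F) :
    D.BdryFun F :=
  fun j s => deriv (f j) s

/-- The integral operator `p ↦ ∫_Γ K(x, y) p(y) ds_y` on `Γ` with a kernel that may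
depend on `x, ν_x, y, ν_y`. -/
def intOp (K : Plane → Plane → Plane → Plane → Fin 2 → ℂ) (p : D.BdryFun ℂ) :
    D.BdryFun (Fin 2 → ℂ) :=
  fun j s => ∑ i, ∫ t in (0 : ℝ)..(D.len i),
    p i t • K (D.curve j s) (D.normal j s) (D.curve i t) (D.normal i t)

/-- The truncated integral `∫_{y ∈ Γ, |x - y| > δ} K(x, y) p(y) ds_y` at `x = curve j s`. -/
def truncInt (K : Plane → Plane → Plane → Plane → Fin 2 → ℂ) (p : D.BdryFun ℂ)
    (j : Fin D.num) (s : ℝ) (δ : ℝ) : Fin 2 → ℂ :=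
  ∑ i, ∫ t in {t : ℝ | t ∈ Set.Ioc 0 (D.len i) ∧ δ < dist (D.curve j s) (D.curve i t)},
    p i t • K (D.curve j s) (D.normal j s) (D.curve i t) (D.normal i t)

/-- A kernel is weakly singular on the (one dimensional) boundary `Γ` if it is continuous
off the diagonal and bounded there by `C |x - y| ^ (-θ)` for some `θ < 1`. -/
def WeaklySingular (K : Plane → Plane → Plane → Plane → Fin 2 → ℂ) : Prop :=
  (∀ i j, ContinuousOn
    (fun z : ℝ × ℝ =>
      K (D.curve i z.1) (D.normal i z.1) (D.curve j z.2) (D.normal j z.2))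
    {z : ℝ × ℝ | D.curve i z.1 ≠ D.curve j z.2}) ∧
  ∃ C θ : ℝ, 0 ≤ θ ∧ θ < 1 ∧ ∀ i j s t, D.curve i s ≠ D.curve j t →
    ‖K (D.curve i s) (D.normal i s) (D.curve j t) (D.normal j t)‖ ≤
      C * dist (D.curve i s) (D.curve j t) ^ (-θ)

end SmoothDomain

/-- `v` is the Hadamard finite part of `F δ` as `δ → 0⁺`: what remains in the limit after
the divergent terms, multiples of `1/δ` and of `log δ`, have been discarded.  (If no term
has to be discarded, this is the Cauchy principal value.) -/
def HasFinitePart (F : ℝ → Fin 2 → ℂ) (v : Fin 2 → ℂ) : Prop :=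
  ∃ a b : Fin 2 → ℂ,
    Tendsto (fun δ : ℝ => F δ - δ⁻¹ • a - Real.log δ • b) (𝓝[>] 0) (𝓝 v)

/-- The hypersingular operator block `N₂`: the function `N₂ p` on `Γ` exists and equals `w`,
i.e. at each `x ∈ Γ` the finite part integral `∫_Γ N₂(x, y) p(y) ds_y` exists and is `w(x)`. -/
def IsN2 (P : Params) (k₁ k₂ : ℂ) (D : SmoothDomain) (p : D.BdryFun ℂ)
    (w : D.BdryFun (Fin 2 → ℂ)) : Prop :=
  ∀ j s, HasFinitePart (D.truncInt (P.kernelN2 k₁ k₂) p j s) (w j s)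

/-- The operator `N₂¹`. -/
def N21 (P : Params) (k₁ k₂ : ℂ) (D : SmoothDomain) (p : D.BdryFun ℂ) :
    D.BdryFun (Fin 2 → ℂ) := D.intOp (P.kernelN21 k₁ k₂) p

/-- The operator `N₂²`. -/
def N22 (P : Params) (k₁ k₂ : ℂ) (D : SmoothDomain) (p : D.BdryFun ℂ) :
    D.BdryFun (Fin 2 → ℂ) := D.intOp (P.kernelN22 k₁ k₂) p

/-- The operator `N₂³`. -/
def N23 (P : Params) (k₁ k₂ : ℂ) (D : SmoothDomain) (p : D.BdryFun ℂ) :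
    D.BdryFun (Fin 2 → ℂ) := D.intOp (P.kernelN23 k₁ k₂) p

end Poroelastic

end

open Filter Topology MeasureTheory
open scoped ContDiff

noncomputable section

namespace Poroelastic

/-! ### Entire power series and the Bessel equation -/

/-! Write θ = γ_{k₁} − γ_{k₂}, ψ for the bracket in `E11`, and c for `constN2`. Off the diagonal,
the hypersingular kernel equals the kernel of `N21`, plus the tangential x-derivative of the kernel
of `N23`, plus the tangential x-derivative of −c ∑_b τ_b(y) ∂_b∂_aθ(x − y), where τ is the unit
tangent (`Params.kernelN2_eq_regularized`). This is an algebraic identity between third derivatives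
of ψ and θ, once symmetry of partial derivatives and the differentiated Helmholtz equations have
removed the dependent ones. Integrated over |x − y| > δ, it reduces the lemma to three limits.

The limits rest on the type of the singularities. In the variable ρ = |z|², γ_k is A(ρ) log ρ + B(ρ)
with A, B smooth and A(0) = −1/(4π), independently of k, and it solves ρf'' + f' + k²f/4 = 0. In ψ
and θ the coefficients sum to zero, so the leading logarithm cancels and f' = O(log ρ); the
differential equation then controls f'' and f'''. Hence the second derivatives of ψ and θ are even,
O(log |z|), with gradient O(log |z| / |z|) (`logKernel_pd_pd_radial`, `LogKernel`).

For such a kernel M and a C¹ density w, the potential ∫ w(t) M(x(s) − y(t)) dt is differentiable in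
s, and its derivative is the principal value of the differentiated integral
(`CurvePair.hasDerivAt_layer`). After the substitution t = s + τ the singularity stays at τ = 0, and
the s-derivative of M carries the factor x'(s) − y'(s + τ), which compensates the 1/|z| in the
gradient; a logarithm remains as integrable majorant. Differentiating in x alone differs from this
by a total τ-derivative, which integrates to values at ±δ whose difference vanishes because M is
even and the curve is smooth (`SmoothDomain.tendsto_symmetric_difference`). Replacing |τ| > δ by |x
− y| > δ changes the domain by a set of measure O(δ²), on which the integrand is O(|log δ| / δ)
(`tendsto_punctured_sub_truncated`).

The kernel of `N21` contains only normal derivatives of radial functions; these are bounded on a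
smooth curve, so dominated convergence suffices. `N22` is applied to dp/ds, which is merely
continuous; integration by parts (`SmoothDomain.integral_deriv_mul`) first turns it into a
logarithmic potential with C¹ density. Since all three truncated integrals converge, the finite part
is a principal value. -/

/-- The sum of the power series with coefficients `a`. -/
def powerSum (a : ℕ → ℂ) (w : ℂ) : ℂ := ∑' m, a m * w ^ m

/-- The coefficients of the differentiated power series. -/
def derivCoeff (a : ℕ → ℂ) (m : ℕ) : ℂ := ((m : ℂ) + 1) * a (m + 1)

/-- Coefficients dominated by those of the exponential series. -/
def FactorialBound (a : ℕ → ℂ) : Prop := ∀ m, ‖a m‖ ≤ 1 / (m.factorial : ℝ)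

/-- Since (m + 1)/(m + 1)! = 1/m!, the bound is stable under differentiation; one hypothesis
therefore serves a series and all its derivatives. -/
lemma FactorialBound.derivCoeff {a : ℕ → ℂ} (ha : FactorialBound a) :
    FactorialBound (derivCoeff a) := by
  intro m
  have h := ha (m + 1)
  have hm : (0 : ℝ) < (m : ℝ) + 1 := by positivity
  have hn : ‖(m : ℂ) + 1‖ = (m : ℝ) + 1 := by
    have : (m : ℂ) + 1 = ((m + 1 : ℕ) : ℂ) := by push_cast; ring
    rw [this, Complex.norm_natCast]; push_cast; ring
  rw [Poroelastic.derivCoeff, norm_mul, hn]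
  calc ((m : ℝ) + 1) * ‖a (m + 1)‖ ≤ ((m : ℝ) + 1) * (1 / ((m + 1).factorial : ℝ)) := by gcongr
    _ = 1 / (m.factorial : ℝ) := by
      rw [Nat.factorial_succ]; push_cast; field_simp

lemma FactorialBound.summable {a : ℕ → ℂ} (ha : FactorialBound a) (w : ℂ) :
    Summable fun m => a m * w ^ m := by
  refine Summable.of_norm_bounded (Real.summable_pow_div_factorial ‖w‖) fun m => ?_
  rw [norm_mul, norm_pow]
  calc ‖a m‖ * ‖w‖ ^ m ≤ 1 / (m.factorial : ℝ) * ‖w‖ ^ m := by gcongr; exact ha m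
    _ = ‖w‖ ^ m / (m.factorial : ℝ) := by ring

lemma FactorialBound.hasDerivAt {a : ℕ → ℂ} (ha : FactorialBound a) (w : ℂ) :
    HasDerivAt (powerSum a) (powerSum (Poroelastic.derivCoeff a) w) w := by
  set R := ‖w‖ + 1 with hR
  have hR0 : 0 ≤ R := by positivity
  -- Majorant of the differentiated terms on the ball of radius `R`. At m = 0 the truncated
  -- subtraction gives the value 1, which is harmless because that term has derivative zero.
  set u : ℕ → ℝ := fun m => R ^ (m - 1) / ((m - 1).factorial : ℝ) with hu
  have hus : Summable u := by
    rw [← summable_nat_add_iff 1]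
    simpa [hu] using Real.summable_pow_div_factorial R
  have key : ∀ m (y : ℂ), a (m + 1) * (((m + 1 : ℕ) : ℂ) * y ^ m) =
      Poroelastic.derivCoeff a m * y ^ m := by
    intro m y; simp only [Poroelastic.derivCoeff]; push_cast; ring
  have h := hasDerivAt_tsum_of_isPreconnected (𝕜 := ℂ) (g := fun m y => a m * y ^ m)
    (g' := fun m y => a m * ((m : ℂ) * y ^ (m - 1))) (t := Metric.ball 0 R) (y₀ := 0) (y := w)
    hus Metric.isOpen_ball (convex_ball (0 : ℂ) R).isPreconnected
    (fun m y _ => (hasDerivAt_pow m y).const_mul (a m)) ?_ (by simp [hR]; positivity)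
    (ha.summable 0) (by simp [hR])
  · have hsum : Summable fun m : ℕ => a m * ((m : ℂ) * w ^ (m - 1)) := by
      rw [← summable_nat_add_iff 1]
      simpa only [Nat.add_sub_cancel, key] using ha.derivCoeff.summable w
    rw [hsum.tsum_eq_zero_add] at h
    simp only [Nat.add_sub_cancel, key, Nat.cast_zero, zero_mul, mul_zero, zero_add] at h
    exact h
  · intro m y hy
    rcases m with _ | m
    · simp [hu]
    · simp only [Nat.add_sub_cancel, key, hu]
      rw [norm_mul, norm_pow]
      have hy' : ‖y‖ ≤ R := by simpa using (mem_ball_zero_iff.mp hy).le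
      calc ‖Poroelastic.derivCoeff a m‖ * ‖y‖ ^ m ≤ 1 / (m.factorial : ℝ) * R ^ m := by
            gcongr; exact ha.derivCoeff m
        _ = R ^ m / (m.factorial : ℝ) := by ring

lemma FactorialBound.contDiff {a : ℕ → ℂ} (ha : FactorialBound a) (c : ℂ) :
    ContDiff ℝ ∞ fun ρ : ℝ => powerSum a (c * ρ) := by
  have h1 : ContDiff ℂ ∞ (powerSum a) :=
    Differentiable.contDiff fun w => (ha.hasDerivAt w).differentiableAt
  have h2 : ContDiff ℝ ∞ (powerSum a) := h1.restrict_scalars ℝ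
  exact h2.comp (contDiff_const.mul Complex.ofRealCLM.contDiff)

lemma FactorialBound.hasDerivAt_ofReal {a : ℕ → ℂ} (ha : FactorialBound a) (c : ℂ) (ρ : ℝ) :
    HasDerivAt (fun ρ : ℝ => powerSum a (c * ρ))
      (c * powerSum (Poroelastic.derivCoeff a) (c * ρ)) ρ := by
  have h1 : HasDerivAt (fun z : ℂ => powerSum a (c * z))
      (powerSum (Poroelastic.derivCoeff a) (c * ρ) * (c * 1)) (ρ : ℂ) :=
    HasDerivAt.comp (h₂ := powerSum a) (h := fun z : ℂ => c * z) (ρ : ℂ) (ha.hasDerivAt _)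
      ((hasDerivAt_id (ρ : ℂ)).const_mul c)
  convert h1.comp_ofReal using 1
  ring

lemma mul_powerSum_derivCoeff {b : ℕ → ℂ} (hb : FactorialBound b) (w : ℂ) :
    HasSum (fun m : ℕ => (m : ℂ) * b m * w ^ m) (w * powerSum (derivCoeff b) w) := by
  have h := (hb.derivCoeff.summable w).hasSum.mul_left w
  rw [← hasSum_nat_add_iff' 1]
  simp only [Finset.sum_range_one, Nat.cast_zero, zero_mul, sub_zero]
  have h' : (fun m : ℕ => ((m + 1 : ℕ) : ℂ) * b (m + 1) * w ^ (m + 1)) =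
      fun m => w * (derivCoeff b m * w ^ m) := by
    ext m
    simp only [derivCoeff]; push_cast; ring
  rw [h']
  exact h

/-- The coefficients of `J₀` as a function of `z² / 4`. -/
def coeffJ (m : ℕ) : ℂ := (-1 : ℂ) ^ m / ((m.factorial : ℂ)) ^ 2

/-- The coefficients of the harmonic series in the definition of `Y₀`. -/
def coeffH (m : ℕ) : ℂ := (-1 : ℂ) ^ m * ((harmonic m : ℚ) : ℂ) / ((m.factorial : ℂ)) ^ 2

lemma factorialBound_coeffJ : FactorialBound coeffJ := by
  intro m
  have h1 : (1 : ℝ) ≤ (m.factorial : ℝ) := by exact_mod_cast Nat.one_le_iff_ne_zero.mpr (Nat.factorial_ne_zero m)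
  simp only [coeffJ, norm_div, norm_pow, norm_neg, norm_one, one_pow, Complex.norm_natCast]
  gcongr
  nlinarith

lemma harmonic_le (m : ℕ) : (harmonic m : ℚ) ≤ m := by
  induction m with
  | zero => simp
  | succ m ih =>
    rw [harmonic_succ]
    have : ((m + 1 : ℕ) : ℚ)⁻¹ ≤ 1 := by
      apply inv_le_one_of_one_le₀; exact_mod_cast Nat.succ_le_succ (Nat.zero_le m)
    push_cast at this ⊢
    linarith

/-- One of the two factorials in the denominator absorbs the harmonic number, since harmonic m ≤ m ≤
m!. -/
lemma factorialBound_coeffH : FactorialBound coeffH := by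
  intro m
  have h0 : (0 : ℝ) < (m.factorial : ℝ) := by exact_mod_cast Nat.factorial_pos m
  have h1 : ((harmonic m : ℚ) : ℝ) ≤ (m.factorial : ℝ) := by
    have h := harmonic_le m
    have h' : (m : ℚ) ≤ (m.factorial : ℚ) := by exact_mod_cast Nat.self_le_factorial m
    exact_mod_cast h.trans h'
  have h2 : (0 : ℝ) ≤ ((harmonic m : ℚ) : ℝ) := by
    have : (0 : ℚ) ≤ harmonic m := by
      unfold harmonic; exact Finset.sum_nonneg fun i _ => by positivity
    exact_mod_cast this
  have h3 : ‖((harmonic m : ℚ) : ℂ)‖ = ((harmonic m : ℚ) : ℝ) := by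
    rw [← Complex.ofReal_ratCast, Complex.norm_real, Real.norm_of_nonneg h2]
  simp only [coeffH, norm_div, norm_mul, norm_pow, norm_neg, norm_one, one_pow,
    Complex.norm_natCast, h3, one_mul]
  rw [div_le_div_iff₀ (by positivity) h0]
  nlinarith

lemma bessel_coeffJ (m : ℕ) :
    (m : ℂ) * derivCoeff coeffJ m + derivCoeff coeffJ m + coeffJ m = 0 := by
  have h0 : (m.factorial : ℂ) ≠ 0 := by exact_mod_cast Nat.factorial_ne_zero m
  have h1 : (m : ℂ) + 1 ≠ 0 := by exact_mod_cast Nat.succ_ne_zero m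
  simp only [derivCoeff, coeffJ, Nat.factorial_succ, pow_succ]
  push_cast
  field_simp
  ring

/-- The increment 1/(m + 1) of the harmonic numbers leaves the differentiated `J₀` series as a
source term. It is what cancels the cross terms of the logarithm in `profile_ode`. -/
lemma bessel_coeffH (m : ℕ) :
    (m : ℂ) * derivCoeff coeffH m + derivCoeff coeffH m + coeffH m = derivCoeff coeffJ m := by
  have h0 : (m.factorial : ℂ) ≠ 0 := by exact_mod_cast Nat.factorial_ne_zero m
  have h1 : (m : ℂ) + 1 ≠ 0 := by exact_mod_cast Nat.succ_ne_zero m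
  simp only [derivCoeff, coeffJ, coeffH, Nat.factorial_succ, pow_succ, harmonic_succ]
  push_cast
  field_simp
  ring

lemma bessel_powerSum {a r : ℕ → ℂ} (ha : FactorialBound a)
    (h : ∀ m : ℕ, (m : ℂ) * derivCoeff a m + derivCoeff a m + a m = r m) (w : ℂ) :
    w * powerSum (derivCoeff (derivCoeff a)) w + powerSum (derivCoeff a) w + powerSum a w =
      powerSum r w := by
  have := ((mul_powerSum_derivCoeff ha.derivCoeff w).add (ha.derivCoeff.summable w).hasSum).add
    (ha.summable w).hasSum
  refine (this.tsum_eq).symm.trans ?_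
  rw [powerSum]
  congr 1
  ext m
  rw [← h m]; ring

/-! ### Functions with a logarithmic singularity at the origin -/

/-- `f` has the form `A log + B` on the positive half-line, with `A`, `B` smooth and `A 0 = a`. -/
def IsLogProfile (f : ℝ → ℂ) (a : ℂ) : Prop :=
  ∃ A B : ℝ → ℂ, ContDiff ℝ ∞ A ∧ ContDiff ℝ ∞ B ∧ A 0 = a ∧
    ∀ ρ : ℝ, 0 < ρ → f ρ = Real.log ρ * A ρ + B ρ

lemma IsLogProfile.add {f g : ℝ → ℂ} {a b : ℂ} (hf : IsLogProfile f a) (hg : IsLogProfile g b) :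
    IsLogProfile (fun ρ => f ρ + g ρ) (a + b) := by
  obtain ⟨A, B, hA, hB, h0, h⟩ := hf
  obtain ⟨A', B', hA', hB', h0', h'⟩ := hg
  exact ⟨fun ρ => A ρ + A' ρ, fun ρ => B ρ + B' ρ, hA.add hA', hB.add hB', by simp [h0, h0'],
    fun ρ hρ => by simp only [h ρ hρ, h' ρ hρ]; ring⟩

lemma IsLogProfile.const_mul {f : ℝ → ℂ} {a : ℂ} (hf : IsLogProfile f a) (c : ℂ) :
    IsLogProfile (fun ρ => c * f ρ) (c * a) := by
  obtain ⟨A, B, hA, hB, h0, h⟩ := hf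
  exact ⟨fun ρ => c * A ρ, fun ρ => c * B ρ, contDiff_const.mul hA, contDiff_const.mul hB,
    by simp [h0], fun ρ hρ => by simp only [h ρ hρ]; ring⟩

lemma contDiffAt_ofReal_log {ρ : ℝ} (hρ : 0 < ρ) :
    ContDiffAt ℝ ∞ (fun ρ : ℝ => (Real.log ρ : ℂ)) ρ :=
  Complex.ofRealCLM.contDiff.contDiffAt.comp ρ (Real.contDiffAt_log.mpr hρ.ne')

lemma IsLogProfile.contDiffAt {f : ℝ → ℂ} {a : ℂ} (hf : IsLogProfile f a) {ρ : ℝ} (hρ : 0 < ρ) :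
    ContDiffAt ℝ ∞ f ρ := by
  obtain ⟨A, B, hA, hB, -, h⟩ := hf
  refine ContDiffAt.congr_of_eventuallyEq
    (((contDiffAt_ofReal_log hρ).mul hA.contDiffAt).add hB.contDiffAt) ?_
  filter_upwards [lt_mem_nhds hρ] with x hx using h x hx

lemma IsLogProfile.hasDerivAt {f : ℝ → ℂ} {a : ℂ} (hf : IsLogProfile f a) {ρ : ℝ} (hρ : 0 < ρ) :
    HasDerivAt f (deriv f ρ) ρ :=
  ((hf.contDiffAt hρ).differentiableAt (by simp)).hasDerivAt

lemma exists_bound_Icc {A : ℝ → ℂ} (hA : Continuous A) (R : ℝ) :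
    ∃ C, 0 ≤ C ∧ ∀ ρ, 0 ≤ ρ → ρ ≤ R → ‖A ρ‖ ≤ C := by
  obtain ⟨C, hC⟩ := isCompact_Icc.exists_bound_of_continuousOn (s := Set.Icc 0 R) hA.continuousOn
  exact ⟨max C 0, le_max_right _ _, fun ρ h0 h1 => (hC ρ ⟨h0, h1⟩).trans (le_max_left _ _)⟩

lemma norm_ofReal_log (ρ : ℝ) : ‖(Real.log ρ : ℂ)‖ = |Real.log ρ| := by
  rw [Complex.norm_real, Real.norm_eq_abs]

lemma IsLogProfile.exists_bound {f : ℝ → ℂ} {a : ℂ} (hf : IsLogProfile f a) (R : ℝ) :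
    ∃ C, 0 ≤ C ∧ ∀ ρ, 0 < ρ → ρ ≤ R → ‖f ρ‖ ≤ C * (1 + |Real.log ρ|) := by
  obtain ⟨A, B, hA, hB, -, h⟩ := hf
  obtain ⟨a, ha0, ha⟩ := exists_bound_Icc hA.continuous R
  obtain ⟨b, hb0, hb⟩ := exists_bound_Icc hB.continuous R
  refine ⟨a + b, by positivity, fun ρ h0 h1 => ?_⟩
  rw [h ρ h0]
  have hl := abs_nonneg (Real.log ρ)
  calc ‖(Real.log ρ : ℂ) * A ρ + B ρ‖ ≤ |Real.log ρ| * a + b := by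
        refine (norm_add_le _ _).trans ?_
        rw [norm_mul, norm_ofReal_log]
        gcongr
        · exact ha ρ h0.le h1
        · exact hb ρ h0.le h1
    _ ≤ (a + b) * (1 + |Real.log ρ|) := by nlinarith

lemma hasDerivAt_ofReal_log {ρ : ℝ} (hρ : 0 < ρ) :
    HasDerivAt (fun ρ : ℝ => (Real.log ρ : ℂ)) (ρ : ℂ)⁻¹ ρ := by
  simpa using (Real.hasDerivAt_log hρ.ne').ofReal_comp

lemma deriv_log_mul_add {f A B : ℝ → ℂ} {A' B' : ℂ} {ρ : ℝ} (hρ : 0 < ρ)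
    (h : ∀ ρ : ℝ, 0 < ρ → f ρ = Real.log ρ * A ρ + B ρ)
    (hA : HasDerivAt A A' ρ) (hB : HasDerivAt B B' ρ) :
    HasDerivAt f (Real.log ρ * A' + (A ρ / ρ + B')) ρ := by
  have h1 := ((hasDerivAt_ofReal_log hρ).mul hA).add hB
  have h2 : HasDerivAt f ((ρ : ℂ)⁻¹ * A ρ + Real.log ρ * A' + B') ρ := by
    refine h1.congr_of_eventuallyEq ?_
    filter_upwards [lt_mem_nhds hρ] with x hx using h x hx
  convert h2 using 1
  ring

lemma contDiff_deriv {A : ℝ → ℂ} (hA : ContDiff ℝ ∞ A) : ContDiff ℝ ∞ (deriv A) :=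
  (contDiff_infty_iff_deriv.mp hA).2

/-- ρ log ρ is continuous up to 0, hence bounded on the compact interval. -/
lemma one_add_abs_log_le {R : ℝ} : ∃ C, 0 ≤ C ∧ ∀ ρ, 0 < ρ → ρ ≤ R →
    ρ * (1 + |Real.log ρ|) ≤ C := by
  obtain ⟨C, hC⟩ := isCompact_Icc.exists_bound_of_continuousOn (s := Set.Icc 0 R)
    Real.continuous_mul_log.continuousOn
  refine ⟨|R| + |C|, by positivity, fun ρ h0 h1 => ?_⟩
  have h := hC ρ ⟨h0.le, h1⟩
  rw [norm_mul, Real.norm_eq_abs, Real.norm_eq_abs, abs_of_pos h0] at h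
  nlinarith [le_abs_self R, le_abs_self C]

/-- The derivative of a logarithmic profile is `O(1 / ρ)`. -/
lemma IsLogProfile.exists_bound_deriv {f : ℝ → ℂ} {a : ℂ} (hf : IsLogProfile f a) (R : ℝ) :
    ∃ C, 0 ≤ C ∧ ∀ ρ, 0 < ρ → ρ ≤ R → ‖deriv f ρ‖ ≤ C / ρ := by
  obtain ⟨A, B, hA, hB, -, h⟩ := hf
  obtain ⟨a, ha0, ha⟩ := exists_bound_Icc hA.continuous R
  obtain ⟨a', ha0', ha'⟩ := exists_bound_Icc (contDiff_deriv hA).continuous R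
  obtain ⟨b, hb0, hb⟩ := exists_bound_Icc (contDiff_deriv hB).continuous R
  obtain ⟨c, hc0, hc⟩ := one_add_abs_log_le (R := R)
  refine ⟨c * a' + a + c * b, by positivity, fun ρ h0 h1 => ?_⟩
  rw [(deriv_log_mul_add h0 h (hA.differentiable (by simp) ρ).hasDerivAt
    (hB.differentiable (by simp) ρ).hasDerivAt).deriv]
  have hl := abs_nonneg (Real.log ρ)
  have hcρ := hc ρ h0 h1
  have hn : ‖(ρ : ℂ)‖ = ρ := by rw [Complex.norm_real, Real.norm_of_nonneg h0.le]
  have e1 : ‖(Real.log ρ : ℂ) * deriv A ρ + (A ρ / ρ + deriv B ρ)‖ ≤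
      |Real.log ρ| * a' + (a / ρ + b) := by
    refine (norm_add_le _ _).trans (add_le_add ?_ ((norm_add_le _ _).trans (add_le_add ?_ ?_)))
    · rw [norm_mul, norm_ofReal_log]; gcongr; exact ha' ρ h0.le h1
    · rw [norm_div, hn]; gcongr; exact ha ρ h0.le h1
    · exact hb ρ h0.le h1
  refine e1.trans ?_
  rw [le_div_iff₀ h0]
  have : (|Real.log ρ| * a' + (a / ρ + b)) * ρ = (ρ * |Real.log ρ|) * a' + a + ρ * b := by
    field_simp
    ring
  rw [this]
  have h3 : ρ * |Real.log ρ| ≤ c := by nlinarith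
  have h4 : ρ ≤ c := by nlinarith
  gcongr

/-- If the logarithm is multiplied by a function that vanishes at the origin, then the
derivative has only a logarithmic singularity. -/
lemma IsLogProfile.exists_bound_deriv_of_zero {f : ℝ → ℂ} (hf : IsLogProfile f 0) (R : ℝ) :
    ∃ C, 0 ≤ C ∧ ∀ ρ, 0 < ρ → ρ ≤ R → ‖deriv f ρ‖ ≤ C * (1 + |Real.log ρ|) := by
  obtain ⟨A, B, hA, hB, hA0, h⟩ := hf
  obtain ⟨a', ha0', ha'⟩ := exists_bound_Icc (contDiff_deriv hA).continuous R
  obtain ⟨b, hb0, hb⟩ := exists_bound_Icc (contDiff_deriv hB).continuous R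
  refine ⟨a' + b, by positivity, fun ρ h0 h1 => ?_⟩
  rw [(deriv_log_mul_add h0 h (hA.differentiable (by simp) ρ).hasDerivAt
    (hB.differentiable (by simp) ρ).hasDerivAt).deriv]
  have hl := abs_nonneg (Real.log ρ)
  have hn : ‖(ρ : ℂ)‖ = ρ := by rw [Complex.norm_real, Real.norm_of_nonneg h0.le]
  -- As A(0) = 0, the mean value inequality makes A(ρ)/ρ bounded; this removes the 1/ρ singularity
  -- that the derivative of the logarithm would create.
  have hA1 : ‖A ρ‖ ≤ a' * ρ := by
    have := (convex_Icc (0 : ℝ) R).norm_image_sub_le_of_norm_deriv_le (f := A) (C := a')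
      (fun x _ => hA.differentiable (by simp) x) (fun x hx => ha' x hx.1 hx.2)
      (Set.left_mem_Icc.mpr (h0.le.trans h1)) ⟨h0.le, h1⟩
    rwa [hA0, sub_zero, sub_zero, Real.norm_of_nonneg h0.le] at this
  calc ‖(Real.log ρ : ℂ) * deriv A ρ + (A ρ / ρ + deriv B ρ)‖
      ≤ |Real.log ρ| * a' + (a' + b) := by
        refine (norm_add_le _ _).trans (add_le_add ?_ ((norm_add_le _ _).trans (add_le_add ?_ ?_)))
        · rw [norm_mul, norm_ofReal_log]; gcongr; exact ha' ρ h0.le h1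
        · rw [norm_div, hn, div_le_iff₀ h0]; exact hA1
        · exact hb ρ h0.le h1
    _ ≤ (a' + b) * (1 + |Real.log ρ|) := by nlinarith

/-! ### The radial profile of the Helmholtz fundamental solution -/

/-- The coefficient of the logarithm in the radial profile. -/
def profileA (k : ℂ) (ρ : ℝ) : ℂ := -(1 / (4 * Real.pi)) * powerSum coeffJ (k ^ 2 / 4 * ρ)

/-- The constant in the smooth part of the radial profile. -/
def profileC (k : ℂ) : ℂ :=
  Complex.I / 4 - (Complex.log (k / 2) + (Real.eulerMascheroniConstant : ℂ)) / (2 * Real.pi)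

/-- The smooth part of the radial profile. -/
def profileB (k : ℂ) (ρ : ℝ) : ℂ :=
  profileC k * powerSum coeffJ (k ^ 2 / 4 * ρ)
    + 1 / (2 * Real.pi) * powerSum coeffH (k ^ 2 / 4 * ρ)

/-- The Helmholtz fundamental solution as a function of the squared distance. -/
def profile (k : ℂ) (ρ : ℝ) : ℂ := Real.log ρ * profileA k ρ + profileB k ρ

/-- The leading coefficient does not depend on k, so a combination of such profiles loses its
leading logarithm exactly when its coefficients sum to zero. -/
lemma isLogProfile_profile (k : ℂ) : IsLogProfile (profile k) (-(1 / (4 * Real.pi))) := by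
  refine ⟨profileA k, profileB k, contDiff_const.mul (factorialBound_coeffJ.contDiff _),
    (contDiff_const.mul (factorialBound_coeffJ.contDiff _)).add
      (contDiff_const.mul (factorialBound_coeffH.contDiff _)), ?_, fun ρ _ => rfl⟩
  have : powerSum coeffJ 0 = 1 := by
    rw [powerSum, tsum_eq_single 0 (fun m hm => by simp [hm])]
    simp [coeffJ]
  simp [profileA, this]

/-- The Bessel equation in the variable `ρ = r²`. -/
lemma profile_ode (k : ℂ) {ρ : ℝ} (hρ : 0 < ρ) :
    HasDerivAt (deriv (profile k)) (-(deriv (profile k) ρ + k ^ 2 / 4 * profile k ρ) / ρ) ρ := by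
  set c := k ^ 2 / 4 with hc
  have hρ0 : (ρ : ℂ) ≠ 0 := by exact_mod_cast hρ.ne'
  have hπ : (Real.pi : ℂ) ≠ 0 := by exact_mod_cast Real.pi_ne_zero
  set F := powerSum coeffJ
  set F1 := powerSum (derivCoeff coeffJ)
  set F2 := powerSum (derivCoeff (derivCoeff coeffJ))
  set H := powerSum coeffH
  set H1 := powerSum (derivCoeff coeffH)
  set H2 := powerSum (derivCoeff (derivCoeff coeffH))
  have dF : ∀ x : ℝ, HasDerivAt (fun ρ : ℝ => F (c * ρ)) (c * F1 (c * x)) x := fun x =>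
    factorialBound_coeffJ.hasDerivAt_ofReal c x
  have dF1 : ∀ x : ℝ, HasDerivAt (fun ρ : ℝ => F1 (c * ρ)) (c * F2 (c * x)) x := fun x =>
    factorialBound_coeffJ.derivCoeff.hasDerivAt_ofReal c x
  have dH : ∀ x : ℝ, HasDerivAt (fun ρ : ℝ => H (c * ρ)) (c * H1 (c * x)) x := fun x =>
    factorialBound_coeffH.hasDerivAt_ofReal c x
  have dH1 : ∀ x : ℝ, HasDerivAt (fun ρ : ℝ => H1 (c * ρ)) (c * H2 (c * x)) x := fun x =>
    factorialBound_coeffH.derivCoeff.hasDerivAt_ofReal c x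
  have eF : c * ρ * F2 (c * ρ) + F1 (c * ρ) + F (c * ρ) = 0 := by
    have := bessel_powerSum (r := fun _ => 0) factorialBound_coeffJ bessel_coeffJ (c * ρ)
    rw [this, powerSum]; simp
  have eH : c * ρ * H2 (c * ρ) + H1 (c * ρ) + H (c * ρ) = F1 (c * ρ) :=
    bessel_powerSum factorialBound_coeffH bessel_coeffH (c * ρ)
  have h1 : ∀ x : ℝ, 0 < x → deriv (profile k) x =
      Real.log x * (-(1 / (4 * Real.pi)) * (c * F1 (c * x)))
        + (profileA k x / x + (profileC k * (c * F1 (c * x))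
          + 1 / (2 * Real.pi) * (c * H1 (c * x)))) := fun x hx =>
    (deriv_log_mul_add hx (fun _ _ => rfl) ((dF x).const_mul _)
      (((dF x).const_mul _).add ((dH x).const_mul _))).deriv
  have dρ : HasDerivAt (fun x : ℝ => (x : ℂ)) 1 ρ := by
    simpa using (hasDerivAt_id ρ).ofReal_comp
  have h2 := deriv_log_mul_add hρ h1 (((dF1 ρ).const_mul c).const_mul _)
    ((((dF ρ).const_mul (-(1 / (4 * Real.pi : ℂ)))).div dρ hρ0).add
      ((((dF1 ρ).const_mul c).const_mul (profileC k)).add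
        (((dH1 ρ).const_mul c).const_mul (1 / (2 * Real.pi : ℂ)))))
  convert h2 using 1
  rw [h1 ρ hρ]
  simp only [profile, profileA, profileB]
  change -(_ + c * (_ * (_ * F (c * ρ)) + (_ * F (c * ρ) + _ * H (c * ρ)))) / _ = _
  -- Once `F` and `H` are eliminated by the Bessel equations, a rational identity in their
  -- derivatives remains. The cross term 2A' of the logarithm cancels against the source `F1` in
  -- `eH`.
  have eF' : F (c * ρ) = -(c * ρ * F2 (c * ρ) + F1 (c * ρ)) := by linear_combination eF
  have eH' : H (c * ρ) = F1 (c * ρ) - (c * ρ * H2 (c * ρ) + H1 (c * ρ)) := by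
    linear_combination eH
  rw [eH']
  change -(_ + (-(1 / (4 * Real.pi)) * F (c * ρ) / ρ + _) + _) / _ = _
  rw [eF']
  field_simp
  ring

/-- Multiplication by a positive real does not move the argument, so the principal logarithm of kr/2
splits as log r + log(k/2); the factor k ≠ 0 is needed here. With log r² = 2 log r, the coefficient
1/(2π) becomes 1/(4π). -/
lemma helmholtz_eq_profile {k : ℂ} (hk : k ≠ 0) {r : ℝ} (hr : 0 < r) :
    Complex.I / 4 * hankelH0 (k * r) = profile k (r ^ 2) := by
  have hw : (k * r) ^ 2 / 4 = k ^ 2 / 4 * ((r ^ 2 : ℝ) : ℂ) := by push_cast; ring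
  have hlog : Complex.log (k * r / 2) = Real.log r + Complex.log (k / 2) := by
    rw [← Complex.log_ofReal_mul hr (by simpa using hk)]
    congr 1; ring
  have hJ : besselJ0 (k * r) = powerSum coeffJ (k ^ 2 / 4 * ((r ^ 2 : ℝ) : ℂ)) := by
    rw [besselJ0, powerSum, hw]; congr 1; ext m; simp only [coeffJ]; ring
  have hY : besselY0 (k * r) = 2 / (Real.pi : ℂ) *
      ((Real.log r + Complex.log (k / 2) + (Real.eulerMascheroniConstant : ℂ)) *
        powerSum coeffJ (k ^ 2 / 4 * ((r ^ 2 : ℝ) : ℂ)) -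
          powerSum coeffH (k ^ 2 / 4 * ((r ^ 2 : ℝ) : ℂ))) := by
    rw [besselY0, hJ, hlog]
    congr 2
    rw [powerSum, hw]; congr 1; ext m; simp only [coeffH]; ring
  have hπ : (Real.pi : ℂ) ≠ 0 := by exact_mod_cast Real.pi_ne_zero
  rw [hankelH0, hJ, hY, profile, profileA, profileB, profileC, Real.log_pow]
  push_cast
  generalize powerSum coeffJ _ = J
  generalize powerSum coeffH _ = H
  field_simp
  ring_nf
  simp only [Complex.I_sq]
  ring

/-! ### Partial derivatives of radial functions in the plane -/

lemma sum_single_eq (v : Plane) : ∑ i, v i • EuclideanSpace.single i (1 : ℝ) = v := by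
  ext j
  fin_cases j <;> simp [Fin.sum_univ_two]

lemma fderiv_apply_eq_dirDeriv (g : Plane → ℂ) (z v : Plane) :
    fderiv ℝ g z v = dirDeriv v g z := by
  conv_lhs => rw [← sum_single_eq v]
  simp only [map_sum, map_smul, dirDeriv, pd, Complex.real_smul]

lemma abs_apply_le_norm (z : Plane) (i : Fin 2) : |z i| ≤ ‖z‖ := by
  simpa using PiLp.norm_apply_le z i

lemma norm_apply_le_norm (z : Plane) (i : Fin 2) : ‖((z i : ℝ) : ℂ)‖ ≤ ‖z‖ := by
  rw [Complex.norm_real, Real.norm_eq_abs]; exact abs_apply_le_norm z i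

lemma norm_fderiv_le {g : Plane → ℂ} {z : Plane} {C : ℝ} (h : ∀ i, ‖pd i g z‖ ≤ C) :
    ‖fderiv ℝ g z‖ ≤ 2 * C := by
  have hC : 0 ≤ C := (norm_nonneg _).trans (h 0)
  refine ContinuousLinearMap.opNorm_le_bound _ (by positivity) fun v => ?_
  rw [fderiv_apply_eq_dirDeriv, dirDeriv, Fin.sum_univ_two]
  calc _ ≤ ‖v‖ * C + ‖v‖ * C := by
        refine (norm_add_le _ _).trans (add_le_add ?_ ?_) <;> rw [norm_mul] <;>
        exact mul_le_mul (norm_apply_le_norm v _) (h _) (norm_nonneg _) (norm_nonneg _)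
    _ = 2 * C * ‖v‖ := by ring

lemma eventually_ne_zero {z : Plane} (hz : z ≠ 0) : ∀ᶠ w in 𝓝 z, w ≠ 0 :=
  isOpen_ne.mem_nhds hz

lemma pd_congr {f g : Plane → ℂ} {z : Plane} (h : f =ᶠ[𝓝 z] g) (i : Fin 2) :
    pd i f z = pd i g z := by rw [pd, pd, h.fderiv_eq]

lemma pd_congr_of_ne {f g : Plane → ℂ} {z : Plane} (hz : z ≠ 0) (h : ∀ w ≠ 0, f w = g w)
    (i : Fin 2) : pd i f z = pd i g z :=
  pd_congr ((eventually_ne_zero hz).mono fun w hw => h w hw) i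

lemma pd_add {f g : Plane → ℂ} {z : Plane} (hf : DifferentiableAt ℝ f z)
    (hg : DifferentiableAt ℝ g z) (i : Fin 2) :
    pd i (fun w => f w + g w) z = pd i f z + pd i g z := by
  simp only [pd]; rw [fderiv_fun_add hf hg]; rfl

lemma pd_mul {f g : Plane → ℂ} {z : Plane} (hf : DifferentiableAt ℝ f z)
    (hg : DifferentiableAt ℝ g z) (i : Fin 2) :
    pd i (fun w => f w * g w) z = f z * pd i g z + pd i f z * g z := by
  simp only [pd]; rw [fderiv_fun_mul hf hg]; simp [mul_comm]

lemma pd_const_mul {f : Plane → ℂ} {z : Plane} (hf : DifferentiableAt ℝ f z) (c : ℂ)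
    (i : Fin 2) : pd i (fun w => c * f w) z = c * pd i f z := by
  rw [pd_mul (differentiableAt_const c) hf]
  simp [pd]

lemma pd_neg (f : Plane → ℂ) (z : Plane) (i : Fin 2) :
    pd i (fun w => -f w) z = -pd i f z := by
  simp only [pd]; rw [fderiv_fun_neg]; rfl

lemma pd_comp_sub (f : Plane → ℂ) (x y : Plane) (i : Fin 2) :
    pd i (fun w => f (w - y)) x = pd i f (x - y) := by
  simp only [pd]; rw [fderiv_comp_sub]

lemma fderiv_comp_neg' (f : Plane → ℂ) (z : Plane) :
    fderiv ℝ (fun w => f (-w)) z = -fderiv ℝ f (-z) := by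
  have := (ContinuousLinearEquiv.neg ℝ (M := Plane)).comp_right_fderiv (f := f) (x := z)
  have h2 : (fun w => f (-w)) = f ∘ (ContinuousLinearEquiv.neg ℝ (M := Plane)) := by
    ext w; simp
  rw [h2, this]
  ext v; simp

lemma pd_comp_neg (f : Plane → ℂ) (z : Plane) (i : Fin 2) :
    pd i (fun w => f (-w)) z = -pd i f (-z) := by
  simp only [pd]; rw [fderiv_comp_neg']; rfl

lemma pd_comp_const_sub (f : Plane → ℂ) (x y : Plane) (i : Fin 2) :
    pd i (fun w => f (x - w)) y = -pd i f (x - y) := by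
  have h : (fun w => f (x - w)) = fun w => (fun u => f (-u)) (w - x) := by ext w; simp
  rw [h, pd_comp_sub (fun u => f (-u)), pd_comp_neg]; simp

lemma pd_coord (z : Plane) (i j : Fin 2) :
    pd j (fun w => ((w i : ℝ) : ℂ)) z = if i = j then 1 else 0 := by
  have h : HasFDerivAt (fun w : Plane => ((w i : ℝ) : ℂ))
      (Complex.ofRealCLM.comp (EuclideanSpace.proj i : Plane →L[ℝ] ℝ)) z :=
    (Complex.ofRealCLM.comp (EuclideanSpace.proj i : Plane →L[ℝ] ℝ)).hasFDerivAt
  rw [pd, h.fderiv]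
  by_cases hij : i = j <;> simp [hij]

lemma differentiableAt_coord (z : Plane) (i : Fin 2) :
    DifferentiableAt ℝ (fun w : Plane => ((w i : ℝ) : ℂ)) z :=
  (Complex.ofRealCLM.comp (EuclideanSpace.proj i : Plane →L[ℝ] ℝ)).differentiableAt

lemma normSq_pos {z : Plane} (hz : z ≠ 0) : 0 < ‖z‖ ^ 2 := by positivity

lemma pd_radial {g : Plane → ℂ} {f : ℝ → ℂ} (hg : ∀ z ≠ 0, g z = f (‖z‖ ^ 2)) {z : Plane}
    (hz : z ≠ 0) {f' : ℂ} (hf : HasDerivAt f f' (‖z‖ ^ 2)) (i : Fin 2) :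
    pd i g z = 2 * (z i : ℂ) * f' := by
  rw [pd_congr_of_ne hz hg]
  have h : HasFDerivAt (fun w : Plane => f (‖w‖ ^ 2)) _ z :=
    hf.hasFDerivAt.comp z (hasStrictFDerivAt_norm_sq z).hasFDerivAt
  rw [pd, h.fderiv]
  simp
  simp [EuclideanSpace.inner_single_right]
  ring

lemma differentiableAt_comp_norm_sq {f : ℝ → ℂ} {z : Plane}
    (hf : DifferentiableAt ℝ f (‖z‖ ^ 2)) :
    DifferentiableAt ℝ (fun w : Plane => f (‖w‖ ^ 2)) z :=
  DifferentiableAt.comp (g := f) z hf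
    (hasStrictFDerivAt_norm_sq z).hasFDerivAt.differentiableAt

lemma contDiffAt_radial {g : Plane → ℂ} {f : ℝ → ℂ} (hg : ∀ z ≠ 0, g z = f (‖z‖ ^ 2))
    (hf : ∀ ρ, 0 < ρ → ContDiffAt ℝ ∞ f ρ) {z : Plane} (hz : z ≠ 0) : ContDiffAt ℝ ∞ g z := by
  have h : ContDiffAt ℝ ∞ (fun w : Plane => f (‖w‖ ^ 2)) z :=
    (hf _ (normSq_pos hz)).comp z (contDiff_norm_sq ℝ).contDiffAt
  exact h.congr_of_eventuallyEq ((eventually_ne_zero hz).mono fun w hw => hg w hw)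

lemma contDiffAt_fderiv {g : Plane → ℂ} {z : Plane} (hg : ContDiffAt ℝ ∞ g z) :
    ContDiffAt ℝ ∞ (fderiv ℝ g) z := hg.fderiv_right (by simp)

lemma contDiffAt_pd {g : Plane → ℂ} {z : Plane} (hg : ContDiffAt ℝ ∞ g z) (i : Fin 2) :
    ContDiffAt ℝ ∞ (pd i g) z := (contDiffAt_fderiv hg).clm_apply contDiffAt_const

lemma differentiableAt_pd {g : Plane → ℂ} {z : Plane} (hg : ContDiffAt ℝ ∞ g z) (i : Fin 2) :
    DifferentiableAt ℝ (pd i g) z := (contDiffAt_pd hg i).differentiableAt (by simp)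

lemma pd_comm {g : Plane → ℂ} {z : Plane} (hg : ContDiffAt ℝ ∞ g z) (i j : Fin 2) :
    pd i (pd j g) z = pd j (pd i g) z := by
  have hs : IsSymmSndFDerivAt ℝ g z := hg.isSymmSndFDerivAt (by simpa using WithTop.coe_le_coe.mpr (le_top : (2 : ℕ∞) ≤ ⊤))
  have hd : DifferentiableAt ℝ (fderiv ℝ g) z := (contDiffAt_fderiv hg).differentiableAt (by simp)
  have key : ∀ a b : Fin 2, pd a (pd b g) z = fderiv ℝ (fderiv ℝ g) z
      (EuclideanSpace.single a (1 : ℝ)) (EuclideanSpace.single b (1 : ℝ)) := by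
    intro a b
    have : HasFDerivAt (pd b g) _ z :=
      hd.hasFDerivAt.clm_apply (hasFDerivAt_const (EuclideanSpace.single b (1 : ℝ)) z)
    rw [pd, this.fderiv]; simp
  rw [key, key, hs.eq]

/-! ### Radial solutions of an inhomogeneous Laplace equation -/

/-- The radial function with profile `f` satisfies `Δ = -h` away from the origin. -/
def IsHelmholtzProfile (f h : ℝ → ℂ) : Prop :=
  ∀ ρ : ℝ, 0 < ρ → HasDerivAt (deriv f) (-(deriv f ρ + h ρ / 4) / ρ) ρ

lemma isHelmholtzProfile_profile (k : ℂ) :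
    IsHelmholtzProfile (profile k) fun ρ => k ^ 2 * profile k ρ := by
  intro ρ hρ
  convert profile_ode k hρ using 1
  ring

lemma IsHelmholtzProfile.add {f g h l : ℝ → ℂ} {a b : ℂ} (hf : IsHelmholtzProfile f h)
    (hg : IsHelmholtzProfile g l) (hf' : IsLogProfile f a) (hg' : IsLogProfile g b) :
    IsHelmholtzProfile (fun ρ => f ρ + g ρ) fun ρ => h ρ + l ρ := by
  have e : ∀ ρ : ℝ, 0 < ρ → deriv (fun ρ => f ρ + g ρ) ρ = deriv f ρ + deriv g ρ := fun ρ hρ =>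
    ((hf'.hasDerivAt hρ).add (hg'.hasDerivAt hρ)).deriv
  intro ρ hρ
  have h2 := ((hf ρ hρ).add (hg ρ hρ)).congr_of_eventuallyEq
    (f₁ := deriv (fun ρ => f ρ + g ρ)) (by filter_upwards [lt_mem_nhds hρ] with x hx using e x hx)
  refine h2.congr_deriv ?_
  rw [e ρ hρ]; ring

lemma IsHelmholtzProfile.const_mul {f h : ℝ → ℂ} {a : ℂ} (hf : IsHelmholtzProfile f h)
    (hf' : IsLogProfile f a) (c : ℂ) :
    IsHelmholtzProfile (fun ρ => c * f ρ) fun ρ => c * h ρ := by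
  have e : ∀ ρ : ℝ, 0 < ρ → deriv (fun ρ => c * f ρ) ρ = c * deriv f ρ := fun ρ hρ =>
    ((hf'.hasDerivAt hρ).const_mul c).deriv
  intro ρ hρ
  have h2 := ((hf ρ hρ).const_mul c).congr_of_eventuallyEq
    (f₁ := deriv (fun ρ => c * f ρ)) (by filter_upwards [lt_mem_nhds hρ] with x hx using e x hx)
  refine h2.congr_deriv ?_
  rw [e ρ hρ]; ring

lemma pd_pd_radial {g : Plane → ℂ} {f : ℝ → ℂ} {a : ℂ} (hg : ∀ z ≠ 0, g z = f (‖z‖ ^ 2))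
    (hf : IsLogProfile f a) {z : Plane} (hz : z ≠ 0) {f'' : ℂ}
    (h2 : HasDerivAt (deriv f) f'' (‖z‖ ^ 2)) (i j : Fin 2) :
    pd i (pd j g) z = 2 * (if j = i then 1 else 0) * deriv f (‖z‖ ^ 2)
      + 4 * (z j : ℂ) * (z i : ℂ) * f'' := by
  have h1 : ∀ w ≠ 0, pd j g w = 2 * ((w j : ℂ) * deriv f (‖w‖ ^ 2)) := fun w hw => by
    rw [pd_radial hg hw (hf.hasDerivAt (normSq_pos hw)), mul_assoc]
  have hd : DifferentiableAt ℝ (fun w : Plane => deriv f (‖w‖ ^ 2)) z :=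
    differentiableAt_comp_norm_sq h2.differentiableAt
  rw [pd_congr_of_ne hz h1, pd_const_mul ((differentiableAt_coord z j).fun_mul hd),
    pd_mul (differentiableAt_coord z j) hd, pd_coord, pd_radial (fun _ _ => rfl) hz h2]
  ring

/-- In the variable ρ = |z|² the planar Laplacian is 4(ρf'' + f'). -/
lemma laplacian_radial {g : Plane → ℂ} {f h : ℝ → ℂ} {a : ℂ} (hg : ∀ z ≠ 0, g z = f (‖z‖ ^ 2))
    (hf : IsLogProfile f a) (hh : IsHelmholtzProfile f h) {z : Plane} (hz : z ≠ 0) :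
    pd 0 (pd 0 g) z + pd 1 (pd 1 g) z = -h (‖z‖ ^ 2) := by
  have h2 := hh _ (normSq_pos hz)
  rw [pd_pd_radial hg hf hz h2, pd_pd_radial hg hf hz h2]
  have hn : ((‖z‖ ^ 2 : ℝ) : ℂ) = (z 0 : ℂ) ^ 2 + (z 1 : ℂ) ^ 2 := by
    rw [EuclideanSpace.norm_sq_eq, Fin.sum_univ_two]; simp
  have hne : ((‖z‖ ^ 2 : ℝ) : ℂ) ≠ 0 := by exact_mod_cast (normSq_pos hz).ne'
  have : (4 * (z 0 : ℂ) * (z 0 : ℂ) + 4 * (z 1 : ℂ) * (z 1 : ℂ)) =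
      4 * ((‖z‖ ^ 2 : ℝ) : ℂ) := by rw [hn]; ring
  calc _ = 4 * deriv f (‖z‖ ^ 2) + (4 * (z 0 : ℂ) * (z 0 : ℂ) + 4 * (z 1 : ℂ) * (z 1 : ℂ)) *
        (-(deriv f (‖z‖ ^ 2) + h (‖z‖ ^ 2) / 4) / ((‖z‖ ^ 2 : ℝ) : ℂ)) := by simp; ring
    _ = _ := by rw [this]; field_simp; ring

/-! ### Kernels with a logarithmic singularity -/

/-- Even functions in the plane, smooth away from the origin, that are `O(log |z|)` there and
whose derivatives are `O(log |z| / |z|)`. -/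
structure LogKernel (M : Plane → ℂ) : Prop where
  contDiffAt : ∀ z ≠ 0, ContDiffAt ℝ ∞ M z
  even : ∀ z, M (-z) = M z
  bound : ∀ R : ℝ, ∃ C, 0 ≤ C ∧ ∀ z : Plane, z ≠ 0 → ‖z‖ ≤ R →
    ‖M z‖ ≤ C * (1 + |Real.log ‖z‖|) ∧ ‖fderiv ℝ M z‖ ≤ C * (1 + |Real.log ‖z‖|) / ‖z‖

lemma LogKernel.add {M N : Plane → ℂ} (hM : LogKernel M) (hN : LogKernel N) :
    LogKernel fun z => M z + N z := by
  refine ⟨fun z hz => (hM.contDiffAt z hz).add (hN.contDiffAt z hz),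
    fun z => by rw [hM.even, hN.even], fun R => ?_⟩
  obtain ⟨C, hC, h⟩ := hM.bound R
  obtain ⟨C', hC', h'⟩ := hN.bound R
  refine ⟨C + C', by positivity, fun z hz hR => ⟨?_, ?_⟩⟩
  · refine (norm_add_le _ _).trans ((add_le_add (h z hz hR).1 (h' z hz hR).1).trans_eq ?_)
    ring
  · rw [fderiv_fun_add ((hM.contDiffAt z hz).differentiableAt (by simp))
      ((hN.contDiffAt z hz).differentiableAt (by simp))]
    refine (norm_add_le _ _).trans ((add_le_add (h z hz hR).2 (h' z hz hR).2).trans_eq ?_)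
    ring

lemma LogKernel.const_mul {M : Plane → ℂ} (hM : LogKernel M) (c : ℂ) :
    LogKernel fun z => c * M z := by
  refine ⟨fun z hz => contDiffAt_const.mul (hM.contDiffAt z hz), fun z => by rw [hM.even],
    fun R => ?_⟩
  obtain ⟨C, hC, h⟩ := hM.bound R
  refine ⟨‖c‖ * C, by positivity, fun z hz hR => ⟨?_, ?_⟩⟩
  · rw [norm_mul, mul_assoc]; gcongr; exact (h z hz hR).1
  · rw [fderiv_const_mul ((hM.contDiffAt z hz).differentiableAt (by simp)), norm_smul, mul_assoc,
      mul_div_assoc]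
    gcongr; exact (h z hz hR).2

lemma one_add_abs_log_sq_le (r : ℝ) :
    1 + |Real.log (r ^ 2)| ≤ 2 * (1 + |Real.log r|) := by
  rw [Real.log_pow, abs_mul]; norm_num; linarith

/-- The gradient is 2z f'(|z|²) with f' = O(1/ρ), hence O(1/|z|), which is better than `LogKernel`
demands. -/
lemma logKernel_radial {g : Plane → ℂ} {f : ℝ → ℂ} {a : ℂ} (hg : ∀ z ≠ 0, g z = f (‖z‖ ^ 2))
    (hf : IsLogProfile f a) : LogKernel g := by
  refine ⟨fun z hz => contDiffAt_radial hg (fun ρ hρ => hf.contDiffAt hρ) hz, fun z => ?_,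
    fun R => ?_⟩
  · by_cases hz : z = 0
    · simp [hz]
    · rw [hg z hz, hg (-z) (neg_ne_zero.mpr hz), norm_neg]
  obtain ⟨C, hC, h⟩ := hf.exists_bound (R ^ 2)
  obtain ⟨C', hC', h'⟩ := hf.exists_bound_deriv (R ^ 2)
  refine ⟨2 * C + 4 * C', by positivity, fun z hz hR => ?_⟩
  have hz0 : 0 < ‖z‖ := norm_pos_iff.mpr hz
  have hR2 : ‖z‖ ^ 2 ≤ R ^ 2 := by gcongr
  have hl := abs_nonneg (Real.log ‖z‖)
  constructor
  · rw [hg z hz]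
    refine (h _ (normSq_pos hz) hR2).trans ?_
    have := mul_le_mul_of_nonneg_left (one_add_abs_log_sq_le ‖z‖) hC
    nlinarith
  · have hp : ∀ i, ‖pd i g z‖ ≤ 2 * C' / ‖z‖ := fun i => by
      rw [pd_radial hg hz (hf.hasDerivAt (normSq_pos hz)), norm_mul, norm_mul]
      calc ‖(2 : ℂ)‖ * ‖((z i : ℝ) : ℂ)‖ * ‖deriv f (‖z‖ ^ 2)‖
          ≤ 2 * ‖z‖ * (C' / ‖z‖ ^ 2) := by
            gcongr
            · simp
            · exact norm_apply_le_norm z i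
            · exact h' _ (normSq_pos hz) hR2
        _ = 2 * C' / ‖z‖ := by field_simp
    refine (norm_fderiv_le hp).trans ?_
    rw [← mul_div_assoc]
    refine div_le_div_of_nonneg_right ?_ hz0.le
    nlinarith

/-- Without the leading logarithm f' is only O(log ρ), so the gradient even tends to 0 at the
origin. This makes the kernel of `N22` bounded and removes the diagonal from the integration by
parts. -/
lemma norm_pd_radial_le {g : Plane → ℂ} {f : ℝ → ℂ} (hg : ∀ z ≠ 0, g z = f (‖z‖ ^ 2))
    (hf : IsLogProfile f 0) (R : ℝ) :
    ∃ C, 0 ≤ C ∧ ∀ z : Plane, z ≠ 0 → ‖z‖ ≤ R → ∀ i,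
      ‖pd i g z‖ ≤ C * (‖z‖ * (1 + |Real.log ‖z‖|)) := by
  obtain ⟨C, hC, h⟩ := hf.exists_bound_deriv_of_zero (R ^ 2)
  refine ⟨4 * C, by positivity, fun z hz hR i => ?_⟩
  have hR2 : ‖z‖ ^ 2 ≤ R ^ 2 := by gcongr
  rw [pd_radial hg hz (hf.hasDerivAt (normSq_pos hz)), norm_mul, norm_mul]
  calc ‖(2 : ℂ)‖ * ‖((z i : ℝ) : ℂ)‖ * ‖deriv f (‖z‖ ^ 2)‖
      ≤ 2 * ‖z‖ * (C * (2 * (1 + |Real.log ‖z‖|))) := by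
        gcongr
        · simp
        · exact norm_apply_le_norm z i
        · exact (h _ (normSq_pos hz) hR2).trans
            (mul_le_mul_of_nonneg_left (one_add_abs_log_sq_le ‖z‖) hC)
    _ = 4 * C * (‖z‖ * (1 + |Real.log ‖z‖|)) := by ring

/-- The gradient of a radial function points along z, so its component along n carries the factor
⟨n, z⟩. The factor is kept because, for a normal n and a chord z of a smooth curve, it is O(|z|²)
and compensates the denominator. -/
lemma norm_dirDeriv_radial_le {g : Plane → ℂ} {f : ℝ → ℂ} {a : ℂ}
    (hg : ∀ z ≠ 0, g z = f (‖z‖ ^ 2)) (hf : IsLogProfile f a) (R : ℝ) :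
    ∃ C, 0 ≤ C ∧ ∀ z : Plane, z ≠ 0 → ‖z‖ ≤ R → ∀ n : Plane,
      ‖dirDeriv n g z‖ ≤ C * |inner ℝ n z| / ‖z‖ ^ 2 := by
  obtain ⟨C, hC, h⟩ := hf.exists_bound_deriv (R ^ 2)
  refine ⟨2 * C, by positivity, fun z hz hR n => ?_⟩
  have hR2 : ‖z‖ ^ 2 ≤ R ^ 2 := by gcongr
  have e : dirDeriv n g z = 2 * ((inner ℝ n z : ℝ) : ℂ) * deriv f (‖z‖ ^ 2) := by
    simp only [dirDeriv, Fin.sum_univ_two, PiLp.inner_apply,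
      pd_radial hg hz (hf.hasDerivAt (normSq_pos hz))]
    simp
    ring
  rw [e, norm_mul, norm_mul, Complex.norm_real, Real.norm_eq_abs]
  calc ‖(2 : ℂ)‖ * |inner ℝ n z| * ‖deriv f (‖z‖ ^ 2)‖
      ≤ 2 * |inner ℝ n z| * (C / ‖z‖ ^ 2) := by
        gcongr
        · simp
        · exact h _ (normSq_pos hz) hR2
    _ = _ := by ring

/-- The cancellation gives f' = O(log ρ), and the equation supplies f'' = −(f' + h/4)/ρ and then
f''' = −(2f'' + h'/4)/ρ: each further derivative costs one factor 1/ρ and no power of the logarithm.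
Since ∂ᵢ∂ⱼg = 2δᵢⱼf' + 4zᵢzⱼf'', the quadratic factor restores a logarithm, and one more derivative
costs 1/|z|. Evenness holds because g is even and it is differentiated twice. -/
lemma logKernel_pd_pd_radial {g : Plane → ℂ} {f h : ℝ → ℂ} {b : ℂ}
    (hg : ∀ z ≠ 0, g z = f (‖z‖ ^ 2)) (hf : IsLogProfile f 0) (hh : IsHelmholtzProfile f h)
    (hl : IsLogProfile h b) (i j : Fin 2) : LogKernel (pd i (pd j g)) := by
  have hs : ∀ z ≠ 0, ContDiffAt ℝ ∞ g z := fun z hz =>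
    contDiffAt_radial hg (fun ρ hρ => hf.contDiffAt hρ) hz
  have hge : (fun w => g (-w)) = g := by
    ext z
    exact (logKernel_radial hg hf).even z
  refine ⟨fun z hz => contDiffAt_pd (contDiffAt_pd (hs z hz) j) i, fun z => ?_, fun R => ?_⟩
  · have h1 : ∀ w, pd j g (-w) = -pd j g w := fun w => by
      have := pd_comp_neg g w j
      rw [hge] at this
      rw [this, neg_neg]
    have h2 := pd_comp_neg (pd j g) z i
    have h3 : (fun w => pd j g (-w)) = fun w => -pd j g w := funext h1
    rw [h3, pd_neg] at h2
    exact (neg_injective h2).symm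
  obtain ⟨C₁, hC₁, h₁⟩ := hf.exists_bound_deriv_of_zero (R ^ 2)
  obtain ⟨C₂, hC₂, h₂⟩ := hl.exists_bound (R ^ 2)
  obtain ⟨C₃, hC₃, h₃⟩ := hl.exists_bound_deriv (R ^ 2)
  set f₂ : ℝ → ℂ := fun ρ => -(deriv f ρ + h ρ / 4) / ρ with hf₂
  have d3 : ∀ ρ : ℝ, 0 < ρ → HasDerivAt f₂ (-(2 * f₂ ρ + deriv h ρ / 4) / ρ) ρ := fun ρ hρ => by
    have hρ0 : (ρ : ℂ) ≠ 0 := by exact_mod_cast hρ.ne'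
    have dρ : HasDerivAt (fun x : ℝ => (x : ℂ)) 1 ρ := by
      simpa using (hasDerivAt_id ρ).ofReal_comp
    have := (((hh ρ hρ).add ((hl.hasDerivAt hρ).div_const 4)).neg).div dρ hρ0
    refine this.congr_deriv ?_
    simp only [hf₂, Pi.neg_apply, Pi.add_apply]
    field_simp
    ring
  have b2 : ∀ ρ, 0 < ρ → ρ ≤ R ^ 2 → ‖f₂ ρ‖ ≤ (C₁ + C₂) * (1 + |Real.log ρ|) / ρ := by
    intro ρ h0 hR
    have hn : ‖(ρ : ℂ)‖ = ρ := by rw [Complex.norm_real, Real.norm_of_nonneg h0.le]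
    simp only [hf₂]
    rw [norm_div, norm_neg, hn]
    gcongr
    refine (norm_add_le _ _).trans ?_
    have e1 := h₁ ρ h0 hR
    have e2 := h₂ ρ h0 hR
    rw [norm_div]
    have : ‖(4 : ℂ)‖ = 4 := by simp
    rw [this]
    have := norm_nonneg (h ρ)
    linarith
  have b3 : ∀ ρ, 0 < ρ → ρ ≤ R ^ 2 → ‖-(2 * f₂ ρ + deriv h ρ / 4) / ρ‖ ≤
      (2 * (C₁ + C₂) + C₃) * (1 + |Real.log ρ|) / ρ ^ 2 := by
    intro ρ h0 hR
    have hn : ‖(ρ : ℂ)‖ = ρ := by rw [Complex.norm_real, Real.norm_of_nonneg h0.le]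
    have e1 := b2 ρ h0 hR
    have e2 := h₃ ρ h0 hR
    have hl := abs_nonneg (Real.log ρ)
    rw [norm_div, norm_neg, hn, pow_two, ← div_div]
    gcongr
    refine (norm_add_le _ _).trans ?_
    rw [norm_div, norm_mul]
    have : ‖(4 : ℂ)‖ = 4 := by simp
    rw [this]
    have : ‖(2 : ℂ)‖ = 2 := by simp
    rw [this]
    have h5 : C₃ / ρ ≤ C₃ * (1 + |Real.log ρ|) / ρ := by
      gcongr; nlinarith
    have h6 := norm_nonneg (deriv h ρ)
    calc 2 * ‖f₂ ρ‖ + ‖deriv h ρ‖ / 4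
        ≤ 2 * ((C₁ + C₂) * (1 + |Real.log ρ|) / ρ) + C₃ * (1 + |Real.log ρ|) / ρ := by linarith
      _ = _ := by ring
  -- `K` bounds 2δf' + 4zzf''. In `K'`, the three kinds of f'' terms produced by the product rule
  -- contribute 4 each, and the f''' term contributes 8.
  set K := 2 * C₁ + 4 * (C₁ + C₂) with hK
  set K' := 12 * (C₁ + C₂) + 8 * (2 * (C₁ + C₂) + C₃) with hK'
  have hKK : 0 ≤ K := by positivity
  have hKK' : 0 ≤ K' := by positivity
  -- One factor 2 comes from replacing log |z|² by log |z|; for the gradient, a second one from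
  -- passing from partial derivatives to the operator norm.
  refine ⟨2 * K + 4 * K', by positivity, fun z hz hR => ?_⟩
  have hz0 : 0 < ‖z‖ := norm_pos_iff.mpr hz
  have hR2 : ‖z‖ ^ 2 ≤ R ^ 2 := by gcongr
  have hlg := one_add_abs_log_sq_le ‖z‖
  have hlg0 := abs_nonneg (Real.log ‖z‖)
  have hlg1 := abs_nonneg (Real.log (‖z‖ ^ 2))
  set ℓ := 1 + |Real.log (‖z‖ ^ 2)| with hℓ
  have hℓ0 : 0 ≤ ℓ := by positivity
  have c1 := h₁ _ (normSq_pos hz) hR2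
  have c2 := b2 _ (normSq_pos hz) hR2
  have c3 := b3 _ (normSq_pos hz) hR2
  have hδ : ∀ a b : Fin 2, ‖(if a = b then (1 : ℂ) else 0)‖ ≤ 1 := fun a b => by
    split_ifs <;> simp
  have n2 : ‖(2 : ℂ)‖ = 2 := by simp
  have n4 : ‖(4 : ℂ)‖ = 4 := by simp
  have z1 := norm_apply_le_norm z
  constructor
  · rw [pd_pd_radial hg hf hz (hh _ (normSq_pos hz))]
    refine (norm_add_le _ _).trans ?_
    simp only [norm_mul, n2, n4]
    calc _ ≤ 2 * 1 * (C₁ * ℓ) + 4 * ‖z‖ * ‖z‖ * ((C₁ + C₂) * ℓ / ‖z‖ ^ 2) := by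
          gcongr
          · exact hδ _ _
          · exact z1 _
          · exact z1 _
      _ = K * ℓ := by rw [hK]; field_simp
      _ ≤ (2 * K + 4 * K') * (1 + |Real.log ‖z‖|) := by nlinarith
  · have e : ∀ w ≠ 0, pd i (pd j g) w = 2 * (if j = i then 1 else 0) * deriv f (‖w‖ ^ 2)
        + 4 * ((w j : ℂ) * ((w i : ℂ) * f₂ (‖w‖ ^ 2))) := fun w hw => by
      rw [pd_pd_radial hg hf hw (hh _ (normSq_pos hw))]; ring
    have hd1 : HasDerivAt (deriv f) (f₂ (‖z‖ ^ 2)) (‖z‖ ^ 2) := hh _ (normSq_pos hz)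
    have hd2 := d3 _ (normSq_pos hz)
    set f₃ : ℂ := -(2 * f₂ (‖z‖ ^ 2) + deriv h (‖z‖ ^ 2) / 4) / ((‖z‖ ^ 2 : ℝ) : ℂ)
    have D1 : DifferentiableAt ℝ (fun w : Plane => deriv f (‖w‖ ^ 2)) z :=
      differentiableAt_comp_norm_sq hd1.differentiableAt
    have D2 : DifferentiableAt ℝ (fun w : Plane => f₂ (‖w‖ ^ 2)) z :=
      differentiableAt_comp_norm_sq hd2.differentiableAt
    have D3 := differentiableAt_coord z
    have hp : ∀ l, ‖pd l (pd i (pd j g)) z‖ ≤ K' * ℓ / ‖z‖ := fun l => by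
      rw [pd_congr_of_ne hz e, pd_add (D1.const_mul _) (((D3 j).fun_mul ((D3 i).fun_mul D2)).const_mul _),
        pd_const_mul D1, pd_const_mul ((D3 j).fun_mul ((D3 i).fun_mul D2)), pd_mul (D3 j) ((D3 i).fun_mul D2),
        pd_mul (D3 i) D2, pd_coord, pd_coord, pd_radial (fun _ _ => rfl) hz hd1,
        pd_radial (fun _ _ => rfl) hz hd2]
      refine (norm_add_le _ _).trans ?_
      simp only [norm_mul, n2, n4]
      calc _ ≤ 2 * 1 * (2 * ‖z‖ * ((C₁ + C₂) * ℓ / ‖z‖ ^ 2)) + 4 * (‖z‖ * (‖z‖ * (2 * ‖z‖ *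
            ((2 * (C₁ + C₂) + C₃) * ℓ / (‖z‖ ^ 2) ^ 2)) + 1 * ((C₁ + C₂) * ℓ / ‖z‖ ^ 2))
              + 1 * (‖z‖ * ((C₁ + C₂) * ℓ / ‖z‖ ^ 2))) := by
            gcongr
            · exact hδ _ _
            · exact z1 _
            · refine (norm_add_le _ _).trans ?_
              simp only [norm_mul]
              gcongr
              · exact z1 _
              · refine (norm_add_le _ _).trans ?_
                simp only [norm_mul, n2]
                gcongr
                · exact z1 _
                · exact z1 _
                · exact hδ _ _
              · exact hδ _ _
              · exact z1 _
        _ = K' * ℓ / ‖z‖ := by rw [hK']; field_simp; ring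
    refine (norm_fderiv_le hp).trans ?_
    rw [← mul_div_assoc]
    refine div_le_div_of_nonneg_right ?_ hz0.le
    nlinarith

/-! ### The Helmholtz fundamental solution as a function of the difference -/

/-- The Helmholtz fundamental solution as a function of `z = x - y`. -/
def hk (k : ℂ) (z : Plane) : ℂ := Complex.I / 4 * hankelH0 (k * ((‖z‖ : ℝ) : ℂ))

lemma helmholtz_eq (k : ℂ) (x y : Plane) : helmholtz k x y = hk k (x - y) := rfl

lemma hk_eq_profile {k : ℂ} (hk0 : k ≠ 0) (z : Plane) (hz : z ≠ 0) :
    hk k z = profile k (‖z‖ ^ 2) :=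
  helmholtz_eq_profile hk0 (norm_pos_iff.mpr hz)

lemma contDiffAt_hk {k : ℂ} (hk0 : k ≠ 0) {z : Plane} (hz : z ≠ 0) : ContDiffAt ℝ ∞ (hk k) z :=
  contDiffAt_radial (hk_eq_profile hk0) (fun _ hρ => (isLogProfile_profile k).contDiffAt hρ) hz

/-- A linear combination of three Helmholtz fundamental solutions. -/
def comb (c k : Fin 3 → ℂ) (z : Plane) : ℂ :=
  c 0 * hk (k 0) z + c 1 * hk (k 1) z + c 2 * hk (k 2) z

/-- The radial profile of `comb`. -/
def combProfile (c k : Fin 3 → ℂ) (ρ : ℝ) : ℂ :=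
  c 0 * profile (k 0) ρ + c 1 * profile (k 1) ρ + c 2 * profile (k 2) ρ

lemma comb_eq_profile (c : Fin 3 → ℂ) {k : Fin 3 → ℂ} (hk0 : ∀ i, k i ≠ 0) (z : Plane)
    (hz : z ≠ 0) : comb c k z = combProfile c k (‖z‖ ^ 2) := by
  simp only [comb, combProfile, hk_eq_profile (hk0 _) z hz]

lemma isLogProfile_comb (c k : Fin 3 → ℂ) :
    IsLogProfile (combProfile c k) (-(1 / (4 * Real.pi)) * (c 0 + c 1 + c 2)) := by
  have := (((isLogProfile_profile (k 0)).const_mul (c 0)).add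
    ((isLogProfile_profile (k 1)).const_mul (c 1))).add
    ((isLogProfile_profile (k 2)).const_mul (c 2))
  have e : -(1 / (4 * Real.pi)) * (c 0 + c 1 + c 2) = c 0 * -(1 / (4 * (Real.pi : ℂ)))
      + c 1 * -(1 / (4 * Real.pi)) + c 2 * -(1 / (4 * Real.pi)) := by ring
  rw [e]
  exact this

lemma isLogProfile_comb_zero {c k : Fin 3 → ℂ} (hc : c 0 + c 1 + c 2 = 0) :
    IsLogProfile (combProfile c k) 0 := by
  simpa [hc] using isLogProfile_comb c k

lemma isHelmholtzProfile_comb (c k : Fin 3 → ℂ) :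
    IsHelmholtzProfile (combProfile c k) (combProfile (fun i => c i * k i ^ 2) k) := by
  have h : ∀ i, IsHelmholtzProfile (fun ρ => c i * profile (k i) ρ)
      fun ρ => c i * (k i ^ 2 * profile (k i) ρ) := fun i =>
    (isHelmholtzProfile_profile (k i)).const_mul (isLogProfile_profile (k i)) (c i)
  have l : ∀ i, IsLogProfile (fun ρ => c i * profile (k i) ρ) _ := fun i =>
    (isLogProfile_profile (k i)).const_mul (c i)
  have := ((h 0).add (h 1) (l 0) (l 1)).add (h 2) ((l 0).add (l 1)) (l 2)
  intro ρ hρ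
  refine (this ρ hρ).congr_deriv ?_
  simp only [combProfile]
  change -(_ + (c 0 * _ + c 1 * _ + c 2 * _) / 4) / _ = _
  have e : combProfile c k = fun ρ => c 0 * profile (k 0) ρ + c 1 * profile (k 1) ρ
      + c 2 * profile (k 2) ρ := rfl
  rw [e]
  ring

lemma contDiffAt_comb (c : Fin 3 → ℂ) {k : Fin 3 → ℂ} (hk0 : ∀ i, k i ≠ 0) {z : Plane}
    (hz : z ≠ 0) : ContDiffAt ℝ ∞ (comb c k) z :=
  contDiffAt_radial (comb_eq_profile c hk0) (fun _ hρ => (isLogProfile_comb c k).contDiffAt hρ) hz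

lemma laplacian_comb (c : Fin 3 → ℂ) {k : Fin 3 → ℂ} (hk0 : ∀ i, k i ≠ 0) {z : Plane}
    (hz : z ≠ 0) : pd 0 (pd 0 (comb c k)) z + pd 1 (pd 1 (comb c k)) z =
      -comb (fun i => c i * k i ^ 2) k z := by
  rw [laplacian_radial (comb_eq_profile c hk0) (isLogProfile_comb c k)
    (isHelmholtzProfile_comb c k) hz, comb_eq_profile _ hk0 z hz]

lemma logKernel_pd_pd_comb {c k : Fin 3 → ℂ} (hk0 : ∀ i, k i ≠ 0) (hc : c 0 + c 1 + c 2 = 0)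
    (i j : Fin 2) : LogKernel (pd i (pd j (comb c k))) :=
  logKernel_pd_pd_radial (comb_eq_profile c hk0) (isLogProfile_comb_zero hc)
    (isHelmholtzProfile_comb c k) (isLogProfile_comb _ k) i j

lemma pd_comb (c : Fin 3 → ℂ) {k : Fin 3 → ℂ} (hk0 : ∀ i, k i ≠ 0) {z : Plane} (hz : z ≠ 0)
    (m : Fin 2) : pd m (comb c k) z =
      c 0 * pd m (hk (k 0)) z + c 1 * pd m (hk (k 1)) z + c 2 * pd m (hk (k 2)) z := by
  have d : ∀ i, DifferentiableAt ℝ (hk (k i)) z := fun i =>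
    (contDiffAt_hk (hk0 i) hz).differentiableAt (by simp)
  have e : comb c k = fun z => c 0 * hk (k 0) z + c 1 * hk (k 1) z + c 2 * hk (k 2) z := rfl
  rw [e, pd_add (((d 0).const_mul _).fun_add ((d 1).const_mul _)) ((d 2).const_mul _),
    pd_add ((d 0).const_mul _) ((d 1).const_mul _), pd_const_mul (d 0), pd_const_mul (d 1),
    pd_const_mul (d 2)]

/-- The derivative of the Helmholtz equation. -/
lemma pd_laplacian_comb (c : Fin 3 → ℂ) {k : Fin 3 → ℂ} (hk0 : ∀ i, k i ≠ 0) {z : Plane}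
    (hz : z ≠ 0) (m : Fin 2) :
    pd m (pd 0 (pd 0 (comb c k))) z + pd m (pd 1 (pd 1 (comb c k))) z =
      -(c 0 * k 0 ^ 2 * pd m (hk (k 0)) z + c 1 * k 1 ^ 2 * pd m (hk (k 1)) z
        + c 2 * k 2 ^ 2 * pd m (hk (k 2)) z) := by
  have hs := contDiffAt_comb c hk0 hz
  rw [← pd_add (differentiableAt_pd (contDiffAt_pd hs 0) 0)
    (differentiableAt_pd (contDiffAt_pd hs 1) 1),
    pd_congr_of_ne hz (fun w hw => laplacian_comb c hk0 hw), pd_neg, pd_comb _ hk0 hz]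

lemma pd_pd_pd_comm {g : Plane → ℂ} (hg : ∀ z ≠ 0, ContDiffAt ℝ ∞ g z) {z : Plane} (hz : z ≠ 0)
    (m i j : Fin 2) : pd m (pd i (pd j g)) z = pd m (pd j (pd i g)) z :=
  pd_congr_of_ne hz (fun w hw => pd_comm (hg w hw) i j) m

/-! ### The parameters -/

namespace Params

variable (P : Params)

/-- The constant `(ρ - β ρ_f) ω²`. -/
def dens : ℂ := ((P.rho : ℂ) - P.beta * (P.rhoF : ℂ)) * (P.omega : ℂ) ^ 2

lemma lam_add_two_mu_pos : 0 < P.lam + 2 * P.mu := by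
  have := P.mu_pos; have := P.lam_add_mu_pos; linarith

lemma beta_denom_ne_zero : Complex.I * ((P.phi ^ 2 : ℝ) : ℂ) +
    ((P.omega * P.kappa * (P.rhoA + P.phi * P.rhoF) : ℝ) : ℂ) ≠ 0 := by
  intro h
  have := congrArg Complex.im h
  rw [Complex.add_im, Complex.I_mul_im, Complex.ofReal_re, Complex.ofReal_im] at this
  have h2 := P.phi_pos
  simp at this
  exact h2.ne' this

lemma beta_ne_zero : P.beta ≠ 0 := by
  have h1 := P.omega_pos; have h2 := P.phi_pos; have h3 := P.rhoF_pos; have h4 := P.kappa_pos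
  refine div_ne_zero ?_ P.beta_denom_ne_zero
  exact_mod_cast (by positivity : (0 : ℝ) < P.omega * P.phi ^ 2 * P.rhoF * P.kappa).ne'

/-- The denominator of β has imaginary part φ² > 0. As ρ and ρ_f are real with ρ_f ≠ 0, it follows
that ρ − βρ_f cannot vanish, so k_s and k_p are nonzero. -/
lemma beta_im_neg : P.beta.im < 0 := by
  have h1 := P.omega_pos; have h2 := P.phi_pos; have h3 := P.rhoF_pos; have h4 := P.kappa_pos
  have hn := Complex.normSq_pos.mpr P.beta_denom_ne_zero
  rw [beta, Complex.div_im, Complex.ofReal_im, Complex.ofReal_re, Complex.add_im,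
    Complex.I_mul_im, Complex.ofReal_re, Complex.ofReal_im, zero_mul, zero_div, zero_sub, add_zero]
  have : 0 < P.omega * P.phi ^ 2 * P.rhoF * P.kappa * P.phi ^ 2 := by positivity
  have := div_pos this hn
  linarith

lemma rho_sub_ne_zero : (P.rho : ℂ) - P.beta * (P.rhoF : ℂ) ≠ 0 := by
  intro h
  have := congrArg Complex.im h
  have h1 := P.beta_im_neg
  have h2 := P.rhoF_pos
  simp at this
  rcases this with h | h <;> linarith

lemma omega_ne_zero : (P.omega : ℂ) ≠ 0 := by exact_mod_cast P.omega_pos.ne'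

lemma rhoF_ne_zero : (P.rhoF : ℂ) ≠ 0 := by exact_mod_cast P.rhoF_pos.ne'

lemma mu_ne_zero : (P.mu : ℂ) ≠ 0 := by exact_mod_cast P.mu_pos.ne'

lemma lam_add_two_mu_ne_zero : ((P.lam + 2 * P.mu : ℝ) : ℂ) ≠ 0 := by
  exact_mod_cast P.lam_add_two_mu_pos.ne'

lemma dens_ne_zero : P.dens ≠ 0 := mul_ne_zero P.rho_sub_ne_zero (pow_ne_zero _ P.omega_ne_zero)

lemma cpow_half_sq (w : ℂ) : (w ^ (1 / 2 : ℂ)) ^ 2 = w := by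
  rw [← Complex.cpow_nat_mul]; norm_num

lemma mu_mul_ks_sq : (P.mu : ℂ) * P.ks ^ 2 = P.dens := by
  have := P.mu_ne_zero
  rw [ks, mul_pow, cpow_half_sq, dens]; field_simp

lemma lam_mul_kp_sq : ((P.lam + 2 * P.mu : ℝ) : ℂ) * P.kp ^ 2 = P.dens := by
  have := P.lam_add_two_mu_ne_zero
  rw [kp, mul_pow, cpow_half_sq, dens]; field_simp

lemma ks_ne_zero : P.ks ≠ 0 := fun h => P.dens_ne_zero (by rw [← P.mu_mul_ks_sq, h]; simp)

lemma kp_ne_zero : P.kp ≠ 0 := fun h => P.dens_ne_zero (by rw [← P.lam_mul_kp_sq, h]; simp)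

lemma R_ne_zero : P.R ≠ 0 := by
  have h1 := P.nuP_gt; have h2 := P.nuP_lt_nuU; have h3 := P.nuU_lt
  have h4 := P.mu_pos; have h5 := P.B_pos; have h6 := P.phi_pos
  have e1 : 0 < 1 - 2 * P.nuP := by linarith
  have e2 : 0 < 1 + P.nuU := by linarith
  have e3 : 0 < P.nuU - P.nuP := by linarith
  have e4 : 0 < 1 - 2 * P.nuU := by linarith
  unfold R
  positivity

lemma q_ne_zero : P.q ≠ 0 := by
  have h1 := P.omega_pos; have h2 := P.phi_pos; have h3 := P.rhoF_pos
  refine div_ne_zero ?_ (mul_ne_zero P.beta_ne_zero (by exact_mod_cast P.R_ne_zero))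
  exact_mod_cast (by positivity : (0 : ℝ) < P.omega ^ 2 * P.phi ^ 2 * P.rhoF).ne'

variable {P}

/-- The product k₁²k₂² = q k_p² is nonzero. Nonvanishing wave numbers are required for the
logarithmic expansion of the Hankel function. -/
lemma IsWavePair.ne_zero {k₁ k₂ : ℂ} (h : P.IsWavePair k₁ k₂) : k₁ ≠ 0 ∧ k₂ ≠ 0 := by
  have h1 : k₁ ^ 2 * k₂ ^ 2 ≠ 0 := by
    rw [h.2.2.2]; exact mul_ne_zero P.q_ne_zero (pow_ne_zero _ P.kp_ne_zero)
  exact ⟨fun h => h1 (by simp [h]), fun h => h1 (by simp [h])⟩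

variable (P)

/-! ### The kernels as functions of the difference -/

/-- The three wave numbers. -/
def waves (k₁ k₂ : ℂ) : Fin 3 → ℂ := ![P.ks, k₁, k₂]

/-- The coefficients of `psi`. -/
def psiCoeff (k₁ k₂ : ℂ) : Fin 3 → ℂ :=
  ![1, -((P.kp ^ 2 - k₂ ^ 2) / (k₁ ^ 2 - k₂ ^ 2)), (P.kp ^ 2 - k₁ ^ 2) / (k₁ ^ 2 - k₂ ^ 2)]

/-- The function `psi` of `z = x - y`. -/
def psiZ (k₁ k₂ : ℂ) : Plane → ℂ := comb (P.psiCoeff k₁ k₂) (P.waves k₁ k₂)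

/-- The function `γ_{k₁} - γ_{k₂}` of `z = x - y`. -/
def thetaZ (k₁ k₂ : ℂ) : Plane → ℂ := comb ![0, 1, -1] (P.waves k₁ k₂)

variable {P}

lemma waves_ne_zero {k₁ k₂ : ℂ} (h : P.IsWavePair k₁ k₂) (i : Fin 3) : P.waves k₁ k₂ i ≠ 0 := by
  fin_cases i
  exacts [P.ks_ne_zero, h.ne_zero.1, h.ne_zero.2]

lemma psi_eq (k₁ k₂ : ℂ) (x y : Plane) : P.psi k₁ k₂ x y = P.psiZ k₁ k₂ (x - y) := by
  simp only [psi, psiZ, comb, psiCoeff, waves, helmholtz_eq, Matrix.cons_val_zero,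
    Matrix.cons_val_one, Matrix.cons_val]
  ring

variable (P) in
lemma theta_eq (k₁ k₂ : ℂ) (x y : Plane) :
    helmholtz k₁ x y - helmholtz k₂ x y = P.thetaZ k₁ k₂ (x - y) := by
  simp only [thetaZ, comb, waves, helmholtz_eq, Matrix.cons_val_zero,
    Matrix.cons_val_one, Matrix.cons_val]
  ring

variable (P)

/-- The entries of `E11` as functions of `z = x - y`. -/
def E11Z (k₁ k₂ : ℂ) (i j : Fin 2) (z : Plane) : ℂ :=
  (if i = j then 1 else 0) * (1 / (P.mu : ℂ)) * hk P.ks z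
    + 1 / P.dens * pd i (pd j (P.psiZ k₁ k₂)) z

/-- The constant in front of the second derivatives of `thetaZ` in the double layer kernel. -/
def constU (k₁ k₂ : ℂ) : ℂ :=
  Complex.I * P.beta * P.gam /
    ((P.omega : ℂ) * (P.rhoF : ℂ) * (((P.lam + 2 * P.mu : ℝ) : ℂ) * (k₁ ^ 2 - k₂ ^ 2)))

/-- The displacement rows of the pressure column of the double layer kernel. -/
def columnU (k₁ k₂ : ℂ) (n : Plane) (l : Fin 2) (z : Plane) : ℂ :=
  (-P.beta / (P.mu : ℂ) * (n l : ℂ)) * hk P.ks z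
    + (-P.beta / P.dens * (n 0 : ℂ)) * pd 0 (pd l (P.psiZ k₁ k₂)) z
    + (-P.beta / P.dens * (n 1 : ℂ)) * pd 1 (pd l (P.psiZ k₁ k₂)) z
    + (P.constU k₁ k₂ * (n 0 : ℂ)) * pd 0 (pd l (P.thetaZ k₁ k₂)) z
    + (P.constU k₁ k₂ * (n 1 : ℂ)) * pd 1 (pd l (P.thetaZ k₁ k₂)) z

/-- The matrix `M` with `kernelN23 = M (x - y) ν_y`. -/
def N23Z (k₁ k₂ : ℂ) (a b : Fin 2) (z : Plane) : ℂ :=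
  (-P.beta) * (∑ c, rotA a c * (2 * (P.mu : ℂ) * P.E11Z k₁ k₂ c b z
      + -(if c = b then 1 else 0) * hk P.ks z))
    + (-(P.constN2 k₁ k₂ * rotA a b)) * (k₁ ^ 2 * hk k₁ z + -k₂ ^ 2 * hk k₂ z)

variable {P}

lemma E11_eq (k₁ k₂ : ℂ) (x y : Plane) (i j : Fin 2) :
    P.E11 k₁ k₂ x y i j = P.E11Z k₁ k₂ i j (x - y) := by
  have h1 : (fun x' => pd j (fun x'' => P.psi k₁ k₂ x'' y) x') =
      fun x' => pd j (P.psiZ k₁ k₂) (x' - y) := by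
    ext x'
    rw [← pd_comp_sub]
    simp only [psi_eq]
  simp only [E11, Matrix.add_apply, Matrix.smul_apply, Matrix.of_apply, h1, pd_comp_sub, E11Z,
    Matrix.one_apply, helmholtz_eq, smul_eq_mul, dens]
  split_ifs <;> ring

lemma grad_theta_eq (k₁ k₂ : ℂ) (x y : Plane) (i : Fin 2) :
    grad (fun x' => helmholtz k₁ x' y - helmholtz k₂ x' y) x i =
      pd i (P.thetaZ k₁ k₂) (x - y) := by
  rw [grad, ← pd_comp_sub]
  simp only [P.theta_eq k₁ k₂]

lemma kernelN22_eq (k₁ k₂ : ℂ) (x nx y ny : Plane) (a : Fin 2) :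
    P.kernelN22 k₁ k₂ x nx y ny a = -P.constN2 k₁ k₂ * pd a (P.thetaZ k₁ k₂) (x - y) := by
  simp only [kernelN22, Pi.smul_apply, smul_eq_mul, grad_theta_eq (P := P)]

lemma kernelN23_eq (k₁ k₂ : ℂ) (x nx y ny : Plane) (a : Fin 2) :
    P.kernelN23 k₁ k₂ x nx y ny a = ∑ b, (ny b : ℂ) * P.N23Z k₁ k₂ a b (x - y) := by
  simp only [kernelN23, N23Z, Pi.sub_apply, Pi.smul_apply, smul_eq_mul, Matrix.mulVec,
    dotProduct, Matrix.mul_apply, Matrix.sub_apply, Matrix.smul_apply, E11_eq, Fin.sum_univ_two,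
    helmholtz_eq, cvec, Matrix.one_apply]
  ring

lemma contDiffAt_psiZ {k₁ k₂ : ℂ} (hw : P.IsWavePair k₁ k₂) (z : Plane) (hz : z ≠ 0) :
    ContDiffAt ℝ ∞ (P.psiZ k₁ k₂) z :=
  contDiffAt_comb _ (waves_ne_zero hw) hz

lemma contDiffAt_thetaZ {k₁ k₂ : ℂ} (hw : P.IsWavePair k₁ k₂) (z : Plane) (hz : z ≠ 0) :
    ContDiffAt ℝ ∞ (P.thetaZ k₁ k₂) z :=
  contDiffAt_comb _ (waves_ne_zero hw) hz

lemma logKernel_pd_pd_thetaZ {k₁ k₂ : ℂ} (hw : P.IsWavePair k₁ k₂) (i j : Fin 2) :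
    LogKernel (pd i (pd j (P.thetaZ k₁ k₂))) :=
  logKernel_pd_pd_comb (waves_ne_zero hw) (by simp) i j

/-- The coefficients of ψ sum to zero: 1 − (k_p² − k₂²)/(k₁² − k₂²) + (k_p² − k₁²)/(k₁² − k₂²) = 0.
-/
lemma logKernel_pd_pd_psiZ {k₁ k₂ : ℂ} (hw : P.IsWavePair k₁ k₂) (hne : k₁ ^ 2 ≠ k₂ ^ 2)
    (i j : Fin 2) : LogKernel (pd i (pd j (P.psiZ k₁ k₂))) := by
  refine logKernel_pd_pd_comb (waves_ne_zero hw) ?_ i j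
  have := sub_ne_zero.mpr hne
  simp only [psiCoeff, Matrix.cons_val_zero, Matrix.cons_val_one, Matrix.cons_val]
  field_simp
  ring

lemma logKernel_hk {k : ℂ} (hk0 : k ≠ 0) : LogKernel (hk k) :=
  logKernel_radial (hk_eq_profile hk0) (isLogProfile_profile k)

lemma logKernel_E11Z {k₁ k₂ : ℂ} (hw : P.IsWavePair k₁ k₂) (hne : k₁ ^ 2 ≠ k₂ ^ 2)
    (i j : Fin 2) : LogKernel (P.E11Z k₁ k₂ i j) :=
  ((logKernel_hk P.ks_ne_zero).const_mul _).add ((logKernel_pd_pd_psiZ hw hne i j).const_mul _)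

lemma logKernel_N23Z {k₁ k₂ : ℂ} (hw : P.IsWavePair k₁ k₂) (hne : k₁ ^ 2 ≠ k₂ ^ 2)
    (a b : Fin 2) : LogKernel (P.N23Z k₁ k₂ a b) := by
  have h : ∀ c, LogKernel fun z => rotA a c * (2 * (P.mu : ℂ) * P.E11Z k₁ k₂ c b z
      + -(if c = b then 1 else 0) * hk P.ks z) := fun c =>
    (((logKernel_E11Z hw hne c b).const_mul _).add
      ((logKernel_hk P.ks_ne_zero).const_mul _)).const_mul _
  have h' : LogKernel fun z => k₁ ^ 2 * hk k₁ z + -k₂ ^ 2 * hk k₂ z :=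
    ((logKernel_hk hw.ne_zero.1).const_mul _).add ((logKernel_hk hw.ne_zero.2).const_mul _)
  have := (((h 0).add (h 1)).const_mul (-P.beta)).add
    (h'.const_mul (-(P.constN2 k₁ k₂ * rotA a b)))
  unfold N23Z
  simpa only [Fin.sum_univ_two] using this

end Params

namespace Params

variable {P : Params}

/-! ### The pointwise identity between the kernels -/

lemma pd_translate {F G : Plane → ℂ} {x y : Plane} (hxy : x ≠ y)
    (h : ∀ x' ≠ y, F x' = G (x' - y)) (i : Fin 2) : pd i F x = pd i G (x - y) := by
  rw [← pd_comp_sub]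
  refine pd_congr ?_ i
  filter_upwards [isOpen_ne.mem_nhds hxy] with w hw using h w hw

lemma pd_columnU {k₁ k₂ : ℂ} (hw : P.IsWavePair k₁ k₂) (n : Plane) (l m : Fin 2) {z : Plane}
    (hz : z ≠ 0) : pd m (P.columnU k₁ k₂ n l) z =
      (-P.beta / (P.mu : ℂ) * (n l : ℂ)) * pd m (hk P.ks) z
      + (-P.beta / P.dens * (n 0 : ℂ)) * pd m (pd 0 (pd l (P.psiZ k₁ k₂))) z
      + (-P.beta / P.dens * (n 1 : ℂ)) * pd m (pd 1 (pd l (P.psiZ k₁ k₂))) z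
      + (P.constU k₁ k₂ * (n 0 : ℂ)) * pd m (pd 0 (pd l (P.thetaZ k₁ k₂))) z
      + (P.constU k₁ k₂ * (n 1 : ℂ)) * pd m (pd 1 (pd l (P.thetaZ k₁ k₂))) z := by
  have d0 : DifferentiableAt ℝ (hk P.ks) z :=
    (contDiffAt_hk P.ks_ne_zero hz).differentiableAt (by simp)
  have d1 : ∀ i, DifferentiableAt ℝ (pd i (pd l (P.psiZ k₁ k₂))) z := fun i =>
    differentiableAt_pd (contDiffAt_pd (contDiffAt_psiZ hw z hz) l) i
  have d2 : ∀ i, DifferentiableAt ℝ (pd i (pd l (P.thetaZ k₁ k₂))) z := fun i =>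
    differentiableAt_pd (contDiffAt_pd (contDiffAt_thetaZ hw z hz) l) i
  unfold columnU
  have e0 := d0.const_mul (-P.beta / (P.mu : ℂ) * (n l : ℂ))
  have e1 := e0.fun_add ((d1 0).const_mul (-P.beta / P.dens * (n 0 : ℂ)))
  have e2 := e1.fun_add ((d1 1).const_mul (-P.beta / P.dens * (n 1 : ℂ)))
  have e3 := e2.fun_add ((d2 0).const_mul (P.constU k₁ k₂ * (n 0 : ℂ)))
  rw [pd_add e3 ((d2 1).const_mul _), pd_add e2 ((d2 0).const_mul _),
    pd_add e1 ((d1 1).const_mul _), pd_add e0 ((d1 0).const_mul _), pd_const_mul d0,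
    pd_const_mul (d1 0), pd_const_mul (d1 1), pd_const_mul (d2 0), pd_const_mul (d2 1)]

/-- The kernels depend on x − y only, so the y-derivative of `E21` changes sign; this absorbs the
minus sign of `E21` and gives `constU` its positive sign. -/
lemma doubleLayerKernel_inl {k₁ k₂ : ℂ} (hw : P.IsWavePair k₁ k₂) {x y : Plane} (hxy : x ≠ y)
    (n : Plane) (l : Fin 2) : P.doubleLayerKernel k₁ k₂ x y n (Sum.inl l) (Sum.inr ()) =
      P.columnU k₁ k₂ n l (x - y) := by
  have hz : x - y ≠ 0 := sub_ne_zero.mpr hxy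
  have h21 : ∀ j, pd j (fun y' => P.E21 k₁ k₂ x y' l) y =
      P.gam / (((P.lam + 2 * P.mu : ℝ) : ℂ) * (k₁ ^ 2 - k₂ ^ 2)) *
        pd j (pd l (P.thetaZ k₁ k₂)) (x - y) := fun j => by
    have : (fun y' => P.E21 k₁ k₂ x y' l) = fun y' => (fun z =>
        (-(P.gam / (((P.lam + 2 * P.mu : ℝ) : ℂ) * (k₁ ^ 2 - k₂ ^ 2)))) *
          pd l (P.thetaZ k₁ k₂) z) (x - y') := by
      ext y'
      simp only [E21, Pi.smul_apply, smul_eq_mul, grad_theta_eq (P := P)]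
    rw [this, pd_comp_const_sub (fun z => _ * pd l (P.thetaZ k₁ k₂) z), pd_const_mul (differentiableAt_pd (contDiffAt_thetaZ hw _ hz) l)]
    ring
  simp only [doubleLayerKernel, Matrix.transpose_apply, Matrix.of_apply, neumannAdj, Sum.elim_inr,
    E, Matrix.fromBlocks_apply₁₁, Matrix.fromBlocks_apply₂₁, dirDeriv, h21, E11_eq,
    Fin.sum_univ_two, columnU, E11Z, constU, cvec]
  generalize ((P.lam + 2 * P.mu : ℝ) : ℂ) = l₂
  generalize k₁ ^ 2 - k₂ ^ 2 = d
  fin_cases l <;> simp <;> ring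

/-- The contributions of `E12` and `E22` are kept in the form in which `kernelN21` contains them, so
that they cancel verbatim in the regularization identity. -/
lemma doubleLayerKernel_inr {k₁ k₂ : ℂ} (hw : P.IsWavePair k₁ k₂) (hne : k₁ ^ 2 ≠ k₂ ^ 2)
    {x y : Plane} (hxy : x ≠ y) (n : Plane) :
    P.doubleLayerKernel k₁ k₂ x y n (Sum.inr ()) (Sum.inr ()) =
      -P.beta * ∑ j, P.E12 k₁ k₂ x y j * cvec n j
        - 1 / (k₁ ^ 2 - k₂ ^ 2) * dirDeriv n (fun y' => (P.kp ^ 2 - k₁ ^ 2) * helmholtz k₁ x y'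
          - (P.kp ^ 2 - k₂ ^ 2) * helmholtz k₂ x y') y := by
  have hz : x - y ≠ 0 := sub_ne_zero.mpr hxy
  have hd : ∀ k ≠ 0, DifferentiableAt ℝ (fun y' => helmholtz k x y') y := fun k hk0 => by
    have : DifferentiableAt ℝ (hk k) (x - y) :=
      (contDiffAt_hk hk0 hz).differentiableAt (by simp)
    exact DifferentiableAt.comp (g := hk k) y this
      ((differentiableAt_const x).sub differentiableAt_id)
  have h22 : ∀ j, pd j (fun y' => P.E22 k₁ k₂ x y') y =
      Complex.I * (P.rhoF : ℂ) * (P.omega : ℂ) / (P.beta * (k₁ ^ 2 - k₂ ^ 2)) *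
        pd j (fun y' => (P.kp ^ 2 - k₁ ^ 2) * helmholtz k₁ x y'
          - (P.kp ^ 2 - k₂ ^ 2) * helmholtz k₂ x y') y := fun j => by
    unfold E22
    rw [pd_const_mul (((hd k₁ hw.ne_zero.1).const_mul _).fun_sub
      ((hd k₂ hw.ne_zero.2).const_mul _))]
  have h1 := P.beta_ne_zero
  have h2 := P.rhoF_ne_zero
  have h3 := P.omega_ne_zero
  have h4 := sub_ne_zero.mpr hne
  simp only [doubleLayerKernel, Matrix.transpose_apply, Matrix.of_apply, neumannAdj, Sum.elim_inr,
    E, Matrix.fromBlocks_apply₁₂, Matrix.fromBlocks_apply₂₂, dirDeriv, h22, Fin.sum_univ_two]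
  field_simp
  ring_nf
  simp only [Complex.I_sq]
  ring

lemma kernelN2_eq {k₁ k₂ : ℂ} (hw : P.IsWavePair k₁ k₂) (hne : k₁ ^ 2 ≠ k₂ ^ 2)
    {x y : Plane} (hxy : x ≠ y) (nx ny : Plane) (a : Fin 2) :
    P.kernelN2 k₁ k₂ x nx y ny a =
      2 * (P.mu : ℂ) * (∑ j, (nx j : ℂ) * pd j (P.columnU k₁ k₂ ny a) (x - y))
        + (P.lam : ℂ) * (nx a : ℂ) * (∑ j, pd j (P.columnU k₁ k₂ ny j) (x - y))
        + (P.mu : ℂ) * (![-(nx 1 : ℂ), (nx 0 : ℂ)] : Fin 2 → ℂ) a *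
          (pd 1 (P.columnU k₁ k₂ ny 0) (x - y) - pd 0 (P.columnU k₁ k₂ ny 1) (x - y))
        - (P.alpha : ℂ) * (nx a : ℂ) * (-P.beta * ∑ j, P.E12 k₁ k₂ x y j * cvec ny j
          - 1 / (k₁ ^ 2 - k₂ ^ 2) * dirDeriv ny (fun y' => (P.kp ^ 2 - k₁ ^ 2) *
            helmholtz k₁ x y' - (P.kp ^ 2 - k₂ ^ 2) * helmholtz k₂ x y') y) := by
  have h : ∀ l j, pd j (fun x' => P.doubleLayerKernel k₁ k₂ x' y ny (Sum.inl l) (Sum.inr ())) x =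
      pd j (P.columnU k₁ k₂ ny l) (x - y) := fun l j =>
    pd_translate hxy (fun x' hx' => doubleLayerKernel_inl hw hx' ny l) j
  simp only [kernelN2, Matrix.toBlocks₁₂, Matrix.of_apply, hypersingularKernel, neumann,
    Sum.elim_inl, traction, dirDeriv, h]
  rw [doubleLayerKernel_inr hw hne hxy]
  simp only [cvec, dirDeriv]

lemma dirDeriv_N23Z {k₁ k₂ : ℂ} (hw : P.IsWavePair k₁ k₂) (a b m : Fin 2) {z : Plane}
    (hz : z ≠ 0) : pd m (P.N23Z k₁ k₂ a b) z =
      (-P.beta) * (∑ c, rotA a c * (2 * (P.mu : ℂ) *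
        ((if c = b then 1 else 0) * (1 / (P.mu : ℂ)) * pd m (hk P.ks) z
          + 1 / P.dens * pd m (pd c (pd b (P.psiZ k₁ k₂))) z)
        + -(if c = b then 1 else 0) * pd m (hk P.ks) z))
      + (-(P.constN2 k₁ k₂ * rotA a b)) *
        (k₁ ^ 2 * pd m (hk k₁) z + -k₂ ^ 2 * pd m (hk k₂) z) := by
  have d : ∀ k ≠ 0, DifferentiableAt ℝ (hk k) z := fun k hk0 =>
    (contDiffAt_hk hk0 hz).differentiableAt (by simp)
  have ds := d _ P.ks_ne_zero
  have d1 := d _ hw.ne_zero.1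
  have d2 := d _ hw.ne_zero.2
  have dp : ∀ c, DifferentiableAt ℝ (pd c (pd b (P.psiZ k₁ k₂))) z := fun c =>
    differentiableAt_pd (contDiffAt_pd (contDiffAt_psiZ hw z hz) b) c
  have dE : ∀ c, DifferentiableAt ℝ (P.E11Z k₁ k₂ c b) z := fun c =>
    (ds.const_mul _).fun_add ((dp c).const_mul _)
  have eE : ∀ c, pd m (P.E11Z k₁ k₂ c b) z = (if c = b then 1 else 0) * (1 / (P.mu : ℂ)) *
      pd m (hk P.ks) z + 1 / P.dens * pd m (pd c (pd b (P.psiZ k₁ k₂))) z := fun c => by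
    unfold E11Z
    rw [pd_add (ds.const_mul _) ((dp c).const_mul _), pd_const_mul ds, pd_const_mul (dp c)]
  have dc : ∀ c, DifferentiableAt ℝ (fun z => rotA a c * (2 * (P.mu : ℂ) * P.E11Z k₁ k₂ c b z
      + -(if c = b then 1 else 0) * hk P.ks z)) z := fun c =>
    (((dE c).const_mul _).fun_add (ds.const_mul _)).const_mul _
  unfold N23Z
  simp only [Fin.sum_univ_two]
  rw [pd_add (((dc 0).fun_add (dc 1)).const_mul _)
      (((d1.const_mul _).fun_add (d2.const_mul _)).const_mul _),
    pd_const_mul ((dc 0).fun_add (dc 1)), pd_add (dc 0) (dc 1),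
    pd_const_mul (((dE 0).const_mul _).fun_add (ds.const_mul _)),
    pd_const_mul (((dE 1).const_mul _).fun_add (ds.const_mul _)),
    pd_add ((dE 0).const_mul _) (ds.const_mul _), pd_add ((dE 1).const_mul _) (ds.const_mul _),
    pd_const_mul (dE 0), pd_const_mul (dE 1), pd_const_mul ds, pd_const_mul ds,
    pd_const_mul ((d1.const_mul _).fun_add (d2.const_mul _)),
    pd_add (d1.const_mul _) (d2.const_mul _), pd_const_mul d1, pd_const_mul d2, eE, eE]

/-- The derivatives of `kernelN21` in terms of the wave functions. -/
lemma kernelN21_eq {k₁ k₂ : ℂ} (hw : P.IsWavePair k₁ k₂)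
    {x y : Plane} (hxy : x ≠ y) (nx ny : Plane) (a : Fin 2) :
    P.kernelN21 k₁ k₂ x nx y ny a =
      P.beta * (∑ j, (pd j (hk P.ks) (x - y) - pd j (hk k₁) (x - y)
        - (k₂ ^ 2 - P.q) / (k₁ ^ 2 - k₂ ^ 2) * (pd j (hk k₁) (x - y) - pd j (hk k₂) (x - y)))
          * (ny j : ℂ)) * (nx a : ℂ)
      - P.beta * (dirDeriv nx (hk P.ks) (x - y) * (ny a : ℂ)
        - ((P.alpha : ℂ) * ∑ j, P.E12 k₁ k₂ x y j * cvec ny j) * (nx a : ℂ))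
      - Complex.I * P.beta * P.gam / ((P.rhoF : ℂ) * (P.omega : ℂ) * (k₁ ^ 2 - k₂ ^ 2)) *
        (k₁ ^ 2 * dirDeriv ny (hk k₁) (x - y) - k₂ ^ 2 * dirDeriv ny (hk k₂) (x - y)) * (nx a : ℂ)
      + ((P.alpha : ℂ) / (k₁ ^ 2 - k₂ ^ 2) * dirDeriv ny (fun y' =>
        (P.kp ^ 2 - k₁ ^ 2) * helmholtz k₁ x y' - (P.kp ^ 2 - k₂ ^ 2) * helmholtz k₂ x y') y)
          * (nx a : ℂ) := by
  have hz : x - y ≠ 0 := sub_ne_zero.mpr hxy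
  have h0 := waves_ne_zero hw
  have e1 : ∀ j, grad (fun x' => (helmholtz P.ks x' y - helmholtz k₁ x' y)
        - (k₂ ^ 2 - P.q) / (k₁ ^ 2 - k₂ ^ 2) * (helmholtz k₁ x' y - helmholtz k₂ x' y)) x j =
      pd j (hk P.ks) (x - y) - pd j (hk k₁) (x - y)
        - (k₂ ^ 2 - P.q) / (k₁ ^ 2 - k₂ ^ 2) * (pd j (hk k₁) (x - y) - pd j (hk k₂) (x - y)) := by
    intro j
    have := pd_comb ![1, -1 - (k₂ ^ 2 - P.q) / (k₁ ^ 2 - k₂ ^ 2),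
      (k₂ ^ 2 - P.q) / (k₁ ^ 2 - k₂ ^ 2)] h0 hz j
    rw [← pd_comp_sub] at this
    simp only [comb, waves, Matrix.cons_val_zero, Matrix.cons_val_one, Matrix.cons_val] at this
    rw [grad]
    refine Eq.trans ?_ (this.trans (by ring))
    congr 1
    ext x'
    simp only [helmholtz_eq]
    ring
  have e2 : dirDeriv nx (fun x' => helmholtz P.ks x' y) x = dirDeriv nx (hk P.ks) (x - y) := by
    simp only [dirDeriv, ← pd_comp_sub, helmholtz_eq]
  have e3 : dirDeriv ny (fun y' => k₁ ^ 2 * helmholtz k₁ x y' - k₂ ^ 2 * helmholtz k₂ x y') y =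
      -(k₁ ^ 2 * dirDeriv ny (hk k₁) (x - y) - k₂ ^ 2 * dirDeriv ny (hk k₂) (x - y)) := by
    have : ∀ j, pd j (fun y' => k₁ ^ 2 * helmholtz k₁ x y' - k₂ ^ 2 * helmholtz k₂ x y') y =
        -(k₁ ^ 2 * pd j (hk k₁) (x - y) - k₂ ^ 2 * pd j (hk k₂) (x - y)) := by
      intro j
      have := pd_comb ![0, k₁ ^ 2, -k₂ ^ 2] h0 hz j
      rw [← neg_inj, ← pd_comp_const_sub] at this
      simp only [comb, waves, Matrix.cons_val_zero, Matrix.cons_val_one, Matrix.cons_val] at this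
      refine Eq.trans ?_ (this.trans (by ring))
      congr 1
      ext x'
      simp only [helmholtz_eq]
      ring
    simp only [dirDeriv, this, Fin.sum_univ_two]
    ring
  simp only [kernelN21, Pi.add_apply, Pi.sub_apply, Pi.smul_apply, smul_eq_mul, e1, e2, e3]
  simp only [cvec]
  ring

/-- The regularization identity: away from the diagonal, the hypersingular kernel is the sum of
`kernelN21`, of the tangential derivative in `x` of `kernelN23`, and of minus the mixed tangential
derivative of `kernelN22`. -/
theorem kernelN2_eq_regularized {k₁ k₂ : ℂ} (hw : P.IsWavePair k₁ k₂) (hne : k₁ ^ 2 ≠ k₂ ^ 2)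
    {x y : Plane} (hxy : x ≠ y) (nx ny : Plane) (a : Fin 2) :
    P.kernelN2 k₁ k₂ x nx y ny a = P.kernelN21 k₁ k₂ x nx y ny a
      + (∑ b, (ny b : ℂ) * dirDeriv !₂[-(nx 1), nx 0] (P.N23Z k₁ k₂ a b) (x - y))
      + ∑ b, -P.constN2 k₁ k₂ * (!₂[-(ny 1), ny 0] : Plane) b *
        dirDeriv !₂[-(nx 1), nx 0] (pd b (pd a (P.thetaZ k₁ k₂))) (x - y) := by
  have hz : x - y ≠ 0 := sub_ne_zero.mpr hxy
  rw [kernelN2_eq hw hne hxy, kernelN21_eq hw hxy]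
  have h0 := waves_ne_zero hw
  have ψs := pd_pd_pd_comm (contDiffAt_psiZ hw) hz
  have θs := pd_pd_pd_comm (contDiffAt_thetaZ hw) hz
  have ψt := fun j i m => pd_comm (contDiffAt_pd (contDiffAt_psiZ hw _ hz) j) i m
  have θt := fun j i m => pd_comm (contDiffAt_pd (contDiffAt_thetaZ hw _ hz) j) i m
  have ψl := pd_laplacian_comb (P.psiCoeff k₁ k₂) h0 hz
  have θl := pd_laplacian_comb ![0, 1, -1] h0 hz
  change ∀ m, pd m (pd 0 (pd 0 (P.psiZ k₁ k₂))) _ + pd m (pd 1 (pd 1 (P.psiZ k₁ k₂))) _ = _ at ψl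
  change ∀ m, pd m (pd 0 (pd 0 (P.thetaZ k₁ k₂))) _ + pd m (pd 1 (pd 1 (P.thetaZ k₁ k₂))) _ = _
    at θl
  have hd := sub_ne_zero.mpr hne
  -- Everything is expressed through μ, λ + 2μ, `dens`, k₁ and k₂: the definitions of k_s and k_p
  -- give their squares, and k₁²k₂² = q k_p² gives q.
  have hks : P.ks ^ 2 = P.dens / P.mu := by
    rw [← P.mu_mul_ks_sq]; field_simp [P.mu_ne_zero]
  have hkp : P.kp ^ 2 = P.dens / ((P.lam + 2 * P.mu : ℝ) : ℂ) := by
    rw [← P.lam_mul_kp_sq, mul_div_cancel_left₀ _ P.lam_add_two_mu_ne_zero]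
  have hq : P.q = k₁ ^ 2 * k₂ ^ 2 * ((P.lam + 2 * P.mu : ℝ) : ℂ) / P.dens := by
    have := hw.2.2.2
    have h1 := P.lam_add_two_mu_ne_zero
    have h2 := P.kp_ne_zero
    rw [this, ← P.lam_mul_kp_sq, eq_div_iff (mul_ne_zero h1 (pow_ne_zero _ h2))]
    ring
  have hlam : (P.lam : ℂ) = ((P.lam + 2 * P.mu : ℝ) : ℂ) - 2 * P.mu := by push_cast; ring
  have n1 := P.mu_ne_zero
  have n2 := P.lam_add_two_mu_ne_zero
  have n3 := P.dens_ne_zero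
  have n4 := P.omega_ne_zero
  have n5 := P.rhoF_ne_zero
  have ψl0 := ψl 0
  have ψl1 := ψl 1
  have θl0 := θl 0
  have θl1 := θl 1
  simp only [psiCoeff, waves, Matrix.cons_val_zero, Matrix.cons_val_one, Matrix.cons_val, hks]
    at ψl0 ψl1 θl0 θl1
  rw [hkp] at ψl0 ψl1
  simp only [pd_columnU hw ny _ _ hz, Fin.sum_univ_two, dirDeriv_N23Z hw _ _ _ hz, dirDeriv, hq,
    hlam, constN2, constU]
  -- Symmetry leaves four third derivatives of each of ψ and θ, normalized so that the indices
  -- increase.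
  have ψ010 := ψs 0 1 0
  have ψ100 := (ψt 0 1 0).trans ψ010
  have ψ101 := ψt 1 1 0
  have ψ110 := (ψs 1 1 0).trans ψ101
  have θ010 := θs 0 1 0
  have θ100 := (θt 0 1 0).trans θ010
  have θ101 := θt 1 1 0
  have θ110 := (θs 1 1 0).trans θ101
  rw [ψ100] at ψl1
  rw [θ100] at θl1
  have hβ := P.beta_ne_zero
  clear ψs θs ψt θt ψl θl hkp hks hq h0
  revert ψl0 ψl1 θl0 θl1
  -- The `E12` and `E22` terms occur identically on both sides and may be treated as opaque.
  generalize pd 0 (fun y' => (P.kp ^ 2 - k₁ ^ 2) * helmholtz k₁ x y'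
    - (P.kp ^ 2 - k₂ ^ 2) * helmholtz k₂ x y') y = X0
  generalize pd 1 (fun y' => (P.kp ^ 2 - k₁ ^ 2) * helmholtz k₁ x y'
    - (P.kp ^ 2 - k₂ ^ 2) * helmholtz k₂ x y') y = X1
  generalize P.E12 k₁ k₂ x y 0 = Y0
  generalize P.E12 k₁ k₂ x y 1 = Y1
  generalize ((P.lam + 2 * P.mu : ℝ) : ℂ) = l₂ at *
  fin_cases a <;>
  simp [ψ010, ψ100, ψ101, ψ110, θ010, θ100, θ101, θ110, rotA, cvec] <;>
  generalize pd 0 (pd 0 (pd 0 (P.psiZ k₁ k₂))) (x - y) = p000 <;>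
  generalize pd 0 (pd 0 (pd 1 (P.psiZ k₁ k₂))) (x - y) = p001 <;>
  generalize pd 0 (pd 1 (pd 1 (P.psiZ k₁ k₂))) (x - y) = p011 <;>
  generalize pd 1 (pd 1 (pd 1 (P.psiZ k₁ k₂))) (x - y) = p111 <;>
  generalize pd 0 (pd 0 (pd 0 (P.thetaZ k₁ k₂))) (x - y) = t000 <;>
  generalize pd 0 (pd 0 (pd 1 (P.thetaZ k₁ k₂))) (x - y) = t001 <;>
  generalize pd 0 (pd 1 (pd 1 (P.thetaZ k₁ k₂))) (x - y) = t011 <;>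
  generalize pd 1 (pd 1 (pd 1 (P.thetaZ k₁ k₂))) (x - y) = t111 <;>
  generalize P.dens = D at * <;>
  intro hp0 hp1 ht0 ht1 <;>
  -- The differentiated Helmholtz equations are solved for the derivatives with indices 011 and 111.
  -- With these eliminated the claim is a rational identity.
  rw [← eq_sub_iff_add_eq'] at hp0 hp1 ht0 ht1 <;>
  rw [hp0, hp1, ht0, ht1] <;>
  field_simp <;>
  ring

end Params

/-! ### Punctured integrals -/

/-- The outer endpoints cancel by periodicity, leaving only the jump across the gap. -/
lemma integral_punctured_deriv {g g' : ℝ → ℂ} {a δ : ℝ}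
    (hd : ∀ τ, τ ≠ 0 → |τ| ≤ a → HasDerivAt g (g' τ) τ)
    (hc : ContinuousOn g' {τ | τ ≠ 0 ∧ |τ| ≤ a}) (hper : g a = g (-a)) (hδ : 0 < δ) (hδa : δ ≤ a) :
    (∫ τ in (-a)..(-δ), g' τ) + ∫ τ in δ..a, g' τ = g (-δ) - g δ := by
  have s1 : Set.uIcc (-a) (-δ) ⊆ {τ | τ ≠ 0 ∧ |τ| ≤ a} := by
    rw [Set.uIcc_of_le (by linarith)]
    rintro τ ⟨h1, h2⟩
    exact ⟨by linarith, abs_le.mpr ⟨by linarith, by linarith⟩⟩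
  have s2 : Set.uIcc δ a ⊆ {τ | τ ≠ 0 ∧ |τ| ≤ a} := by
    rw [Set.uIcc_of_le hδa]
    rintro τ ⟨h1, h2⟩
    exact ⟨by linarith, abs_le.mpr ⟨by linarith, by linarith⟩⟩
  rw [intervalIntegral.integral_eq_sub_of_hasDerivAt (fun τ h => hd τ (s1 h).1 (s1 h).2)
      (hc.mono s1).intervalIntegrable,
    intervalIntegral.integral_eq_sub_of_hasDerivAt (fun τ h => hd τ (s2 h).1 (s2 h).2)
      (hc.mono s2).intervalIntegrable, hper]
  ring

lemma tendsto_punctured_integral {f : ℝ → ℂ} {a : ℝ} (ha : 0 < a)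
    (hf : IntervalIntegrable f volume (-a) a) :
    Tendsto (fun δ => (∫ τ in (-a)..(-δ), f τ) + ∫ τ in δ..a, f τ) (𝓝[>] 0)
      (𝓝 (∫ τ in (-a)..a, f τ)) := by
  have h0 : (0 : ℝ) ∈ Set.uIcc (-a) a := by
    rw [Set.uIcc_of_le (by linarith)]; exact ⟨by linarith, ha.le⟩
  have hn : Set.uIcc (-a) a ∈ 𝓝 (0 : ℝ) := by
    rw [Set.uIcc_of_le (by linarith)]; exact Icc_mem_nhds (by linarith) ha
  have hc := (intervalIntegral.continuousOn_primitive_interval' hf h0).continuousAt hn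
  have hI : ∀ b c : ℝ, b ∈ Set.uIcc (-a) a → c ∈ Set.uIcc (-a) a →
      IntervalIntegrable f volume b c := fun b c hb hcc =>
    hf.mono_set (Set.uIcc_subset_uIcc hb hcc)
  have hl : -a ∈ Set.uIcc (-a) a := Set.left_mem_uIcc
  have hr : a ∈ Set.uIcc (-a) a := Set.right_mem_uIcc
  -- The last summand is zero; it is written as the value at δ = 0 of ∫_0^{−δ} − ∫_0^{δ}, so that
  -- continuity of the primitive yields the limit.
  have e0 : (∫ τ in (-a)..a, f τ) = -(∫ τ in (0 : ℝ)..(-a), f τ) + (∫ τ in (0 : ℝ)..a, f τ) +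
      ((∫ τ in (0 : ℝ)..0, f τ) - ∫ τ in (0 : ℝ)..0, f τ) := by
    rw [sub_self, add_zero, ← intervalIntegral.integral_symm,
      intervalIntegral.integral_add_adjacent_intervals (hI _ _ hl h0) (hI _ _ h0 hr)]
  have hneg : Tendsto (fun δ : ℝ => -δ) (𝓝[>] 0) (𝓝 0) := by
    have : Tendsto (fun δ : ℝ => -δ) (𝓝 0) (𝓝 (-0)) := continuous_neg.tendsto 0
    rw [neg_zero] at this
    exact this.mono_left nhdsWithin_le_nhds
  have t1 := (hc.tendsto.comp hneg).sub (hc.tendsto.mono_left (nhdsWithin_le_nhds (s := Set.Ioi 0)))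
  rw [e0]
  refine (t1.const_add _).congr' ?_
  have hm : Set.Ioo 0 a ∈ 𝓝[>] (0 : ℝ) := Ioo_mem_nhdsGT ha
  filter_upwards [hm] with δ hδ
  have hd1 : δ ∈ Set.uIcc (-a) a := by
    rw [Set.uIcc_of_le (by linarith)]; exact ⟨by linarith [hδ.1], hδ.2.le⟩
  have hd2 : -δ ∈ Set.uIcc (-a) a := by
    rw [Set.uIcc_of_le (by linarith)]; exact ⟨by linarith [hδ.2], by linarith [hδ.1]⟩
  have e1 := intervalIntegral.integral_add_adjacent_intervals (hI _ _ hl h0) (hI _ _ h0 hd2)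
  have e2 := intervalIntegral.integral_add_adjacent_intervals (hI _ _ hd1 h0) (hI _ _ h0 hr)
  rw [← e1, ← e2, intervalIntegral.integral_symm (-a) 0, intervalIntegral.integral_symm δ 0]
  simp only [Function.comp]
  ring

lemma integral_periodic_shift {E : Type*} [NormedAddCommGroup E] [NormedSpace ℝ E] {f : ℝ → E}
    {L : ℝ} (hf : Function.Periodic f L) (s : ℝ) :
    ∫ t in (0 : ℝ)..L, f t = ∫ τ in (-(L / 2))..(L / 2), f (s + τ) := by
  rw [intervalIntegral.integral_comp_add_left]
  have := hf.intervalIntegral_add_eq 0 (s + -(L / 2))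
  rw [zero_add] at this
  rw [this]
  congr 1
  ring

lemma exists_bound_of_periodic {E : Type*} [NormedAddCommGroup E] {f : ℝ → E} {L : ℝ}
    (hf : Function.Periodic f L) (hL : L ≠ 0) (hc : Continuous f) :
    ∃ C, 0 ≤ C ∧ ∀ t, ‖f t‖ ≤ C := by
  obtain ⟨C, hC⟩ := (hf.isBounded_of_continuous hL hc).exists_norm_le
  exact ⟨max C 0, le_max_right _ _, fun t => (hC _ ⟨t, rfl⟩).trans (le_max_left _ _)⟩

lemma periodic_deriv {E : Type*} [NormedAddCommGroup E] [NormedSpace ℝ E] {f : ℝ → E} {L : ℝ}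
    (hf : Function.Periodic f L) : Function.Periodic (deriv f) L := by
  intro t
  rw [← deriv_comp_add_const]
  congr 1
  ext u
  exact hf u

lemma intervalIntegrable_one_add_abs_log (C a b : ℝ) :
    IntervalIntegrable (fun τ => C * (1 + |Real.log τ|)) volume a b :=
  (intervalIntegrable_const.add intervalIntegral.intervalIntegrable_log'.abs).const_mul C

lemma tendsto_mul_one_add_abs_log :
    Tendsto (fun δ : ℝ => δ * (1 + |Real.log δ|)) (𝓝[>] 0) (𝓝 0) := by
  have a1 : Tendsto (fun δ : ℝ => δ + |δ * Real.log δ|) (𝓝 0) (𝓝 (0 + |0 * Real.log 0|)) :=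
    (continuous_id.add Real.continuous_mul_log.abs).tendsto 0
  simp only [zero_mul, abs_zero, add_zero] at a1
  refine (a1.mono_left nhdsWithin_le_nhds).congr' ?_
  filter_upwards [self_mem_nhdsWithin] with δ hδ
  rw [abs_mul, abs_of_pos (Set.mem_Ioi.mp hδ)]; ring

/-! ### Layer potentials with a logarithmic kernel -/

/-- Two closed curves `x`, `y`, the second of period `L`, that either coincide or are disjoint,
described by the estimates that both cases have in common. -/
structure CurvePair (x y : ℝ → Plane) (L : ℝ) : Prop where
  pos : 0 < L
  contDiff_left : ContDiff ℝ ∞ x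
  contDiff_right : ContDiff ℝ ∞ y
  periodic : Function.Periodic y L
  lower : ∃ c > 0, ∀ s τ, |τ| ≤ L / 2 → c * |τ| ≤ ‖x s - y (s + τ)‖
  upper : ∃ R, ∀ s t, ‖x s - y t‖ ≤ R
  tangent : ∃ C, 0 ≤ C ∧ ∀ s τ, |τ| ≤ L / 2 →
    ‖deriv x s - deriv y (s + τ)‖ ≤ C * ‖x s - y (s + τ)‖

namespace CurvePair

variable {x y : ℝ → Plane} {L : ℝ} {M : Plane → ℂ} {w : ℝ → ℂ}

lemma sub_ne_zero' (hp : CurvePair x y L) (s : ℝ) {τ : ℝ} (h0 : τ ≠ 0) (h : |τ| ≤ L / 2) :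
    x s - y (s + τ) ≠ 0 := by
  obtain ⟨c, hc, hl⟩ := hp.lower
  have := hl s τ h
  have h1 : 0 < c * |τ| := mul_pos hc (abs_pos.mpr h0)
  exact norm_pos_iff.mp (h1.trans_le this)

lemma log_bound (hp : CurvePair x y L) : ∃ C, 0 ≤ C ∧ ∀ s τ, τ ≠ 0 → |τ| ≤ L / 2 →
    1 + |Real.log ‖x s - y (s + τ)‖| ≤ C * (1 + |Real.log τ|) := by
  obtain ⟨c, hc, hl⟩ := hp.lower
  obtain ⟨R, hR⟩ := hp.upper
  refine ⟨1 + |Real.log c| + |Real.log R|, by positivity, fun s τ h0 h => ?_⟩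
  have hz := norm_pos_iff.mpr (hp.sub_ne_zero' s h0 h)
  have hτ := abs_pos.mpr h0
  -- `Real.log` depends on |τ| only, so negative τ needs no separate treatment.
  have h1 : Real.log c + Real.log τ ≤ Real.log ‖x s - y (s + τ)‖ := by
    rw [← Real.log_abs τ, ← Real.log_mul hc.ne' hτ.ne']
    exact Real.log_le_log (mul_pos hc hτ) (hl s τ h)
  have h2 : Real.log ‖x s - y (s + τ)‖ ≤ Real.log R := Real.log_le_log hz (hR _ _)
  have h3 : |Real.log ‖x s - y (s + τ)‖| ≤ |Real.log c| + |Real.log R| + |Real.log τ| := by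
    rw [abs_le]
    constructor
    · linarith [neg_abs_le (Real.log c), neg_abs_le (Real.log τ), abs_nonneg (Real.log R)]
    · linarith [le_abs_self (Real.log R), abs_nonneg (Real.log c), abs_nonneg (Real.log τ)]
  nlinarith [abs_nonneg (Real.log c), abs_nonneg (Real.log R), abs_nonneg (Real.log τ)]

/-- When both points move along the curves at fixed τ, the gradient is applied to x'(s) − y'(s + τ),
which is O(|x − y|) by `tangent`. This cancels the 1/|z| of the gradient, and the s-derivative is as
harmless as the kernel itself. -/
lemma kernel_bound (hp : CurvePair x y L) (hM : LogKernel M) :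
    ∃ C, 0 ≤ C ∧ ∀ s τ, τ ≠ 0 → |τ| ≤ L / 2 →
      ‖M (x s - y (s + τ))‖ ≤ C * (1 + |Real.log τ|) ∧
      ‖fderiv ℝ M (x s - y (s + τ)) (deriv x s - deriv y (s + τ))‖ ≤ C * (1 + |Real.log τ|) := by
  obtain ⟨R, hR⟩ := hp.upper
  obtain ⟨C, hC, hb⟩ := hM.bound R
  obtain ⟨C', hC', hl⟩ := hp.log_bound
  obtain ⟨C'', hC'', ht⟩ := hp.tangent
  refine ⟨C * C' + C * C' * C'', by positivity, fun s τ h0 h => ?_⟩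
  have hz0 := hp.sub_ne_zero' s h0 h
  have hz := norm_pos_iff.mpr hz0
  obtain ⟨h1, h2⟩ := hb _ hz0 (hR s (s + τ))
  have h3 := hl s τ h0 h
  have h4 := ht s τ h
  have h5 : 0 ≤ 1 + |Real.log τ| := by positivity
  have h6 : C * (1 + |Real.log ‖x s - y (s + τ)‖|) ≤ C * C' * (1 + |Real.log τ|) := by
    rw [mul_assoc]; gcongr
  have h7 : 0 ≤ C * C' * (1 + |Real.log τ|) := by positivity
  have h8 : 0 ≤ C * C' * C'' * (1 + |Real.log τ|) := by positivity
  constructor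
  · linarith
  · calc _ ≤ ‖fderiv ℝ M (x s - y (s + τ))‖ * ‖deriv x s - deriv y (s + τ)‖ :=
          ContinuousLinearMap.le_opNorm _ _
      _ ≤ C * C' * (1 + |Real.log τ|) / ‖x s - y (s + τ)‖ * (C'' * ‖x s - y (s + τ)‖) := by
          gcongr
          exact h2.trans (div_le_div_of_nonneg_right h6 hz.le)
      _ = C * C' * C'' * (1 + |Real.log τ|) := by field_simp
      _ ≤ _ := by linarith

lemma continuousOn_kernel (hp : CurvePair x y L) {F : Type*} [TopologicalSpace F] {N : Plane → F}
    (hN : ∀ z ≠ 0, ContinuousAt N z) (s : ℝ) :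
    ContinuousOn (fun τ => N (x s - y (s + τ))) {τ | τ ≠ 0 ∧ |τ| ≤ L / 2} := by
  rintro τ ⟨h0, h⟩
  have hy : Continuous fun τ => x s - y (s + τ) :=
    continuous_const.sub (hp.contDiff_right.continuous.comp (continuous_const.add continuous_id))
  exact (ContinuousAt.comp (f := fun τ => x s - y (s + τ)) (g := N)
    (hN _ (hp.sub_ne_zero' s h0 h)) hy.continuousAt).continuousWithinAt

lemma aestronglyMeasurable_of_continuousOn {f : ℝ → ℂ} {a : ℝ} (ha : 0 < a)
    (hf : ContinuousOn f {τ | τ ≠ 0 ∧ |τ| ≤ a}) :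
    AEStronglyMeasurable f (volume.restrict (Set.uIoc (-a) a)) := by
  have e : (Set.Ioc (-a) a \ {0} : Set ℝ) ⊆ {τ | τ ≠ 0 ∧ |τ| ≤ a} := fun τ h =>
    ⟨h.2, abs_le.mpr ⟨h.1.1.le, h.1.2⟩⟩
  have hm : MeasurableSet (Set.Ioc (-a) a \ {0} : Set ℝ) :=
    measurableSet_Ioc.diff (measurableSet_singleton 0)
  have := (hf.mono e).aestronglyMeasurable hm (μ := volume)
  rw [Set.uIoc_of_le (by linarith)]
  have h2 : (Set.Ioc (-a) a \ {0} : Set ℝ) =ᵐ[volume] Set.Ioc (-a) a :=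
    sdiff_null_ae_eq_self (by simp)
  rwa [Measure.restrict_congr_set h2] at this

lemma ae_ne_zero (s : Set ℝ) {p : ℝ → Prop} (h : ∀ τ, τ ≠ 0 → τ ∈ s → p τ) :
    ∀ᵐ τ ∂volume, τ ∈ s → p τ := by
  have : ∀ᵐ τ : ℝ ∂volume, τ ≠ 0 := by simp [ae_iff]
  filter_upwards [this] with τ h1 h2 using h τ h1 h2

lemma abs_le_of_mem {a τ : ℝ} (ha : 0 < a) (h : τ ∈ Set.uIoc (-a) a) : |τ| ≤ a := by
  rw [Set.uIoc_of_le (by linarith)] at h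
  exact abs_le.mpr ⟨h.1.le, h.2⟩

lemma hasFDerivAt_logKernel (hM : LogKernel M) {z : Plane} (hz : z ≠ 0) :
    HasFDerivAt M (fderiv ℝ M z) z :=
  ((hM.contDiffAt z hz).differentiableAt (by simp)).hasFDerivAt

lemma hasDerivAt_curve {c : ℝ → Plane} (hc : ContDiff ℝ ∞ c) (t : ℝ) :
    HasDerivAt c (deriv c t) t := (hc.differentiable (by simp) t).hasDerivAt

lemma hasDerivAt_density (hw : ContDiff ℝ 1 w) (t : ℝ) : HasDerivAt w (deriv w t) t :=
  (hw.differentiable (by simp) t).hasDerivAt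

lemma continuous_density_deriv (hw : ContDiff ℝ 1 w) : Continuous (deriv w) :=
  hw.continuous_deriv le_rfl

lemma intervalIntegrable_kernel (hp : CurvePair x y L) (hM : LogKernel M) (hw : Continuous w)
    (hwp : Function.Periodic w L) (s : ℝ) :
    IntervalIntegrable (fun τ => w (s + τ) * M (x s - y (s + τ))) volume (-(L / 2)) (L / 2) := by
  obtain ⟨C, hC, hk⟩ := hp.kernel_bound hM
  obtain ⟨W, hW, hwb⟩ := exists_bound_of_periodic hwp hp.pos.ne' hw
  have hL := half_pos hp.pos
  refine (intervalIntegrable_one_add_abs_log (W * C) _ _).mono_fun'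
    (aestronglyMeasurable_of_continuousOn hL ?_) ?_
  · exact ((hw.comp (continuous_const.add continuous_id)).continuousOn).mul
      (hp.continuousOn_kernel (fun z hz => (hM.contDiffAt z hz).continuousAt) s)
  · refine (ae_restrict_iff' measurableSet_uIoc).mpr (ae_ne_zero _ fun τ h0 h => ?_)
    simp only [norm_mul, mul_assoc]
    exact mul_le_mul (hwb _) (hk s τ h0 (abs_le_of_mem hL h)).1 (norm_nonneg _) hW

/-- The derivative of a layer potential with logarithmic kernel, and its expression by the
principal value of the differentiated integral. -/
theorem hasDerivAt_layer (hp : CurvePair x y L) (hM : LogKernel M) (hw : ContDiff ℝ 1 w)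
    (hwp : Function.Periodic w L) (s : ℝ)
    (hsym : Tendsto (fun δ : ℝ => M (x s - y (s + δ)) - M (x s - y (s - δ))) (𝓝[>] 0) (𝓝 0)) :
    ∃ v, HasDerivAt (fun s => ∫ t in (0 : ℝ)..L, w t * M (x s - y t)) v s ∧
      Tendsto (fun δ : ℝ =>
        (∫ τ in (-(L / 2))..(-δ), w (s + τ) * fderiv ℝ M (x s - y (s + τ)) (deriv x s)) +
          ∫ τ in δ..(L / 2), w (s + τ) * fderiv ℝ M (x s - y (s + τ)) (deriv x s))
        (𝓝[>] 0) (𝓝 v) := by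
  have hL := half_pos hp.pos
  obtain ⟨C, hC, hk⟩ := hp.kernel_bound hM
  obtain ⟨W, hW, hwb⟩ := exists_bound_of_periodic hwp hp.pos.ne' hw.continuous
  obtain ⟨W', hW', hwb'⟩ := exists_bound_of_periodic (periodic_deriv hwp) hp.pos.ne'
    (continuous_density_deriv hw)
  have hMc : ∀ z ≠ 0, ContinuousAt M z := fun z hz => (hM.contDiffAt z hz).continuousAt
  have hDc : ∀ z ≠ 0, ContinuousAt (fderiv ℝ M) z := fun z hz =>
    (contDiffAt_fderiv (hM.contDiffAt z hz)).continuousAt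
  have hsh : ∀ σ : ℝ, Continuous fun τ : ℝ => σ + τ := fun σ =>
    continuous_const.add continuous_id
  have hxc := hp.contDiff_left.continuous_deriv (by simp)
  have hyc := hp.contDiff_right.continuous_deriv (by simp)
  -- With t = σ + τ the singularity stays at τ = 0 for every σ. Here `hs` is the derivative of `h`
  -- in σ and `ht` its derivative in τ at σ = s; only `hs` has an integrable bound.
  set h : ℝ → ℝ → ℂ := fun σ τ => w (σ + τ) * M (x σ - y (σ + τ)) with hh
  set hs : ℝ → ℝ → ℂ := fun σ τ => deriv w (σ + τ) * M (x σ - y (σ + τ)) +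
    w (σ + τ) * fderiv ℝ M (x σ - y (σ + τ)) (deriv x σ - deriv y (σ + τ)) with hhs
  set ht : ℝ → ℂ := fun τ => deriv w (s + τ) * M (x s - y (s + τ)) +
    w (s + τ) * fderiv ℝ M (x s - y (s + τ)) (-deriv y (s + τ)) with hht
  have cM : ∀ σ, ContinuousOn (fun τ => M (x σ - y (σ + τ))) {τ | τ ≠ 0 ∧ |τ| ≤ L / 2} :=
    hp.continuousOn_kernel hMc
  have cD : ∀ σ, ContinuousOn (fun τ => fderiv ℝ M (x σ - y (σ + τ)))
    {τ | τ ≠ 0 ∧ |τ| ≤ L / 2} := hp.continuousOn_kernel hDc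
  have cw : ∀ σ (S : Set ℝ), ContinuousOn (fun τ => w (σ + τ)) S := fun σ S =>
    (hw.continuous.comp (hsh σ)).continuousOn
  have cw' : ∀ σ (S : Set ℝ), ContinuousOn (fun τ => deriv w (σ + τ)) S := fun σ S =>
    ((continuous_density_deriv hw).comp (hsh σ)).continuousOn
  have cy : ∀ σ (S : Set ℝ), ContinuousOn (fun τ => deriv y (σ + τ)) S := fun σ S =>
    (hyc.comp (hsh σ)).continuousOn
  have ch : ∀ σ, ContinuousOn (h σ) {τ | τ ≠ 0 ∧ |τ| ≤ L / 2} := fun σ => (cw σ _).mul (cM σ)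
  have chs : ∀ σ, ContinuousOn (hs σ) {τ | τ ≠ 0 ∧ |τ| ≤ L / 2} := fun σ =>
    ((cw' σ _).mul (cM σ)).add ((cw σ _).mul ((cD σ).clm_apply (continuousOn_const.sub (cy σ _))))
  have cht : ContinuousOn ht {τ | τ ≠ 0 ∧ |τ| ≤ L / 2} :=
    ((cw' s _).mul (cM s)).add ((cw s _).mul ((cD s).clm_apply (cy s _).neg))
  have bs : ∀ σ τ, τ ≠ 0 → |τ| ≤ L / 2 → ‖hs σ τ‖ ≤ (W' * C + W * C) * (1 + |Real.log τ|) := by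
    intro σ τ h0 h1
    obtain ⟨k1, k2⟩ := hk σ τ h0 h1
    refine (norm_add_le _ _).trans ?_
    rw [norm_mul, norm_mul, add_mul, mul_assoc, mul_assoc]
    exact add_le_add (mul_le_mul (hwb' _) k1 (norm_nonneg _) hW')
      (mul_le_mul (hwb _) k2 (norm_nonneg _) hW)
  have ds : ∀ σ τ, τ ≠ 0 → |τ| ≤ L / 2 → HasDerivAt (fun σ => h σ τ) (hs σ τ) σ := by
    intro σ τ h0 h1
    have e1 : HasDerivAt (fun σ => w (σ + τ)) (deriv w (σ + τ)) σ :=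
      (hasDerivAt_density hw (σ + τ)).comp_add_const σ τ
    have e2 : HasDerivAt (fun σ => x σ - y (σ + τ)) (deriv x σ - deriv y (σ + τ)) σ :=
      (hasDerivAt_curve hp.contDiff_left σ).sub
        ((hasDerivAt_curve hp.contDiff_right (σ + τ)).comp_add_const σ τ)
    have e3 : HasDerivAt (fun σ => M (x σ - y (σ + τ))) _ σ :=
      (hasFDerivAt_logKernel hM (hp.sub_ne_zero' σ h0 h1)).comp_hasDerivAt σ e2
    exact e1.mul e3
  have dt : ∀ τ, τ ≠ 0 → |τ| ≤ L / 2 → HasDerivAt (h s) (ht τ) τ := by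
    intro τ h0 h1
    have e1 : HasDerivAt (fun τ => w (s + τ)) (deriv w (s + τ)) τ :=
      (hasDerivAt_density hw (s + τ)).comp_const_add s τ
    have e2 : HasDerivAt (fun τ => x s - y (s + τ)) (-deriv y (s + τ)) τ :=
      ((hasDerivAt_curve hp.contDiff_right (s + τ)).comp_const_add s τ).const_sub _
    have e3 : HasDerivAt (fun τ => M (x s - y (s + τ))) _ τ :=
      (hasFDerivAt_logKernel hM (hp.sub_ne_zero' s h0 h1)).comp_hasDerivAt τ e2
    exact e1.mul e3
  obtain ⟨i1, i2⟩ := intervalIntegral.hasDerivAt_integral_of_dominated_loc_of_deriv_le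
    (μ := volume) (F := h) (F' := hs) (x₀ := s) (a := -(L / 2)) (b := L / 2) (s := Set.univ)
    (bound := fun τ => (W' * C + W * C) * (1 + |Real.log τ|)) univ_mem
    (Eventually.of_forall fun σ => aestronglyMeasurable_of_continuousOn hL (ch σ))
    (hp.intervalIntegrable_kernel hM hw.continuous hwp s)
    (aestronglyMeasurable_of_continuousOn hL (chs s))
    (ae_ne_zero _ fun τ h0 h σ _ => bs σ τ h0 (abs_le_of_mem hL h))
    (intervalIntegrable_one_add_abs_log _ _ _)
    (ae_ne_zero _ fun τ h0 h σ _ => ds σ τ h0 (abs_le_of_mem hL h))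
  refine ⟨∫ τ in (-(L / 2))..(L / 2), hs s τ, ?_, ?_⟩
  · have e : (fun s => ∫ t in (0 : ℝ)..L, w t * M (x s - y t)) =
        fun σ => ∫ τ in (-(L / 2))..(L / 2), h σ τ := by
      ext σ
      exact integral_periodic_shift (f := fun t => w t * M (x σ - y t))
        (fun t => by simp only [hwp t, hp.periodic t]) σ
    rw [e]
    exact i2
  have hper : h s (L / 2) = h s (-(L / 2)) := by
    have e : s + L / 2 = s + -(L / 2) + L := by ring
    simp only [hh, e, hwp (s + -(L / 2)), hp.periodic (s + -(L / 2))]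
  -- The jump splits into the difference of the densities times M, which is O(δ log δ), and a
  -- bounded density times the symmetric difference of M, which vanishes by `hsym`.
  have hbdry : Tendsto (fun δ : ℝ => h s δ - h s (-δ)) (𝓝[>] 0) (𝓝 0) := by
    have hw0 : (fun δ : ℝ => w (s + δ) - w (s - δ)) =O[𝓝[>] 0] fun δ => δ := by
      have a1 : HasDerivAt (fun δ : ℝ => w (s + δ) - w (s - δ)) (deriv w s - -deriv w s) 0 := by
        have b1 : HasDerivAt (fun δ : ℝ => w (s + δ)) (deriv w s) 0 := by
          have := (hasDerivAt_density hw (s + 0)).comp_const_add s 0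
          simpa using this
        have b2 : HasDerivAt (fun δ : ℝ => w (s - δ)) (-deriv w s) 0 := by
          have := (hasDerivAt_density hw (s - 0)).comp_const_sub s 0
          simpa using this
        exact b1.sub b2
      have := a1.isBigO_sub
      simp only [add_zero, sub_zero, sub_self] at this
      exact this.mono nhdsWithin_le_nhds
    have hM0 : (fun δ : ℝ => M (x s - y (s + δ))) =O[𝓝[>] 0] fun δ => 1 + |Real.log δ| := by
      refine Asymptotics.IsBigO.of_bound C ?_
      filter_upwards [Ioo_mem_nhdsGT hL] with δ hδ
      have := (hk s δ hδ.1.ne' (by rw [abs_of_pos hδ.1]; exact hδ.2.le)).1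
      rwa [Real.norm_of_nonneg (by positivity)]
    have t1 := (hw0.mul hM0).trans_tendsto tendsto_mul_one_add_abs_log
    have t2 : Tendsto (fun δ : ℝ => w (s - δ)) (𝓝[>] 0) (𝓝 (w s)) := by
      have hc : Continuous fun δ : ℝ => w (s - δ) := by fun_prop
      have := hc.tendsto 0
      simp only [sub_zero] at this
      exact this.mono_left nhdsWithin_le_nhds
    have t3 := t1.add (t2.mul hsym)
    simp only [mul_zero, add_zero] at t3
    refine t3.congr fun δ => ?_
    simp only [hh, ← sub_eq_add_neg]
    ring
  have t := (tendsto_punctured_integral hL i1).add hbdry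
  rw [add_zero] at t
  refine t.congr' ?_
  filter_upwards [Ioo_mem_nhdsGT hL] with δ hδ
  have e := integral_punctured_deriv dt cht hper hδ.1 hδ.2.le
  have s1 : Set.uIcc (-(L / 2)) (-δ) ⊆ {τ | τ ≠ 0 ∧ |τ| ≤ L / 2} := by
    rw [Set.uIcc_of_le (by linarith [hδ.2])]
    rintro τ ⟨h1, h2⟩
    exact ⟨by linarith [hδ.1], abs_le.mpr ⟨by linarith, by linarith [hδ.1]⟩⟩
  have s2 : Set.uIcc δ (L / 2) ⊆ {τ | τ ≠ 0 ∧ |τ| ≤ L / 2} := by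
    rw [Set.uIcc_of_le hδ.2.le]
    rintro τ ⟨h1, h2⟩
    exact ⟨by linarith [hδ.1], abs_le.mpr ⟨by linarith [hδ.1], by linarith⟩⟩
  -- The terms with w' and y' are common to both derivatives, so their difference is the derivative
  -- in x alone.
  have hk' : ∀ τ, w (s + τ) * fderiv ℝ M (x s - y (s + τ)) (deriv x s) = hs s τ - ht τ := by
    intro τ
    simp only [hhs, hht, map_sub, map_neg]
    ring
  simp only [hk']
  rw [intervalIntegral.integral_sub ((chs s).mono s1).intervalIntegrable
      (cht.mono s1).intervalIntegrable,
    intervalIntegral.integral_sub ((chs s).mono s2).intervalIntegrable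
      (cht.mono s2).intervalIntegrable]
  linear_combination e

end CurvePair

/-! ### Geometry of the boundary curves -/

lemma exists_shift {L : ℝ} (hL : 0 < L) (s t : ℝ) :
    ∃ (τ : ℝ) (n : ℤ), |τ| ≤ L / 2 ∧ t = s + τ + n • L := by
  have h := toIcoMod_mem_Ico hL (s - L / 2) t
  refine ⟨toIcoMod hL (s - L / 2) t - s, toIcoDiv hL (s - L / 2) t,
    abs_le.mpr ⟨by linarith [h.1], by linarith [h.2]⟩, ?_⟩
  have := toIcoMod_add_toIcoDiv_zsmul hL (s - L / 2) t
  rw [add_sub_cancel]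
  exact this.symm

namespace SmoothDomain

variable (D : SmoothDomain)

lemma hasDerivAt_curve (j : Fin D.num) (t : ℝ) :
    HasDerivAt (D.curve j) (deriv (D.curve j) t) t :=
  CurvePair.hasDerivAt_curve (D.smooth j) t

lemma contDiff_deriv_curve (j : Fin D.num) : ContDiff ℝ ∞ (deriv (D.curve j)) :=
  (contDiff_infty_iff_deriv.mp (D.smooth j)).2

lemma norm_curve_sub_le (j : Fin D.num) (s t : ℝ) :
    ‖D.curve j s - D.curve j t‖ ≤ |s - t| := by
  have := convex_univ.norm_image_sub_le_of_norm_deriv_le (f := D.curve j) (C := 1) (x := t) (y := s)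
    (fun x _ => (D.hasDerivAt_curve j x).differentiableAt) (fun x _ => (D.unit_speed j x).le)
    (Set.mem_univ _) (Set.mem_univ _)
  simpa using this

lemma exists_norm_deriv_sub_le (j : Fin D.num) : ∃ C, 0 ≤ C ∧ ∀ s t,
    ‖deriv (D.curve j) s - deriv (D.curve j) t‖ ≤ C * |s - t| := by
  have hc := D.contDiff_deriv_curve j
  obtain ⟨C, hC, hb⟩ := exists_bound_of_periodic (periodic_deriv (periodic_deriv (D.periodic j)))
    (D.len_pos j).ne' (hc.continuous_deriv (by simp))
  refine ⟨C, hC, fun s t => ?_⟩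
  exact convex_univ.norm_image_sub_le_of_norm_deriv_le (f := deriv (D.curve j))
    (fun x _ => hc.differentiable (by simp) x) (fun x _ => hb x) (Set.mem_univ _) (Set.mem_univ _)

lemma exists_taylor (j : Fin D.num) : ∃ C, 0 ≤ C ∧ ∀ s t,
    ‖D.curve j t - D.curve j s - (t - s) • deriv (D.curve j) s‖ ≤ C * |t - s| ^ 2 := by
  obtain ⟨C, hC, hb⟩ := D.exists_norm_deriv_sub_le j
  refine ⟨C, hC, fun s t => ?_⟩
  have hd : ∀ σ, HasDerivAt (fun σ => D.curve j σ - σ • deriv (D.curve j) s)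
      (deriv (D.curve j) σ - deriv (D.curve j) s) σ := fun σ => by
    have := (D.hasDerivAt_curve j σ).fun_sub ((hasDerivAt_id σ).smul_const (deriv (D.curve j) s))
    exact this.congr_deriv (by rw [one_smul])
  have := (convex_uIcc s t).norm_image_sub_le_of_norm_hasDerivWithin_le (C := C * |t - s|)
    (fun σ _ => (hd σ).hasDerivWithinAt) (fun σ hσ => (hb σ s).trans (by
      gcongr C * ?_; exact Set.abs_sub_left_of_mem_uIcc hσ)) Set.left_mem_uIcc Set.right_mem_uIcc
  calc _ = ‖D.curve j t - t • deriv (D.curve j) s - (D.curve j s - s • deriv (D.curve j) s)‖ := by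
        congr 1; module
    _ ≤ C * |t - s| * ‖t - s‖ := this
    _ = _ := by rw [Real.norm_eq_abs]; ring

lemma exists_norm_curve_sub_ge (j : Fin D.num) : ∃ C, 0 ≤ C ∧ ∀ s τ,
    |τ| - C * τ ^ 2 ≤ ‖D.curve j s - D.curve j (s + τ)‖ := by
  obtain ⟨C, hC, hb⟩ := D.exists_taylor j
  refine ⟨C, hC, fun s τ => ?_⟩
  have h := hb s (s + τ)
  rw [add_sub_cancel_left, sq_abs] at h
  have h2 : ‖τ • deriv (D.curve j) s‖ = |τ| := by
    rw [norm_smul, D.unit_speed, mul_one, Real.norm_eq_abs]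
  have h3 := norm_sub_norm_le (τ • deriv (D.curve j) s) (D.curve j (s + τ) - D.curve j s)
  rw [h2, norm_sub_rev (τ • _), norm_sub_rev (D.curve j (s + τ))] at h3
  linarith

lemma norm_normal (j : Fin D.num) (t : ℝ) : ‖D.normal j t‖ = 1 := by
  have h := D.unit_speed j t
  rw [EuclideanSpace.norm_eq, Fin.sum_univ_two] at h ⊢
  rw [← h]
  simp [normal, add_comm]

lemma inner_normal_deriv (j : Fin D.num) (t : ℝ) :
    inner ℝ (D.normal j t) (deriv (D.curve j) t) = 0 := by
  simp [normal, PiLp.inner_apply, Fin.sum_univ_two]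
  ring

lemma eq_of_curve_eq (j : Fin D.num) {s t : ℝ} (h : D.curve j s = D.curve j t) :
    ∃ n : ℤ, s - t = n • D.len j := by
  have hL := D.len_pos j
  have e : ∀ u, D.curve j (toIcoMod hL 0 u) = D.curve j u := fun u => by
    rw [toIcoMod, (D.periodic j).sub_zsmul_eq]
  have := D.injOn j (toIcoMod_mem_Ico' hL s) (toIcoMod_mem_Ico' hL t) (by rw [e, e, h])
  refine ⟨toIcoDiv hL 0 s - toIcoDiv hL 0 t, ?_⟩
  rw [sub_zsmul, ← self_sub_toIcoMod, ← self_sub_toIcoMod, this]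
  ring

lemma curve_ne (j : Fin D.num) (s : ℝ) {τ : ℝ} (h0 : τ ≠ 0) (h : |τ| ≤ D.len j / 2) :
    D.curve j s ≠ D.curve j (s + τ) := by
  intro he
  obtain ⟨n, hn⟩ := D.eq_of_curve_eq j he
  have hL := D.len_pos j
  rw [sub_add_cancel_left, zsmul_eq_mul] at hn
  have h1 : |(n : ℝ)| * D.len j ≤ D.len j / 2 := by
    rw [← abs_neg, hn, abs_mul, abs_of_pos hL] at h; exact h
  have h2 : |(n : ℝ)| < 1 := by nlinarith
  have h3 : |n| < 1 := by exact_mod_cast h2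
  have h4 : n = 0 := Int.abs_lt_one_iff.mp h3
  rw [h4] at hn
  simp at hn
  exact h0 hn

/-- For small |τ| Taylor's formula at unit speed gives |τ|/2; for the remaining τ the chord is
bounded below by compactness, as the curve is injective modulo its length. -/
lemma exists_chord_arc (j : Fin D.num) : ∃ c > 0, ∀ s τ, |τ| ≤ D.len j / 2 →
    c * |τ| ≤ ‖D.curve j s - D.curve j (s + τ)‖ := by
  obtain ⟨C, hC, hb⟩ := D.exists_norm_curve_sub_ge j
  have hL := D.len_pos j
  -- Chosen so that |τ| < η makes the Taylor remainder Cτ² at most |τ|/2.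
  set η := 1 / (2 * (C + 1)) with hη
  have hη0 : 0 < η := by positivity
  set K : Set (ℝ × ℝ) := Set.Icc 0 (D.len j) ×ˢ (Set.Icc (-(D.len j / 2)) (D.len j / 2) ∩ {τ | η ≤ |τ|})
  have hK : IsCompact K := isCompact_Icc.prod
    (isCompact_Icc.inter_right (isClosed_le continuous_const continuous_abs))
  have hcc := (D.smooth j).continuous
  have hf : ContinuousOn (fun p : ℝ × ℝ => ‖D.curve j p.1 - D.curve j (p.1 + p.2)‖) K := by
    have : Continuous fun p : ℝ × ℝ => ‖D.curve j p.1 - D.curve j (p.1 + p.2)‖ := by fun_prop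
    exact this.continuousOn
  obtain ⟨m, hm, hmb⟩ := hK.exists_forall_le' hf (a := 0) (by
    rintro ⟨s, τ⟩ ⟨-, h2, h3⟩
    refine norm_pos_iff.mpr (sub_ne_zero.mpr (D.curve_ne j s ?_ (abs_le.mpr h2)))
    intro h0
    rw [Set.mem_ofPred_eq, h0, abs_zero] at h3
    linarith)
  refine ⟨min (1 / 2) (m / D.len j), by positivity, fun s τ hτ => ?_⟩
  have hτ0 := abs_nonneg τ
  by_cases h : |τ| < η
  · refine le_trans ?_ (hb s τ)
    have h1 : (C + 1) * |τ| ≤ 1 / 2 := by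
      rw [hη, lt_div_iff₀ (by positivity)] at h; nlinarith
    have h2 : min (1 / 2) (m / D.len j) * |τ| ≤ 1 / 2 * |τ| := by gcongr; exact min_le_left _ _
    have h3 : C * τ ^ 2 ≤ 1 / 2 * |τ| := by rw [← sq_abs]; nlinarith
    linarith
  -- Periodicity moves s into one period, where the minimum over the compact set `K` applies.
  · obtain ⟨u, hu⟩ : ∃ u, u = toIcoMod hL 0 s := ⟨_, rfl⟩
    have hs : s = u + toIcoDiv hL 0 s • D.len j := by
      rw [hu]; exact (toIcoMod_add_toIcoDiv_zsmul hL 0 s).symm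
    have e1 : D.curve j s = D.curve j u := by
      conv_lhs => rw [hs]
      exact (D.periodic j).zsmul _ u
    have e2 : D.curve j (s + τ) = D.curve j (u + τ) := by
      have : s + τ = u + τ + toIcoDiv hL 0 s • D.len j := by
        conv_lhs => rw [hs]
        ring
      rw [this]
      exact (D.periodic j).zsmul _ (u + τ)
    have hu' : u ∈ Set.Ico 0 (D.len j) := hu ▸ toIcoMod_mem_Ico' hL s
    have := hmb (u, τ) ⟨⟨hu'.1, hu'.2.le⟩, abs_le.mp hτ, not_lt.mp h⟩
    rw [e1, e2]
    refine le_trans ?_ this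
    calc min (1 / 2) (m / D.len j) * |τ| ≤ m / D.len j * D.len j := by
          gcongr
          · exact min_le_right _ _
          · linarith
      _ = m := by field_simp

lemma exists_le_norm_sub {i j : Fin D.num} (hij : i ≠ j) :
    ∃ d > 0, ∀ s t, d ≤ ‖D.curve i s - D.curve j t‖ := by
  have hK : IsCompact (Set.range (D.curve i) ×ˢ Set.range (D.curve j)) :=
    ((D.periodic i).compact_of_continuous (D.len_pos i).ne' (D.smooth i).continuous).prod
      ((D.periodic j).compact_of_continuous (D.len_pos j).ne' (D.smooth j).continuous)
  have hf : Continuous fun p : Plane × Plane => ‖p.1 - p.2‖ := by fun_prop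
  obtain ⟨d, hd, hb⟩ := hK.exists_forall_le' hf.continuousOn (a := 0) (by
    rintro ⟨p, r⟩ ⟨h1, h2⟩
    refine norm_pos_iff.mpr (sub_ne_zero.mpr ?_)
    intro h
    simp only at h h1 h2
    rw [h] at h1
    exact Set.disjoint_left.mp (D.disjoint i j hij) h1 h2)
  exact ⟨d, hd, fun s t => hb (_, _) ⟨⟨s, rfl⟩, ⟨t, rfl⟩⟩⟩

lemma exists_norm_sub_le (i j : Fin D.num) : ∃ R, ∀ s t, ‖D.curve i s - D.curve j t‖ ≤ R := by
  obtain ⟨C, -, h⟩ := exists_bound_of_periodic (D.periodic i) (D.len_pos i).ne'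
    (D.smooth i).continuous
  obtain ⟨C', -, h'⟩ := exists_bound_of_periodic (D.periodic j) (D.len_pos j).ne'
    (D.smooth j).continuous
  exact ⟨C + C', fun s t => (norm_sub_le _ _).trans (add_le_add (h s) (h' t))⟩

/-- Any two boundary components form a pair of curves that coincide or are disjoint. -/
lemma curvePair (i j : Fin D.num) : CurvePair (D.curve i) (D.curve j) (D.len j) := by
  have hL := D.len_pos j
  refine ⟨hL, D.smooth i, D.smooth j, D.periodic j, ?_, D.exists_norm_sub_le i j, ?_⟩
  · by_cases hij : i = j
    · subst hij; exact D.exists_chord_arc i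
    · obtain ⟨d, hd, hb⟩ := D.exists_le_norm_sub hij
      refine ⟨d / D.len j, by positivity, fun s τ hτ => le_trans ?_ (hb s (s + τ))⟩
      rw [div_mul_eq_mul_div, div_le_iff₀ hL]
      gcongr
      linarith
  · by_cases hij : i = j
    · subst hij
      obtain ⟨c, hc, hl⟩ := D.exists_chord_arc i
      obtain ⟨C, hC, hb⟩ := D.exists_norm_deriv_sub_le i
      refine ⟨C / c, by positivity, fun s τ hτ => (hb s (s + τ)).trans ?_⟩
      rw [sub_add_cancel_left, abs_neg, div_mul_eq_mul_div, le_div_iff₀ hc, mul_assoc, mul_comm _ c]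
      gcongr
      exact hl s τ hτ
    · obtain ⟨d, hd, hb⟩ := D.exists_le_norm_sub hij
      refine ⟨2 / d, by positivity, fun s τ _ => ?_⟩
      have h1 : ‖deriv (D.curve i) s - deriv (D.curve j) (s + τ)‖ ≤ 2 := by
        refine (norm_sub_le _ _).trans ?_
        rw [D.unit_speed, D.unit_speed]; norm_num
      refine h1.trans ?_
      rw [div_mul_eq_mul_div, le_div_iff₀ hd]
      gcongr
      exact hb s (s + τ)

lemma curve_shift (j : Fin D.num) (t : ℝ) (n : ℤ) :
    D.curve j (t + n • D.len j) = D.curve j t := (D.periodic j).zsmul n t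

lemma normal_periodic (j : Fin D.num) : Function.Periodic (D.normal j) (D.len j) := by
  intro t
  simp only [normal, periodic_deriv (D.periodic j) t]

lemma normal_shift (j : Fin D.num) (t : ℝ) (n : ℤ) :
    D.normal j (t + n • D.len j) = D.normal j t := (D.normal_periodic j).zsmul n t

/-- On a smooth curve, chords are tangential up to second order. -/
lemma exists_inner_normal_le (i j : Fin D.num) : ∃ C, 0 ≤ C ∧ ∀ s t,
    |inner ℝ (D.normal i s) (D.curve i s - D.curve j t)| ≤
        C * ‖D.curve i s - D.curve j t‖ ^ 2 ∧
      |inner ℝ (D.normal j t) (D.curve i s - D.curve j t)| ≤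
        C * ‖D.curve i s - D.curve j t‖ ^ 2 := by
  by_cases hij : i = j
  · subst hij
    obtain ⟨C, hC, hb⟩ := D.exists_taylor i
    obtain ⟨c, hc, hl⟩ := D.exists_chord_arc i
    have key : ∀ s t, |inner ℝ (D.normal i s) (D.curve i s - D.curve i t)| ≤ C * |t - s| ^ 2 := by
      intro s t
      -- The linear Taylor term is tangential, so the normal sees only the quadratic remainder.
      have e : inner ℝ (D.normal i s) (D.curve i s - D.curve i t) =
          -inner ℝ (D.normal i s) (D.curve i t - D.curve i s - (t - s) • deriv (D.curve i) s) := by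
        rw [inner_sub_right _ _ ((t - s) • _), inner_smul_right, inner_normal_deriv, mul_zero,
          sub_zero, ← inner_neg_right, neg_sub]
      rw [e, abs_neg]
      refine (abs_real_inner_le_norm _ _).trans ?_
      rw [D.norm_normal, one_mul]
      exact hb s t
    have hsq : ∀ s τ, |τ| ≤ D.len i / 2 → C * |τ| ^ 2 ≤
        C / c ^ 2 * ‖D.curve i s - D.curve i (s + τ)‖ ^ 2 := by
      intro s τ hτ
      have h := hl s τ hτ
      have h2 : (c * |τ|) ^ 2 ≤ ‖D.curve i s - D.curve i (s + τ)‖ ^ 2 := by gcongr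
      rw [div_mul_eq_mul_div, le_div_iff₀ (by positivity)]
      calc C * |τ| ^ 2 * c ^ 2 = C * (c * |τ|) ^ 2 := by ring
        _ ≤ _ := by gcongr
    refine ⟨C / c ^ 2, by positivity, fun s t => ?_⟩
    obtain ⟨τ, n, hτ, rfl⟩ := exists_shift (D.len_pos i) s t
    rw [D.curve_shift, D.normal_shift]
    have h1 := hsq s τ hτ
    constructor
    · have := key s (s + τ)
      rw [add_sub_cancel_left] at this
      exact this.trans h1
    · have := key (s + τ) s
      rw [sub_add_cancel_left, abs_neg] at this
      rw [← neg_sub (D.curve i (s + τ)) (D.curve i s), inner_neg_right, abs_neg, norm_neg]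
      rw [norm_sub_rev] at h1
      exact this.trans h1
  · obtain ⟨d, hd, hb⟩ := D.exists_le_norm_sub hij
    refine ⟨1 / d, by positivity, fun s t => ?_⟩
    have h0 := hb s t
    have h1 : ‖D.curve i s - D.curve j t‖ ≤ 1 / d * ‖D.curve i s - D.curve j t‖ ^ 2 := by
      rw [div_mul_eq_mul_div, one_mul, le_div_iff₀ hd, pow_two]
      gcongr
    constructor <;>
    · refine ((abs_real_inner_le_norm _ _).trans ?_).trans h1
      rw [D.norm_normal, one_mul]

/-- A logarithmic kernel has symmetric limits on the boundary. -/
lemma tendsto_symmetric_difference {M : Plane → ℂ} (hM : LogKernel M) (i j : Fin D.num) (s : ℝ) :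
    Tendsto (fun δ : ℝ => M (D.curve i s - D.curve j (s + δ)) - M (D.curve i s - D.curve j (s - δ)))
      (𝓝[>] 0) (𝓝 0) := by
  by_cases hij : i = j
  · subst hij
    obtain ⟨C, hC, hb⟩ := D.exists_taylor i
    obtain ⟨c, hc, hl⟩ := D.exists_chord_arc i
    obtain ⟨K, hK, hMb⟩ := hM.bound 1
    have hL := D.len_pos i
    have hbig : ∀ᶠ δ : ℝ in 𝓝[>] 0,
        ‖M (D.curve i s - D.curve i (s + δ)) - M (D.curve i s - D.curve i (s - δ))‖ ≤
          K * (1 + (|Real.log (c / 2)| + |Real.log δ|)) / (c / 2 * δ) * (2 * C * δ ^ 2) := by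
      -- The bound by half the length makes the chord-arc estimate available; the last two give 2Cδ²
      -- ≤ cδ/2 and 2Cδ² ≤ δ/2, which together with δ < 1/2 keep the segment between cδ/2 and 1 in
      -- norm.
      have hr : 0 < min (min (1 / 2) (D.len i / 2)) (min (c / (4 * (C + 1))) (1 / (4 * (C + 1)))) := by
        positivity
      filter_upwards [Ioo_mem_nhdsGT hr] with δ hδ
      have hδ0 := hδ.1
      have hδ1 : δ < 1 / 2 := hδ.2.trans_le ((min_le_left _ _).trans (min_le_left _ _))
      have hδL : δ < D.len i / 2 := hδ.2.trans_le ((min_le_left _ _).trans (min_le_right _ _))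
      have hδ3 : δ < c / (4 * (C + 1)) :=
        hδ.2.trans_le ((min_le_right _ _).trans (min_le_left _ _))
      have hδ4 : δ < 1 / (4 * (C + 1)) :=
        hδ.2.trans_le ((min_le_right _ _).trans (min_le_right _ _))
      rw [lt_div_iff₀ (by positivity)] at hδ3 hδ4
      set z₁ := D.curve i s - D.curve i (s + δ) with hz₁
      -- Evenness allows the second difference to be reversed. Now z₁ and z₂ are both −δ times the
      -- tangent up to O(δ²), and a gradient of size |log δ|/δ on the segment between them gives
      -- O(δ|log δ|).
      set z₂ := D.curve i (s - δ) - D.curve i s with hz₂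
      have hev : M (D.curve i s - D.curve i (s - δ)) = M z₂ := by
        rw [hz₂, ← neg_sub, hM.even]
      have h1 := hb s (s + δ)
      have h2 := hb s (s - δ)
      rw [add_sub_cancel_left, sq_abs] at h1
      rw [sub_sub_cancel_left, sq_abs, neg_sq] at h2
      have h12 : ‖z₁ - z₂‖ ≤ 2 * C * δ ^ 2 := by
        have e : z₁ - z₂ = -((D.curve i (s + δ) - D.curve i s - δ • deriv (D.curve i) s) +
          (D.curve i (s - δ) - D.curve i s - (-δ) • deriv (D.curve i) s)) := by
          rw [hz₁, hz₂]; module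
        rw [e, norm_neg]
        refine (norm_add_le _ _).trans ?_
        linarith
      have hz1 : c * δ ≤ ‖z₁‖ := by
        have := hl s δ (by rw [abs_of_pos hδ0]; exact hδL.le)
        rwa [abs_of_pos hδ0] at this
      have hz1' : ‖z₁‖ ≤ δ := by
        have := D.norm_curve_sub_le i s (s + δ)
        rwa [sub_add_cancel_left, abs_neg, abs_of_pos hδ0] at this
      have hseg : ∀ z ∈ segment ℝ z₁ z₂, c / 2 * δ ≤ ‖z‖ ∧ ‖z‖ ≤ 1 := by
        intro z hz
        have h3 : ‖z - z₁‖ ≤ 2 * C * δ ^ 2 := by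
          have := norm_sub_le_of_mem_segment hz
          refine (this.trans ?_)
          rw [norm_sub_rev]; exact h12
        have h4 := norm_sub_norm_le z₁ z
        have h5 := norm_sub_norm_le z z₁
        rw [norm_sub_rev z₁ z] at h4
        have h6 : 2 * C * δ ^ 2 ≤ c / 2 * δ := by nlinarith
        have h7 : 2 * C * δ ^ 2 ≤ 1 / 2 * δ := by nlinarith
        constructor <;> linarith
      have hne : ∀ z ∈ segment ℝ z₁ z₂, z ≠ 0 := fun z hz => by
        have := (hseg z hz).1
        have h0 : 0 < c / 2 * δ := by positivity
        exact norm_pos_iff.mp (h0.trans_le this)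
      have hD : ∀ z ∈ segment ℝ z₁ z₂, ‖fderiv ℝ M z‖ ≤
          K * (1 + (|Real.log (c / 2)| + |Real.log δ|)) / (c / 2 * δ) := by
        intro z hz
        obtain ⟨h3, h4⟩ := hseg z hz
        have h0 : 0 < c / 2 * δ := by positivity
        refine (hMb z (hne z hz) h4).2.trans ?_
        have hlog : |Real.log ‖z‖| ≤ |Real.log (c / 2)| + |Real.log δ| := by
          have e1 : Real.log (c / 2 * δ) ≤ Real.log ‖z‖ := Real.log_le_log h0 h3
          rw [Real.log_mul (by positivity) hδ0.ne'] at e1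
          have e2 : Real.log ‖z‖ ≤ 0 := Real.log_nonpos (norm_nonneg _) h4
          rw [abs_of_nonpos e2]
          linarith [neg_abs_le (Real.log (c / 2)), neg_abs_le (Real.log δ)]
        gcongr
      have := (convex_segment z₁ z₂).norm_image_sub_le_of_norm_fderiv_le
        (f := M) (fun z hz => (CurvePair.hasFDerivAt_logKernel hM (hne z hz)).differentiableAt)
        hD (left_mem_segment ℝ z₁ z₂) (right_mem_segment ℝ z₁ z₂)
      rw [hev, norm_sub_rev]
      rw [norm_sub_rev z₂] at this
      refine this.trans ?_
      gcongr
    have t1 := tendsto_mul_one_add_abs_log.const_mul (4 * C * K / c)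
    have t2 : Tendsto (fun δ : ℝ => 4 * C * K / c * |Real.log (c / 2)| * δ) (𝓝[>] 0) (𝓝 0) := by
      have : Tendsto (fun δ : ℝ => 4 * C * K / c * |Real.log (c / 2)| * δ) (𝓝 0)
          (𝓝 (4 * C * K / c * |Real.log (c / 2)| * 0)) := (continuous_const.mul continuous_id).tendsto 0
      rw [mul_zero] at this
      exact this.mono_left nhdsWithin_le_nhds
    have t3 := t1.add t2
    rw [mul_zero, add_zero] at t3
    refine squeeze_zero_norm' ?_ t3
    filter_upwards [hbig, self_mem_nhdsWithin] with δ h hδ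
    refine h.trans_eq ?_
    have hδ0 : δ ≠ 0 := (Set.mem_Ioi.mp hδ).ne'
    field_simp
    ring
  · obtain ⟨d, hd, hb⟩ := D.exists_le_norm_sub hij
    have hz : D.curve i s - D.curve j s ≠ 0 := norm_pos_iff.mp (hd.trans_le (hb s s))
    have hc := (hM.contDiffAt _ hz).continuousAt
    have hcj := (D.smooth j).continuous
    have t1 : Tendsto (fun δ : ℝ => D.curve i s - D.curve j (s + δ)) (𝓝[>] 0)
        (𝓝 (D.curve i s - D.curve j s)) := by
      have : Continuous fun δ : ℝ => D.curve i s - D.curve j (s + δ) := by fun_prop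
      have := this.tendsto 0
      rw [add_zero] at this
      exact this.mono_left nhdsWithin_le_nhds
    have t2 : Tendsto (fun δ : ℝ => D.curve i s - D.curve j (s - δ)) (𝓝[>] 0)
        (𝓝 (D.curve i s - D.curve j s)) := by
      have : Continuous fun δ : ℝ => D.curve i s - D.curve j (s - δ) := by fun_prop
      have := this.tendsto 0
      rw [sub_zero] at this
      exact this.mono_left nhdsWithin_le_nhds
    have := (hc.tendsto.comp t1).sub (hc.tendsto.comp t2)
    rw [sub_self] at this
    exact this

end SmoothDomain

/-! ### Truncated integrals -/

lemma setIntegral_periodic_shift {E : Type*} [NormedAddCommGroup E] [NormedSpace ℝ E]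
    {f : ℝ → E} {L : ℝ} (hL : 0 < L) (hf : Function.Periodic f L) {A : Set ℝ}
    (hA : MeasurableSet A) (hAp : ∀ t, t + L ∈ A ↔ t ∈ A) (s : ℝ) :
    ∫ t in Set.Ioc 0 L ∩ A, f t =
      ∫ τ in Set.Ioc (-(L / 2)) (L / 2) ∩ {τ | s + τ ∈ A}, f (s + τ) := by
  have hA' : MeasurableSet {τ | s + τ ∈ A} := (measurable_const_add s) hA
  rw [← setIntegral_indicator hA, ← setIntegral_indicator hA',
    ← intervalIntegral.integral_of_le hL.le, ← intervalIntegral.integral_of_le (by linarith),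
    integral_periodic_shift (f := A.indicator f) (fun t => ?_) s]
  · rfl
  · by_cases h : t ∈ A
    · rw [Set.indicator_of_mem h, Set.indicator_of_mem ((hAp t).mpr h), hf t]
    · rw [Set.indicator_of_notMem h, Set.indicator_of_notMem (fun h' => h ((hAp t).mp h'))]

/-- Truncating a singular integral by arclength or by distance makes no difference in the limit,
when the integrand is almost of order `1 / |τ|` and the two are equal up to second order. -/
lemma tendsto_punctured_sub_truncated {k : ℝ → ℂ} {r : ℝ → ℝ} {a c C B : ℝ} (ha : 0 < a)
    (hc : 0 < c) (hC : 0 ≤ C) (hB : 0 ≤ B) (hr : Measurable r)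
    (h1 : ∀ τ, |τ| ≤ a → r τ ≤ |τ|) (h2 : ∀ τ, |τ| ≤ a → c * |τ| ≤ r τ)
    (h3 : ∀ τ, |τ| ≤ a → |τ| - C * τ ^ 2 ≤ r τ)
    (hk : ContinuousOn k {τ | τ ≠ 0 ∧ |τ| ≤ a})
    (hkb : ∀ τ, τ ≠ 0 → |τ| ≤ a → ‖k τ‖ ≤ B * (1 + |Real.log τ|) / |τ|) :
    Tendsto (fun δ : ℝ => ((∫ τ in (-a)..(-δ), k τ) + ∫ τ in δ..a, k τ) -
      ∫ τ in Set.Ioc (-a) a ∩ {τ | δ < r τ}, k τ) (𝓝[>] 0) (𝓝 0) := by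
  have t := tendsto_mul_one_add_abs_log.const_mul (B * (2 * (C / c ^ 2)))
  rw [mul_zero] at t
  refine squeeze_zero_norm' ?_ t
  -- The condition δ < c forces |τ| < 1 wherever the two truncations differ, so there |log τ| is at
  -- most |log δ|.
  filter_upwards [Ioo_mem_nhdsGT ha, Ioo_mem_nhdsGT hc] with δ hδ hδ'
  have hδ0 := hδ.1
  have hmS : MeasurableSet (Set.Ioc (-a) a ∩ {τ | δ < r τ}) :=
    measurableSet_Ioc.inter (measurableSet_lt measurable_const hr)
  set S := Set.Ioc (-a) a ∩ {τ | δ < r τ} with hS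
  set T := Set.Ioc (-a) (-δ) ∪ Set.Ioc δ a with hT
  have hcont : ∀ b e : ℝ, b ≤ e → Set.Icc b e ⊆ {τ | τ ≠ 0 ∧ |τ| ≤ a} →
      IntegrableOn k (Set.Ioc b e) := fun b e hbe hs =>
    ((hk.mono hs).integrableOn_Icc).mono_set Set.Ioc_subset_Icc_self
  have i1 : IntegrableOn k (Set.Ioc (-a) (-δ)) := hcont _ _ (by linarith [hδ.2]) fun τ h =>
    ⟨by linarith [h.2], abs_le.mpr ⟨h.1, by linarith [h.2]⟩⟩
  have i2 : IntegrableOn k (Set.Ioc δ a) := hcont _ _ hδ.2.le fun τ h =>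
    ⟨by linarith [h.1], abs_le.mpr ⟨by linarith [h.1], h.2⟩⟩
  have eT : (∫ τ in (-a)..(-δ), k τ) + ∫ τ in δ..a, k τ = ∫ τ in T, k τ := by
    rw [intervalIntegral.integral_of_le (by linarith [hδ.2]),
      intervalIntegral.integral_of_le hδ.2.le, hT, setIntegral_union ?_ measurableSet_Ioc i1 i2]
    exact Set.disjoint_left.mpr fun τ h h' => by linarith [h.2, h'.1]
  have hST : S ⊆ T := by
    rintro τ ⟨hτ, hτ'⟩
    have hab : |τ| ≤ a := abs_le.mpr ⟨hτ.1.le, hτ.2⟩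
    have : δ < |τ| := lt_of_lt_of_le hτ' (h1 τ hab)
    rcases lt_abs.mp this with h | h
    · exact Or.inr ⟨h, hτ.2⟩
    · exact Or.inl ⟨hτ.1, by linarith⟩
  rw [eT, ← setIntegral_sdiff hmS (i1.union i2) hST]
  set K := C / c ^ 2 with hK
  have hKnn : 0 ≤ K := by positivity
  -- On the discrepancy set r ≤ δ, hence |τ| ≤ δ/c, and then |τ| ≤ δ + Cτ² ≤ δ + Kδ²: two intervals
  -- of length Kδ².
  have hmem : ∀ τ ∈ T \ S, δ ≤ |τ| ∧ |τ| ≤ 1 ∧ |τ| ≤ a ∧ |τ| ≤ δ + K * δ ^ 2 := by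
    rintro τ ⟨hτ, hτ'⟩
    have hδτ : δ ≤ |τ| := by
      rcases hτ with h | h
      · exact le_abs.mpr (Or.inr (by linarith [h.2]))
      · exact le_abs.mpr (Or.inl h.1.le)
    have hI : τ ∈ Set.Ioc (-a) a := by
      rcases hτ with h | h
      · exact ⟨h.1, by linarith [h.2]⟩
      · exact ⟨by linarith [h.1], h.2⟩
    have hab : |τ| ≤ a := abs_le.mpr ⟨hI.1.le, hI.2⟩
    have hrτ : r τ ≤ δ := by
      by_contra h
      exact hτ' ⟨hI, not_le.mp h⟩
    have hcτ := (h2 τ hab).trans hrτ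
    have h4 : c * |τ| < c * 1 := by linarith [hδ'.2]
    refine ⟨hδτ, (lt_of_mul_lt_mul_left h4 hc.le).le, hab, ?_⟩
    have h5 : C * τ ^ 2 ≤ K * δ ^ 2 := by
      rw [hK, div_mul_eq_mul_div, le_div_iff₀ (by positivity), ← sq_abs τ]
      calc C * |τ| ^ 2 * c ^ 2 = C * (c * |τ|) ^ 2 := by ring
        _ ≤ C * δ ^ 2 := by gcongr
    linarith [h3 τ hab]
  have hsub : T \ S ⊆ Set.Icc (-(δ + K * δ ^ 2)) (-δ) ∪ Set.Icc δ (δ + K * δ ^ 2) := by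
    intro τ hτ
    obtain ⟨e1, -, -, e2⟩ := hmem τ hτ
    obtain ⟨e3, e4⟩ := abs_le.mp e2
    rcases le_abs.mp e1 with h | h
    · exact Or.inr ⟨h, e4⟩
    · exact Or.inl ⟨e3, by linarith⟩
  have hvol : volume (T \ S) ≤ ENNReal.ofReal (2 * (K * δ ^ 2)) := by
    refine (measure_mono hsub).trans ((measure_union_le _ _).trans ?_)
    rw [Real.volume_Icc, Real.volume_Icc, ← ENNReal.ofReal_add (by nlinarith [sq_nonneg δ])
      (by nlinarith [sq_nonneg δ])]
    exact ENNReal.ofReal_le_ofReal (by linarith)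
  have hbd : ∀ τ ∈ T \ S, ‖k τ‖ ≤ B * (1 + |Real.log δ|) / δ := by
    intro τ hτ
    obtain ⟨e1, e2, e3, -⟩ := hmem τ hτ
    have hτ0 : 0 < |τ| := hδ0.trans_le e1
    refine (hkb τ (abs_pos.mp hτ0) e3).trans ?_
    have hl : |Real.log τ| ≤ |Real.log δ| := by
      rw [← Real.log_abs τ, abs_of_nonpos (Real.log_nonpos hτ0.le e2),
        abs_of_nonpos (Real.log_nonpos hδ0.le (e1.trans e2))]
      exact neg_le_neg (Real.log_le_log hδ0 e1)
    gcongr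
  refine (norm_setIntegral_le_of_norm_le_const (hvol.trans_lt ENNReal.ofReal_lt_top) hbd).trans ?_
  have hreal : volume.real (T \ S) ≤ 2 * (K * δ ^ 2) :=
    ENNReal.toReal_le_of_le_ofReal (by positivity) hvol
  calc _ ≤ B * (1 + |Real.log δ|) / δ * (2 * (K * δ ^ 2)) := by gcongr
    _ = _ := by field_simp

namespace SmoothDomain

variable (D : SmoothDomain)

lemma setIntegral_truncated {E : Type*} [NormedAddCommGroup E] [NormedSpace ℝ E] (i j : Fin D.num)
    (s δ : ℝ) {f : ℝ → E} (hf : Function.Periodic f (D.len j)) :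
    ∫ t in {t : ℝ | t ∈ Set.Ioc 0 (D.len j) ∧ δ < dist (D.curve i s) (D.curve j t)}, f t =
      ∫ τ in Set.Ioc (-(D.len j / 2)) (D.len j / 2) ∩
        {τ | δ < ‖D.curve i s - D.curve j (s + τ)‖}, f (s + τ) := by
  have hc : Continuous fun t => dist (D.curve i s) (D.curve j t) :=
    continuous_const.dist (D.smooth j).continuous
  have := setIntegral_periodic_shift (D.len_pos j) hf
    (A := {t | δ < dist (D.curve i s) (D.curve j t)})
    (measurableSet_lt measurable_const hc.measurable)
    (fun t => by simp only [Set.mem_ofPred_eq, D.periodic j t]) s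
  simp only [Set.mem_ofPred_eq, dist_eq_norm] at this ⊢
  exact this

/-- The derivative along the boundary of a layer potential with logarithmic kernel is the
principal value of the differentiated integral. -/
theorem hasDerivAt_layer {M : Plane → ℂ} (hM : LogKernel M) (i j : Fin D.num) {w : ℝ → ℂ}
    (hw : ContDiff ℝ 1 w) (hwp : Function.Periodic w (D.len j)) (s : ℝ) :
    ∃ v, HasDerivAt (fun s => ∫ t in (0 : ℝ)..(D.len j), w t * M (D.curve i s - D.curve j t)) v s ∧
      Tendsto (fun δ : ℝ =>
        ∫ t in {t : ℝ | t ∈ Set.Ioc 0 (D.len j) ∧ δ < dist (D.curve i s) (D.curve j t)},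
          w t * fderiv ℝ M (D.curve i s - D.curve j t) (deriv (D.curve i) s)) (𝓝[>] 0) (𝓝 v) := by
  have hp := D.curvePair i j
  have hL := half_pos (D.len_pos j)
  obtain ⟨v, hv, ht⟩ := hp.hasDerivAt_layer hM hw hwp s (D.tendsto_symmetric_difference hM i j s)
  refine ⟨v, hv, ?_⟩
  have hper : Function.Periodic
      (fun t => w t * fderiv ℝ M (D.curve i s - D.curve j t) (deriv (D.curve i) s)) (D.len j) :=
    fun t => by simp only [hwp t, D.periodic j t]
  have hDc : ∀ z ≠ 0, ContinuousAt (fderiv ℝ M) z := fun z hz =>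
    (contDiffAt_fderiv (hM.contDiffAt z hz)).continuousAt
  have hk : ContinuousOn
      (fun τ => w (s + τ) * fderiv ℝ M (D.curve i s - D.curve j (s + τ)) (deriv (D.curve i) s))
      {τ | τ ≠ 0 ∧ |τ| ≤ D.len j / 2} :=
    ((hw.continuous.comp (continuous_const.add continuous_id)).continuousOn).mul
      ((hp.continuousOn_kernel hDc s).clm_apply continuousOn_const)
  by_cases hij : i = j
  · subst hij
    obtain ⟨c, hc, hl⟩ := D.exists_chord_arc i
    obtain ⟨C, hC, hb⟩ := D.exists_norm_curve_sub_ge i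
    obtain ⟨W, hW, hwb⟩ := exists_bound_of_periodic hwp (D.len_pos i).ne' hw.continuous
    obtain ⟨R, hR⟩ := D.exists_norm_sub_le i i
    obtain ⟨K, hK, hMb⟩ := hM.bound R
    obtain ⟨K', hK', hlog⟩ := hp.log_bound
    have hc' := (D.smooth i).continuous
    have key := tendsto_punctured_sub_truncated (k := fun τ =>
        w (s + τ) * fderiv ℝ M (D.curve i s - D.curve i (s + τ)) (deriv (D.curve i) s))
      (r := fun τ => ‖D.curve i s - D.curve i (s + τ)‖) (B := W * (K * K' / c)) hL hc hC
      (by positivity) (by fun_prop)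
      (fun τ _ => by
        have := D.norm_curve_sub_le i s (s + τ)
        rwa [sub_add_cancel_left, abs_neg] at this)
      (hl s) (fun τ _ => hb s τ) hk (fun τ h0 h => by
        have hz := hp.sub_ne_zero' s h0 h
        have hτ := abs_pos.mpr h0
        have e1 := (hMb _ hz (hR _ _)).2
        have e2 := hlog s τ h0 h
        have e3 := hl s τ h
        have e4 : ‖fderiv ℝ M (D.curve i s - D.curve i (s + τ)) (deriv (D.curve i) s)‖ ≤
            K * (K' * (1 + |Real.log τ|)) / (c * |τ|) := by
          refine (ContinuousLinearMap.le_opNorm _ _).trans ?_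
          rw [D.unit_speed, mul_one]
          refine e1.trans ?_
          gcongr
        rw [norm_mul]
        refine (mul_le_mul (hwb _) e4 (norm_nonneg _) hW).trans_eq ?_
        field_simp)
    have t := ht.sub key
    rw [sub_zero] at t
    refine t.congr fun δ => ?_
    rw [D.setIntegral_truncated i i s δ hper]
    ring
  · obtain ⟨d, hd, hb⟩ := D.exists_le_norm_sub hij
    have hz : ∀ τ, D.curve i s - D.curve j (s + τ) ≠ 0 := fun τ =>
      norm_pos_iff.mp (hd.trans_le (hb _ _))
    have hy : Continuous fun τ => D.curve i s - D.curve j (s + τ) :=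
      continuous_const.sub ((D.smooth j).continuous.comp (continuous_const.add continuous_id))
    have hkc : Continuous (fun τ =>
        w (s + τ) * fderiv ℝ M (D.curve i s - D.curve j (s + τ)) (deriv (D.curve i) s)) := by
      refine (hw.continuous.comp (continuous_const.add continuous_id)).mul
        (Continuous.clm_apply ?_ continuous_const)
      exact continuous_iff_continuousAt.mpr fun τ =>
        ContinuousAt.comp (f := fun τ => D.curve i s - D.curve j (s + τ)) (hDc _ (hz τ))
          hy.continuousAt
    -- For disjoint components the integrand is continuous and the truncation removes nothing once δ
    -- is below their distance.
    have hv' := tendsto_nhds_unique ht (tendsto_punctured_integral hL (hkc.intervalIntegrable _ _))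
    refine tendsto_const_nhds.congr' ?_
    filter_upwards [Ioo_mem_nhdsGT hd] with δ hδ
    rw [D.setIntegral_truncated i j s δ hper, hv', intervalIntegral.integral_of_le (by linarith),
      Set.inter_eq_left.mpr]
    exact fun τ _ => hδ.2.trans_le (hb _ _)

end SmoothDomain

/-! ### Weak singularity of the regularized kernels -/

lemma one_add_abs_log_le_rpow (R : ℝ) :
    ∃ C, 0 ≤ C ∧ ∀ r, 0 < r → r ≤ R → 1 + |Real.log r| ≤ C * r ^ (-(1 / 2) : ℝ) := by
  obtain ⟨C, hC, h⟩ := one_add_abs_log_le (R := √R)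
  refine ⟨2 * C, by positivity, fun r hr hR => ?_⟩
  have hs : 0 < √r := Real.sqrt_pos.mpr hr
  have h1 := h (√r) hs (Real.sqrt_le_sqrt hR)
  have h2 : |Real.log r| = 2 * |Real.log √r| := by
    rw [Real.log_sqrt hr.le, abs_div, abs_two]; ring
  rw [Real.rpow_neg hr.le, ← Real.sqrt_eq_rpow, ← div_eq_mul_inv, le_div_iff₀ hs, h2]
  nlinarith

lemma continuousOn_dirDeriv {X : Type*} [TopologicalSpace X] {S : Set X} {g : Plane → ℂ}
    {n z : X → Plane} (hg : ∀ z ≠ 0, ContDiffAt ℝ ∞ g z) (hn : ContinuousOn n S)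
    (hz : ContinuousOn z S) (h0 : ∀ t ∈ S, z t ≠ 0) :
    ContinuousOn (fun t => dirDeriv (n t) g (z t)) S := by
  simp only [← fderiv_apply_eq_dirDeriv]
  refine ContinuousOn.clm_apply (fun t ht => ?_) hn
  exact ContinuousAt.comp_continuousWithinAt (f := z)
    (contDiffAt_fderiv (hg _ (h0 t ht))).continuousAt (hz t ht)

lemma continuousOn_coord {X : Type*} [TopologicalSpace X] {S : Set X} {n : X → Plane}
    (hn : ContinuousOn n S) (a : Fin 2) : ContinuousOn (fun t => ((n t a : ℝ) : ℂ)) S := by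
  have h1 : Continuous fun v : Plane => ((v a : ℝ) : ℂ) := by fun_prop
  exact h1.comp_continuousOn hn

namespace Params

variable {P : Params}

/-- Apart from the term with ∂_{ν_x}γ_{k_s}, every summand is a ν_y-derivative of a combination of
the three waves, multiplied by ν_x. In this form only normal derivatives of radial functions occur,
and no relation between the coefficients is needed to bound them. -/
lemma exists_kernelN21_eq {k₁ k₂ : ℂ} (hw : P.IsWavePair k₁ k₂) :
    ∃ c : Fin 3 → ℂ, ∀ x y : Plane, x ≠ y → ∀ (nx ny : Plane) (a : Fin 2),
      P.kernelN21 k₁ k₂ x nx y ny a = dirDeriv ny (comb c (P.waves k₁ k₂)) (x - y) * (nx a : ℂ)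
        - P.beta * (dirDeriv nx (hk P.ks) (x - y) * (ny a : ℂ)) := by
  set e := (k₂ ^ 2 - P.q) / (k₁ ^ 2 - k₂ ^ 2) with he
  set g := Complex.I * (P.omega : ℂ) * P.gam /
      (((P.lam + 2 * P.mu : ℝ) : ℂ) * (k₁ ^ 2 - k₂ ^ 2)) with hg
  set m := Complex.I * P.beta * P.gam / ((P.rhoF : ℂ) * (P.omega : ℂ) * (k₁ ^ 2 - k₂ ^ 2)) with hm
  set l := (P.alpha : ℂ) / (k₁ ^ 2 - k₂ ^ 2) with hl
  refine ⟨![P.beta, P.beta * (-1 - e) + P.beta * P.alpha * g - m * k₁ ^ 2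
      - l * (P.kp ^ 2 - k₁ ^ 2), P.beta * e - P.beta * P.alpha * g + m * k₂ ^ 2
      + l * (P.kp ^ 2 - k₂ ^ 2)], fun x y hxy nx ny a => ?_⟩
  have hz : x - y ≠ 0 := sub_ne_zero.mpr hxy
  have h0 := waves_ne_zero hw
  have e12 : ∀ j, P.E12 k₁ k₂ x y j = g * (pd j (hk k₁) (x - y) - pd j (hk k₂) (x - y)) := by
    intro j
    have := pd_comb ![0, 1, -1] h0 hz j
    simp only [waves, Matrix.cons_val_zero, Matrix.cons_val_one, Matrix.cons_val] at this
    simp only [E12, Pi.smul_apply, smul_eq_mul, grad_theta_eq (P := P), thetaZ, waves, ← hg, this]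
    ring
  have e22 : ∀ j, pd j (fun y' =>
        (P.kp ^ 2 - k₁ ^ 2) * helmholtz k₁ x y' - (P.kp ^ 2 - k₂ ^ 2) * helmholtz k₂ x y') y =
      -((P.kp ^ 2 - k₁ ^ 2) * pd j (hk k₁) (x - y) - (P.kp ^ 2 - k₂ ^ 2) * pd j (hk k₂) (x - y)) := by
    intro j
    have := pd_comb ![0, P.kp ^ 2 - k₁ ^ 2, -(P.kp ^ 2 - k₂ ^ 2)] h0 hz j
    have h2 := pd_comp_const_sub (comb ![0, P.kp ^ 2 - k₁ ^ 2, -(P.kp ^ 2 - k₂ ^ 2)]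
      (P.waves k₁ k₂)) x y j
    rw [this] at h2
    simp only [comb, waves, Matrix.cons_val_zero, Matrix.cons_val_one, Matrix.cons_val] at h2
    refine Eq.trans ?_ (h2.trans (by ring))
    congr 1
    ext y'
    simp only [helmholtz_eq]
    ring
  rw [kernelN21_eq hw hxy]
  simp only [dirDeriv, e12, e22, pd_comb _ h0 hz, Fin.sum_univ_two, cvec, ← he, ← hm, ← hl]
  simp only [waves, Matrix.cons_val_zero, Matrix.cons_val_one, Matrix.cons_val]
  ring

lemma tendsto_pd_thetaZ {k₁ k₂ : ℂ} (hw : P.IsWavePair k₁ k₂) (a : Fin 2) :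
    Tendsto (pd a (P.thetaZ k₁ k₂)) (𝓝[≠] 0) (𝓝 0) := by
  obtain ⟨C, hC, h⟩ := norm_pd_radial_le (comb_eq_profile ![0, 1, -1] (waves_ne_zero hw))
    (isLogProfile_comb_zero (k := P.waves k₁ k₂) (by simp)) 1
  have t := (tendsto_mul_one_add_abs_log.comp (tendsto_norm_nhdsNE_zero (E := Plane))).const_mul C
  rw [mul_zero] at t
  refine squeeze_zero_norm' ?_ t
  filter_upwards [self_mem_nhdsWithin, nhdsWithin_le_nhds (Metric.ball_mem_nhds (0 : Plane) one_pos)]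
    with z hz hz1
  exact h z hz (mem_ball_zero_iff.mp hz1).le a

lemma norm_pd_thetaZ_le {k₁ k₂ : ℂ} (hw : P.IsWavePair k₁ k₂) (R : ℝ) :
    ∃ C, 0 ≤ C ∧ ∀ z : Plane, z ≠ 0 → ‖z‖ ≤ R → ∀ a, ‖pd a (P.thetaZ k₁ k₂) z‖ ≤ C := by
  obtain ⟨C, hC, h⟩ := norm_pd_radial_le (comb_eq_profile ![0, 1, -1] (waves_ne_zero hw))
    (isLogProfile_comb_zero (k := P.waves k₁ k₂) (by simp)) R
  obtain ⟨c, hc, h'⟩ := one_add_abs_log_le (R := R)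
  exact ⟨C * c, by positivity, fun z hz hR a => (h z hz hR a).trans
    (mul_le_mul_of_nonneg_left (h' _ (norm_pos_iff.mpr hz) hR) hC)⟩

end Params

namespace SmoothDomain

variable (D : SmoothDomain)

lemma continuous_normal (j : Fin D.num) : Continuous (D.normal j) := by
  have h := (D.contDiff_deriv_curve j).continuous
  unfold normal
  refine (PiLp.continuous_toLp 2 _).comp (continuous_pi fun i => ?_)
  fin_cases i <;> simp <;> fun_prop

variable {D}

lemma weaklySingular_of {K : Plane → Plane → Plane → Plane → Fin 2 → ℂ} {θ : ℝ} (h0 : 0 ≤ θ)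
    (h1 : θ < 1)
    (hc : ∀ i j a, ContinuousOn (fun z : ℝ × ℝ =>
      K (D.curve i z.1) (D.normal i z.1) (D.curve j z.2) (D.normal j z.2) a)
      {z : ℝ × ℝ | D.curve i z.1 ≠ D.curve j z.2})
    (hb : ∀ i j a, ∃ C, ∀ s t, D.curve i s ≠ D.curve j t →
      ‖K (D.curve i s) (D.normal i s) (D.curve j t) (D.normal j t) a‖ ≤
        C * dist (D.curve i s) (D.curve j t) ^ (-θ)) : D.WeaklySingular K := by
  refine ⟨fun i j => continuousOn_pi.mpr (hc i j), ?_⟩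
  choose C hC using hb
  obtain ⟨B, hB⟩ := Finite.exists_le fun q : Fin D.num × Fin D.num × Fin 2 => C q.1 q.2.1 q.2.2
  refine ⟨B, θ, h0, h1, fun i j s t hne => (pi_norm_le_iff_of_nonempty _).mpr fun a =>
    (hC i j a s t hne).trans ?_⟩
  gcongr
  exact hB (i, j, a)

lemma continuousOn_curve_fst (i j : Fin D.num) : ContinuousOn (fun z : ℝ × ℝ =>
    D.curve i z.1 - D.curve j z.2) {z : ℝ × ℝ | D.curve i z.1 ≠ D.curve j z.2} :=
  (((D.smooth i).continuous.comp continuous_fst).sub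
    ((D.smooth j).continuous.comp continuous_snd)).continuousOn

variable {P : Params} {k₁ k₂ : ℂ}

/-- The normal derivatives are O(|⟨n, z⟩| / |z|²), and chords of a smooth boundary satisfy ⟨n, z⟩ =
O(|z|²). -/
lemma norm_kernelN21_le (hw : P.IsWavePair k₁ k₂) (i j : Fin D.num) (a : Fin 2) :
    ∃ C, ∀ s t, D.curve i s ≠ D.curve j t →
      ‖P.kernelN21 k₁ k₂ (D.curve i s) (D.normal i s) (D.curve j t) (D.normal j t) a‖ ≤ C := by
  obtain ⟨c, hc⟩ := Params.exists_kernelN21_eq hw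
  have h0 := Params.waves_ne_zero hw
  obtain ⟨R, hR⟩ := D.exists_norm_sub_le i j
  obtain ⟨A, hA, hn⟩ := D.exists_inner_normal_le i j
  obtain ⟨C, hC, h1⟩ := norm_dirDeriv_radial_le (comb_eq_profile c h0)
    (isLogProfile_comb c (P.waves k₁ k₂)) R
  obtain ⟨C', hC', h2⟩ := norm_dirDeriv_radial_le (hk_eq_profile P.ks_ne_zero)
    (isLogProfile_profile P.ks) R
  refine ⟨C * A + ‖P.beta‖ * (C' * A), fun s t hne => ?_⟩
  have hz := sub_ne_zero.mpr hne
  have hz2 := normSq_pos hz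
  have u : ∀ (l : Fin D.num) (r : ℝ), ‖((D.normal l r a : ℝ) : ℂ)‖ ≤ 1 := fun l r =>
    (norm_apply_le_norm _ _).trans (D.norm_normal l r).le
  have b : ∀ {B v : ℝ} (n : Plane), 0 ≤ B →
      v ≤ B * |inner ℝ n (D.curve i s - D.curve j t)| / ‖D.curve i s - D.curve j t‖ ^ 2 →
      |inner ℝ n (D.curve i s - D.curve j t)| ≤ A * ‖D.curve i s - D.curve j t‖ ^ 2 →
      v ≤ B * A := fun {B v} n hB hv hi => by
    refine hv.trans ?_
    rw [div_le_iff₀ hz2, mul_assoc]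
    gcongr
  have b1 := b (D.normal j t) hC (h1 _ hz (hR s t) _) (hn s t).2
  have b2 := b (D.normal i s) hC' (h2 _ hz (hR s t) _) (hn s t).1
  rw [hc _ _ hne]
  refine (norm_sub_le _ _).trans ?_
  rw [norm_mul, norm_mul, norm_mul]
  refine add_le_add ?_ (mul_le_mul_of_nonneg_left ?_ (norm_nonneg _))
  · exact (mul_le_of_le_one_right (norm_nonneg _) (u i s)).trans b1
  · exact (mul_le_of_le_one_right (norm_nonneg _) (u j t)).trans b2

theorem weaklySingular_kernelN21 (hw : P.IsWavePair k₁ k₂) :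
    D.WeaklySingular (P.kernelN21 k₁ k₂) := by
  obtain ⟨c, hc⟩ := Params.exists_kernelN21_eq hw
  have h0 := Params.waves_ne_zero hw
  refine weaklySingular_of le_rfl one_pos (fun i j a => ?_) fun i j a => ?_
  · have hn1 : ContinuousOn (fun z : ℝ × ℝ => D.normal i z.1)
        {z : ℝ × ℝ | D.curve i z.1 ≠ D.curve j z.2} :=
      ((D.continuous_normal i).comp continuous_fst).continuousOn
    have hn2 : ContinuousOn (fun z : ℝ × ℝ => D.normal j z.2)
        {z : ℝ × ℝ | D.curve i z.1 ≠ D.curve j z.2} :=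
      ((D.continuous_normal j).comp continuous_snd).continuousOn
    have hz := continuousOn_curve_fst (D := D) i j
    refine ContinuousOn.congr ?_ fun z hz => hc _ _ hz _ _ a
    refine ((continuousOn_dirDeriv (fun z => contDiffAt_comb c h0) hn2 hz ?_).mul
      (continuousOn_coord hn1 a)).sub (continuousOn_const.mul
      ((continuousOn_dirDeriv (fun z => contDiffAt_hk P.ks_ne_zero) hn1 hz ?_).mul
        (continuousOn_coord hn2 a))) <;>
    exact fun z hz => sub_ne_zero.mpr hz
  · obtain ⟨C, h⟩ := norm_kernelN21_le (D := D) hw i j a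
    refine ⟨C, fun s t hne => ?_⟩
    rw [neg_zero, Real.rpow_zero, mul_one]
    exact h s t hne

theorem weaklySingular_kernelN22 (hw : P.IsWavePair k₁ k₂) :
    D.WeaklySingular (P.kernelN22 k₁ k₂) := by
  refine weaklySingular_of le_rfl one_pos (fun i j a => ?_) fun i j a => ?_
  · simp only [Params.kernelN22_eq]
    refine continuousOn_const.mul fun z hz => ?_
    exact ContinuousAt.comp_continuousWithinAt (f := fun z : ℝ × ℝ => D.curve i z.1 - D.curve j z.2)
      (contDiffAt_pd (Params.contDiffAt_thetaZ hw _ (sub_ne_zero.mpr hz)) a).continuousAt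
      (continuousOn_curve_fst i j z hz)
  · obtain ⟨R, hR⟩ := D.exists_norm_sub_le i j
    obtain ⟨C, hC, h1⟩ := Params.norm_pd_thetaZ_le hw R
    refine ⟨‖-P.constN2 k₁ k₂‖ * C, fun s t hne => ?_⟩
    rw [neg_zero, Real.rpow_zero, mul_one, Params.kernelN22_eq, norm_mul]
    exact mul_le_mul_of_nonneg_left (h1 _ (sub_ne_zero.mpr hne) (hR s t) a) (norm_nonneg _)

theorem weaklySingular_kernelN23 (hw : P.IsWavePair k₁ k₂) (hne : k₁ ^ 2 ≠ k₂ ^ 2) :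
    D.WeaklySingular (P.kernelN23 k₁ k₂) := by
  -- Any exponent in (0, 1) would dominate the logarithm; 1/2 comes from applying the bound for r
  -- log r to √r.
  refine weaklySingular_of (θ := 1 / 2) (by norm_num) (by norm_num) (fun i j a => ?_) fun i j a => ?_
  · simp only [Params.kernelN23_eq]
    refine continuousOn_finsetSum _ fun b _ => ContinuousOn.mul ?_ fun z hz => ?_
    · exact continuousOn_coord ((D.continuous_normal j).comp continuous_snd).continuousOn b
    · exact ContinuousAt.comp_continuousWithinAt
        (f := fun z : ℝ × ℝ => D.curve i z.1 - D.curve j z.2)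
        ((Params.logKernel_N23Z hw hne a b).contDiffAt _ (sub_ne_zero.mpr hz)).continuousAt
        (continuousOn_curve_fst i j z hz)
  · obtain ⟨R, hR⟩ := D.exists_norm_sub_le i j
    obtain ⟨B, hB, hl⟩ := one_add_abs_log_le_rpow R
    choose C hC h using fun b => (Params.logKernel_N23Z hw hne a b).bound R
    refine ⟨∑ b, C b * B, fun s t hst => ?_⟩
    have hz := sub_ne_zero.mpr hst
    rw [Params.kernelN23_eq, Finset.sum_mul, dist_eq_norm]
    refine norm_sum_le_of_le _ fun b _ => ?_
    rw [norm_mul, mul_assoc]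
    refine (mul_le_of_le_one_left (norm_nonneg _)
      ((norm_apply_le_norm _ _).trans (D.norm_normal j t).le)).trans
      ((h b _ hz (hR s t)).1.trans ?_)
    exact mul_le_mul_of_nonneg_left (hl _ (norm_pos_iff.mpr hz) (hR s t)) (hC b)

/-! ### Truncated integrals of bounded kernels -/

lemma countable_curve_eq (i j : Fin D.num) (s : ℝ) :
    {t : ℝ | D.curve i s = D.curve j t}.Countable := by
  by_cases hij : i = j
  · subst hij
    refine (Set.countable_range fun n : ℤ => s - n • D.len i).mono fun t ht => ?_
    obtain ⟨n, hn⟩ := D.eq_of_curve_eq i ht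
    exact ⟨n, by simp only [← hn]; ring⟩
  · convert Set.countable_empty
    refine Set.eq_empty_iff_forall_notMem.mpr fun t ht => ?_
    exact Set.disjoint_left.mp (D.disjoint i j hij) ⟨s, rfl⟩ ⟨t, ht.symm⟩

lemma ae_curve_ne (i j : Fin D.num) (s : ℝ) : ∀ᵐ t : ℝ, D.curve i s ≠ D.curve j t := by
  have := (countable_curve_eq i j s).measure_zero volume
  simpa [ae_iff] using this

lemma isOpen_curve_ne (i j : Fin D.num) (s : ℝ) : IsOpen {t : ℝ | D.curve i s ≠ D.curve j t} :=
  isOpen_ne_fun continuous_const (D.smooth j).continuous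

lemma aestronglyMeasurable_of_continuousOn {E : Type*} [NormedAddCommGroup E] {f : ℝ → E}
    {i j : Fin D.num} {s : ℝ} (hf : ContinuousOn f {t : ℝ | D.curve i s ≠ D.curve j t}) :
    AEStronglyMeasurable f volume := by
  have := hf.aestronglyMeasurable (isOpen_curve_ne i j s).measurableSet (μ := volume)
  rwa [Measure.restrict_congr_set (eventuallyEq_univ.mpr (ae_curve_ne i j s)),
    Measure.restrict_univ] at this

lemma intervalIntegrable_of_bounded {E : Type*} [NormedAddCommGroup E] {f : ℝ → E}
    {i j : Fin D.num} {s C : ℝ} (hf : ContinuousOn f {t : ℝ | D.curve i s ≠ D.curve j t})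
    (hb : ∀ t, D.curve i s ≠ D.curve j t → ‖f t‖ ≤ C) (a b : ℝ) :
    IntervalIntegrable f volume a b := by
  refine (intervalIntegrable_const (c := C)).mono_fun'
    (aestronglyMeasurable_of_continuousOn hf).restrict (ae_restrict_of_ae ?_)
  filter_upwards [ae_curve_ne i j s] with t ht using hb t ht

lemma measurableSet_truncated (i j : Fin D.num) (s δ : ℝ) :
    MeasurableSet {t : ℝ | t ∈ Set.Ioc 0 (D.len j) ∧ δ < dist (D.curve i s) (D.curve j t)} := by
  have hc : Continuous fun t => dist (D.curve i s) (D.curve j t) :=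
    continuous_const.dist (D.smooth j).continuous
  exact measurableSet_Ioc.inter (measurableSet_lt measurable_const hc.measurable)

lemma integrableOn_truncated {E : Type*} [NormedAddCommGroup E] {f : ℝ → E} {i j : Fin D.num}
    {s δ : ℝ} (hδ : 0 < δ) (hf : ContinuousOn f {t : ℝ | D.curve i s ≠ D.curve j t}) :
    IntegrableOn f
      {t : ℝ | t ∈ Set.Ioc 0 (D.len j) ∧ δ < dist (D.curve i s) (D.curve j t)} := by
  have hc : Continuous fun t => dist (D.curve i s) (D.curve j t) :=
    continuous_const.dist (D.smooth j).continuous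
  have hK : IsCompact (Set.Icc 0 (D.len j) ∩ {t | δ ≤ dist (D.curve i s) (D.curve j t)}) :=
    isCompact_Icc.inter_right (isClosed_le continuous_const hc)
  refine ((hf.mono fun t ht => ?_).integrableOn_compact hK).mono_set fun t ht =>
    ⟨Set.Ioc_subset_Icc_self ht.1, ht.2.le⟩
  exact dist_pos.mp (hδ.trans_le ht.2)

lemma tendsto_truncated {E : Type*} [NormedAddCommGroup E] [NormedSpace ℝ E] {f : ℝ → E}
    {i j : Fin D.num} {s C : ℝ} (hf : ContinuousOn f {t : ℝ | D.curve i s ≠ D.curve j t})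
    (hb : ∀ t, D.curve i s ≠ D.curve j t → ‖f t‖ ≤ C) :
    Tendsto (fun δ : ℝ =>
      ∫ t in {t : ℝ | t ∈ Set.Ioc 0 (D.len j) ∧ δ < dist (D.curve i s) (D.curve j t)}, f t)
      (𝓝[>] 0) (𝓝 (∫ t in (0 : ℝ)..(D.len j), f t)) := by
  have hc : Continuous fun t => dist (D.curve i s) (D.curve j t) :=
    continuous_const.dist (D.smooth j).continuous
  have hm : ∀ δ, MeasurableSet {t | δ < dist (D.curve i s) (D.curve j t)} := fun δ =>
    measurableSet_lt measurable_const hc.measurable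
  have hfm := aestronglyMeasurable_of_continuousOn hf
  have e : ∀ δ : ℝ,
      ∫ t in {t : ℝ | t ∈ Set.Ioc 0 (D.len j) ∧ δ < dist (D.curve i s) (D.curve j t)}, f t =
        ∫ t in Set.Ioc 0 (D.len j),
          {t | δ < dist (D.curve i s) (D.curve j t)}.indicator f t := fun δ =>
    (setIntegral_indicator (hm δ)).symm
  simp only [e]
  rw [intervalIntegral.integral_of_le (D.len_pos j).le]
  refine tendsto_integral_filter_of_dominated_convergence (fun _ => C)
    (Eventually.of_forall fun δ => hfm.restrict.indicator (hm δ)) ?_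
    (integrable_const C) ?_
  · refine Eventually.of_forall fun δ => ae_restrict_of_ae ?_
    filter_upwards [ae_curve_ne i j s] with t ht
    exact (norm_indicator_le_norm_self _ _).trans (hb t ht)
  · refine ae_restrict_of_ae ?_
    filter_upwards [ae_curve_ne i j s] with t ht
    refine tendsto_const_nhds.congr' ?_
    filter_upwards [Ioo_mem_nhdsGT (dist_pos.mpr ht)] with δ hδ
    exact (Set.indicator_of_mem (s := {t | δ < dist (D.curve i s) (D.curve j t)}) hδ.2 f).symm

end SmoothDomain

/-! ### Integration by parts and assembly of the regularized operator -/

lemma eval_intervalIntegral {f : ℝ → Fin 2 → ℂ} {b : ℝ} (hb : 0 ≤ b)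
    (hf : ∀ a, IntervalIntegrable (fun t => f t a) volume 0 b) (a : Fin 2) :
    (∫ t in (0 : ℝ)..b, f t) a = ∫ t in (0 : ℝ)..b, f t a := by
  rw [intervalIntegral.integral_of_le hb, intervalIntegral.integral_of_le hb]
  exact eval_integral (fun a => (intervalIntegrable_iff_integrableOn_Ioc_of_le hb).mp (hf a)) a

namespace SmoothDomain

variable {D : SmoothDomain}

lemma IsC1.contDiff_mul {p : D.BdryFun ℂ} (hp : D.IsC1 p) (j : Fin D.num) {n : ℝ → Plane}
    (hn : ContDiff ℝ 1 n) (b : Fin 2) : ContDiff ℝ 1 fun t => ((n t b : ℝ) : ℂ) * p j t := by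
  have h1 : ContDiff ℝ 1 fun t => (n t b : ℝ) := contDiff_euclidean.mp hn b
  exact (Complex.ofRealCLM.contDiff.comp h1).mul (hp j).1

lemma contDiff_normal (j : Fin D.num) : ContDiff ℝ 1 (D.normal j) := by
  have h := (contDiff_euclidean.mp (D.contDiff_deriv_curve j))
  refine contDiff_euclidean.mpr fun i => ?_
  have h0 : ContDiff ℝ 1 fun t => deriv (D.curve j) t 0 := (h 0).of_le (by simp)
  have h1 : ContDiff ℝ 1 fun t => deriv (D.curve j) t 1 := (h 1).of_le (by simp)
  fin_cases i
  · simpa [normal] using h1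
  · simpa [normal] using h0.neg

lemma intervalIntegrable_layer {M : Plane → ℂ} (hM : LogKernel M) (i j : Fin D.num) {w : ℝ → ℂ}
    (hw : Continuous w) (hwp : Function.Periodic w (D.len j)) (s a b : ℝ) :
    IntervalIntegrable (fun t => w t * M (D.curve i s - D.curve j t)) volume a b := by
  have h := ((D.curvePair i j).intervalIntegrable_kernel hM hw hwp s).comp_add_right (-s)
  simp only [add_neg_cancel_comm_assoc, sub_neg_eq_add] at h
  refine Function.Periodic.intervalIntegrable (T := D.len j)
    (fun t => by simp only [hwp t, D.periodic j t]) (D.len_pos j).ne' (t := -(D.len j / 2) + s) ?_ a b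
  convert h using 1
  ring

/-- Integration by parts on the boundary, for a kernel that vanishes on the diagonal and whose
gradient has a logarithmic singularity there. -/
lemma integral_deriv_mul {g : Plane → ℂ} (hg : ∀ z ≠ 0, ContDiffAt ℝ ∞ g z)
    (h0 : Tendsto g (𝓝[≠] 0) (𝓝 0)) (hM : ∀ b, LogKernel (pd b g)) (i j : Fin D.num)
    {p : D.BdryFun ℂ} (hp : D.IsC1 p) (s : ℝ) :
    ∫ t in (0 : ℝ)..(D.len j), deriv (p j) t * g (D.curve i s - D.curve j t) =
      ∑ b, ∫ t in (0 : ℝ)..(D.len j),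
        ((deriv (D.curve j) t b : ℝ) : ℂ) * p j t * pd b g (D.curve i s - D.curve j t) := by
  obtain ⟨hp1, hpp⟩ := hp j
  -- The value of g at the origin is arbitrary. With its limit 0 put there, p · G(x − y) is
  -- continuous on the whole period and differentiable off the countable set where y meets x, which
  -- is enough for the fundamental theorem of calculus.
  set G := Function.update g 0 0 with hG
  have hGe : ∀ z ≠ 0, G z = g z := fun z hz => Function.update_of_ne hz _ _
  have hGev : ∀ z ≠ 0, G =ᶠ[𝓝 z] g := fun z hz => by
    filter_upwards [isOpen_ne.mem_nhds hz] with w hw using hGe w hw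
  have hGc : Continuous G := by
    refine continuous_iff_continuousAt.mpr fun z => ?_
    by_cases hz : z = 0
    · rw [hz]; exact continuousAt_update_same.mpr h0
    · exact (hg z hz).continuousAt.congr (hGev z hz).symm
  have hzc : Continuous fun t => D.curve i s - D.curve j t :=
    continuous_const.sub (D.smooth j).continuous
  set w : Fin 2 → ℝ → ℂ := fun b t => ((deriv (D.curve j) t b : ℝ) : ℂ) * p j t with hw
  have hwc : ∀ b, Continuous (w b) := fun b =>
    (hp.contDiff_mul j ((D.contDiff_deriv_curve j).of_le (by simp)) b).continuous
  have hwp : ∀ b, Function.Periodic (w b) (D.len j) := fun b t => by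
    simp only [hw, hpp t, periodic_deriv (D.periodic j) t]
  have hI : ∀ b, IntervalIntegrable (fun t => w b t * pd b g (D.curve i s - D.curve j t))
      volume 0 (D.len j) := fun b => intervalIntegrable_layer (hM b) i j (hwc b) (hwp b) s _ _
  have hI0 : IntervalIntegrable (fun t => deriv (p j) t * G (D.curve i s - D.curve j t))
      volume 0 (D.len j) :=
    ((hp1.continuous_deriv le_rfl).mul (hGc.comp hzc)).intervalIntegrable _ _
  have hIs : IntervalIntegrable (fun t => ∑ b, w b t * pd b g (D.curve i s - D.curve j t))
      volume 0 (D.len j) := by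
    simp only [Fin.sum_univ_two]
    exact (hI 0).add (hI 1)
  have key := integral_eq_of_hasDerivAt_off_countable
    (fun t => p j t * G (D.curve i s - D.curve j t))
    (fun t => deriv (p j) t * G (D.curve i s - D.curve j t) -
      ∑ b, w b t * pd b g (D.curve i s - D.curve j t))
    (a := 0) (b := D.len j) (countable_curve_eq i j s)
    (hp1.continuous.mul (hGc.comp hzc)).continuousOn (fun t ht => by
      have hz : D.curve i s - D.curve j t ≠ 0 := sub_ne_zero.mpr ht.2
      have e1 : HasDerivAt (p j) (deriv (p j) t) t := (hp1.differentiable (by simp) t).hasDerivAt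
      have e2 : HasDerivAt (fun t => D.curve i s - D.curve j t) (-deriv (D.curve j) t) t :=
        (D.hasDerivAt_curve j t).const_sub _
      have e3 : HasFDerivAt G (fderiv ℝ g (D.curve i s - D.curve j t))
          (D.curve i s - D.curve j t) :=
        ((hg _ hz).differentiableAt (by simp)).hasFDerivAt.congr_of_eventuallyEq (hGev _ hz)
      refine (e1.mul (e3.comp_hasDerivAt t e2)).congr_deriv ?_
      rw [map_neg, fderiv_apply_eq_dirDeriv]
      simp only [dirDeriv, hw, Fin.sum_univ_two, Function.comp]
      ring) (hI0.sub hIs)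
  have hper : p j (D.len j) * G (D.curve i s - D.curve j (D.len j)) =
      p j 0 * G (D.curve i s - D.curve j 0) := by
    have e1 := hpp 0
    have e2 := D.periodic j 0
    rw [zero_add] at e1 e2
    rw [e1, e2]
  rw [hper, sub_self, intervalIntegral.integral_sub hI0 hIs, sub_eq_zero,
    intervalIntegral.integral_finsetSum fun b _ => hI b] at key
  rw [← key]
  refine intervalIntegral.integral_congr_ae ?_
  filter_upwards [ae_curve_ne i j s] with t ht _
  rw [hGe _ (sub_ne_zero.mpr ht)]

lemma continuousOn_right {K : Plane → Plane → Plane → Plane → Fin 2 → ℂ}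
    (hK : D.WeaklySingular K) {p : D.BdryFun ℂ} (hp : D.IsC1 p) (i j : Fin D.num) (s : ℝ) :
    ContinuousOn (fun t => p j t • K (D.curve i s) (D.normal i s) (D.curve j t) (D.normal j t))
      {t : ℝ | D.curve i s ≠ D.curve j t} := by
  have h1 : Continuous fun t : ℝ => (s, t) := by fun_prop
  exact (hp j).1.continuous.continuousOn.smul
    ((hK.1 i j).comp (f := fun t : ℝ => (s, t)) h1.continuousOn fun t ht => ht)

variable {P : Params} {k₁ k₂ : ℂ}

/-- The density dp/ds is only continuous, so the differentiation theorem for potentials does not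
apply to it. Moving the derivative onto ∂_aθ produces logarithmic kernels ∂_b∂_aθ with the C¹
densities p τ_b. -/
lemma N22_tderiv_apply (hw : P.IsWavePair k₁ k₂) {p : D.BdryFun ℂ} (hp : D.IsC1 p)
    (i : Fin D.num) (s : ℝ) (a : Fin 2) :
    N22 P k₁ k₂ D (D.tderiv p) i s a = ∑ j, ∑ b, ∫ t in (0 : ℝ)..(D.len j),
      ((deriv (D.curve j) t b : ℝ) : ℂ) * p j t *
        (-P.constN2 k₁ k₂ * pd b (pd a (P.thetaZ k₁ k₂)) (D.curve i s - D.curve j t)) := by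
  simp only [N22, intOp, Finset.sum_apply]
  refine Finset.sum_congr rfl fun j _ => ?_
  obtain ⟨R, hR⟩ := D.exists_norm_sub_le i j
  obtain ⟨C, hC, hb⟩ := Params.norm_pd_thetaZ_le hw R
  have hp' : Continuous (deriv (p j)) := (hp j).1.continuous_deriv le_rfl
  obtain ⟨B, hB, hpb⟩ := exists_bound_of_periodic (periodic_deriv (hp j).2) (D.len_pos j).ne' hp'
  have e : ∀ a t, (D.tderiv p j t • P.kernelN22 k₁ k₂ (D.curve i s) (D.normal i s) (D.curve j t)
      (D.normal j t)) a = -P.constN2 k₁ k₂ *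
        (deriv (p j) t * pd a (P.thetaZ k₁ k₂) (D.curve i s - D.curve j t)) := fun a t => by
    simp only [Pi.smul_apply, smul_eq_mul, Params.kernelN22_eq, tderiv]
    ring
  rw [eval_intervalIntegral (D.len_pos j).le]
  · simp only [e]
    rw [intervalIntegral.integral_const_mul,
      integral_deriv_mul (fun z hz => contDiffAt_pd (Params.contDiffAt_thetaZ hw z hz) a)
        (Params.tendsto_pd_thetaZ hw a) (fun b => Params.logKernel_pd_pd_thetaZ hw b a) i j hp,
      Finset.mul_sum]
    refine Finset.sum_congr rfl fun b _ => ?_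
    rw [← intervalIntegral.integral_const_mul]
    congr 1
    ext t
    ring
  · intro a
    simp only [e]
    refine IntervalIntegrable.const_mul (intervalIntegrable_of_bounded (i := i) (j := j) (s := s)
      (C := B * C) (hp'.continuousOn.mul fun t ht => ?_) (fun t ht => ?_) _ _) _
    · have hz : Continuous fun t => D.curve i s - D.curve j t :=
        continuous_const.sub (D.smooth j).continuous
      exact ContinuousAt.comp_continuousWithinAt (f := fun t => D.curve i s - D.curve j t)
        (contDiffAt_pd (Params.contDiffAt_thetaZ hw _ (sub_ne_zero.mpr ht)) a).continuousAt
        hz.continuousWithinAt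
    · rw [Pi.mul_apply, norm_mul]
      exact mul_le_mul (hpb t) (hb _ (sub_ne_zero.mpr ht) (hR s t) a) (norm_nonneg _) hB

lemma N23_apply (hw : P.IsWavePair k₁ k₂) (hne : k₁ ^ 2 ≠ k₂ ^ 2) {p : D.BdryFun ℂ}
    (hp : D.IsC1 p) (i : Fin D.num) (s : ℝ) (a : Fin 2) :
    N23 P k₁ k₂ D p i s a = ∑ j, ∑ b, ∫ t in (0 : ℝ)..(D.len j),
      ((D.normal j t b : ℝ) : ℂ) * p j t *
        P.N23Z k₁ k₂ a b (D.curve i s - D.curve j t) := by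
  simp only [N23, intOp, Finset.sum_apply]
  refine Finset.sum_congr rfl fun j _ => ?_
  have hI : ∀ a b, IntervalIntegrable (fun t => ((D.normal j t b : ℝ) : ℂ) * p j t *
      P.N23Z k₁ k₂ a b (D.curve i s - D.curve j t)) volume 0 (D.len j) := fun a b =>
    intervalIntegrable_layer (Params.logKernel_N23Z hw hne a b) i j
      (hp.contDiff_mul j (D.contDiff_normal j) b).continuous
      (fun t => by simp only [D.normal_periodic j t, (hp j).2 t]) s _ _
  have e : ∀ a t, (p j t • P.kernelN23 k₁ k₂ (D.curve i s) (D.normal i s) (D.curve j t)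
      (D.normal j t)) a = ∑ b, ((D.normal j t b : ℝ) : ℂ) * p j t *
        P.N23Z k₁ k₂ a b (D.curve i s - D.curve j t) := fun a t => by
    simp only [Pi.smul_apply, smul_eq_mul, Params.kernelN23_eq, Fin.sum_univ_two]
    ring
  rw [eval_intervalIntegral (D.len_pos j).le]
  · simp only [e]
    exact intervalIntegral.integral_finsetSum fun b _ => hI a b
  · intro a
    simp only [e, Fin.sum_univ_two]
    exact (hI a 0).add (hI a 1)

lemma continuousOn_layer_deriv {M : Plane → ℂ} (hM : LogKernel M) (i j : Fin D.num) {w : ℝ → ℂ}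
    (hw : Continuous w) (s : ℝ) : ContinuousOn (fun t => w t *
      dirDeriv (deriv (D.curve i) s) M (D.curve i s - D.curve j t))
      {t : ℝ | D.curve i s ≠ D.curve j t} :=
  hw.continuousOn.mul (continuousOn_dirDeriv hM.contDiffAt continuousOn_const
    (continuous_const.sub (D.smooth j).continuous).continuousOn fun _ ht => sub_ne_zero.mpr ht)

lemma hasDerivAt_layer_sum {M : Fin 2 → Plane → ℂ} (hM : ∀ b, LogKernel (M b))
    {w : Fin D.num → Fin 2 → ℝ → ℂ} (hw : ∀ j b, ContDiff ℝ 1 (w j b))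
    (hwp : ∀ j b, Function.Periodic (w j b) (D.len j)) (i : Fin D.num) (s : ℝ) :
    ∃ v, HasDerivAt (fun s => ∑ j, ∑ b, ∫ t in (0 : ℝ)..(D.len j),
        w j b t * M b (D.curve i s - D.curve j t)) v s ∧
      Tendsto (fun δ : ℝ => ∑ j,
        ∫ t in {t : ℝ | t ∈ Set.Ioc 0 (D.len j) ∧ δ < dist (D.curve i s) (D.curve j t)},
          ∑ b, w j b t * dirDeriv (deriv (D.curve i) s) (M b) (D.curve i s - D.curve j t))
        (𝓝[>] 0) (𝓝 v) := by
  choose v hv ht using fun j b => D.hasDerivAt_layer (hM b) i j (hw j b) (hwp j b) s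
  refine ⟨∑ j, ∑ b, v j b,
    HasDerivAt.fun_sum fun j _ => HasDerivAt.fun_sum fun b _ => hv j b, ?_⟩
  refine tendsto_finsetSum _ fun j _ => ?_
  refine (tendsto_finsetSum _ fun b _ => ht j b).congr' ?_
  filter_upwards [self_mem_nhdsWithin] with δ hδ
  simp only [fderiv_apply_eq_dirDeriv]
  exact (integral_finsetSum _ fun b _ => integrableOn_truncated (Set.mem_Ioi.mp hδ)
    (continuousOn_layer_deriv (hM b) i j (hw j b).continuous s)).symm

lemma tendsto_truncInt_kernelN21 (hw : P.IsWavePair k₁ k₂) {p : D.BdryFun ℂ} (hp : D.IsC1 p)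
    (i : Fin D.num) (s : ℝ) :
    Tendsto (D.truncInt (P.kernelN21 k₁ k₂) p i s) (𝓝[>] 0) (𝓝 (N21 P k₁ k₂ D p i s)) := by
  refine tendsto_finsetSum _ fun j _ => ?_
  choose C hC using fun a => norm_kernelN21_le (D := D) hw i j a
  obtain ⟨B, hB, hpb⟩ := exists_bound_of_periodic (hp j).2 (D.len_pos j).ne' (hp j).1.continuous
  refine tendsto_truncated (C := B * ∑ a, C a)
    (continuousOn_right (weaklySingular_kernelN21 hw) hp i j s) fun t ht => ?_
  have hn : ∀ a, 0 ≤ C a := fun a => (norm_nonneg _).trans (hC a s t ht)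
  rw [norm_smul]
  refine mul_le_mul (hpb t) ((pi_norm_le_iff_of_nonneg (Finset.sum_nonneg fun a _ => hn a)).mpr
    fun a => (hC a s t ht).trans ?_) (norm_nonneg _) hB
  exact Finset.single_le_sum (f := C) (fun a _ => hn a) (Finset.mem_univ a)

/-- The pointwise identity is integrated where |x − y| > δ; there each of its three parts is
integrable, so the integral may be split although the limits are singular. -/
lemma truncInt_kernelN2_apply (hw : P.IsWavePair k₁ k₂) (hne : k₁ ^ 2 ≠ k₂ ^ 2)
    {p : D.BdryFun ℂ} (hp : D.IsC1 p) (i : Fin D.num) (s : ℝ) {δ : ℝ} (hδ : 0 < δ) (a : Fin 2) :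
    D.truncInt (P.kernelN2 k₁ k₂) p i s δ a = D.truncInt (P.kernelN21 k₁ k₂) p i s δ a
      + (∑ j, ∫ t in {t : ℝ | t ∈ Set.Ioc 0 (D.len j) ∧ δ < dist (D.curve i s) (D.curve j t)},
          ∑ b, ((deriv (D.curve j) t b : ℝ) : ℂ) * p j t * dirDeriv (deriv (D.curve i) s)
            (fun z => -P.constN2 k₁ k₂ * pd b (pd a (P.thetaZ k₁ k₂)) z)
              (D.curve i s - D.curve j t))
      + ∑ j, ∫ t in {t : ℝ | t ∈ Set.Ioc 0 (D.len j) ∧ δ < dist (D.curve i s) (D.curve j t)},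
          ∑ b, ((D.normal j t b : ℝ) : ℂ) * p j t * dirDeriv (deriv (D.curve i) s)
            (P.N23Z k₁ k₂ a b) (D.curve i s - D.curve j t) := by
  -- The rotated outward normal is the unit tangent, which makes the directional derivatives in the
  -- identity tangential.
  have hrot : ∀ l r, !₂[-(D.normal l r 1), D.normal l r 0] = deriv (D.curve l) r := fun l r => by
    ext m
    fin_cases m <;> simp [normal]
  have hd : ∀ l r, deriv (D.curve l) r 0 = -(D.normal l r 1) ∧
      deriv (D.curve l) r 1 = D.normal l r 0 := fun l r => by simp [normal]
  simp only [truncInt, Finset.sum_apply, ← Finset.sum_add_distrib]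
  refine Finset.sum_congr rfl fun j _ => ?_
  set S := {t : ℝ | t ∈ Set.Ioc 0 (D.len j) ∧ δ < dist (D.curve i s) (D.curve j t)} with hS
  have hSm : MeasurableSet S := measurableSet_truncated i j s δ
  set f2 : Fin 2 → ℝ → ℂ := fun a t => ∑ b, ((deriv (D.curve j) t b : ℝ) : ℂ) * p j t *
    dirDeriv (deriv (D.curve i) s) (fun z => -P.constN2 k₁ k₂ * pd b (pd a (P.thetaZ k₁ k₂)) z)
      (D.curve i s - D.curve j t) with hf2
  set f3 : Fin 2 → ℝ → ℂ := fun a t => ∑ b, ((D.normal j t b : ℝ) : ℂ) * p j t *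
    dirDeriv (deriv (D.curve i) s) (P.N23Z k₁ k₂ a b) (D.curve i s - D.curve j t) with hf3
  set f1 : ℝ → Fin 2 → ℂ := fun t =>
    p j t • P.kernelN21 k₁ k₂ (D.curve i s) (D.normal i s) (D.curve j t) (D.normal j t) with hf1
  have i1 : ∀ a, IntegrableOn (fun t => f1 t a) S := fun a =>
    integrableOn_truncated hδ
      (continuousOn_pi.mp (continuousOn_right (weaklySingular_kernelN21 hw) hp i j s) a)
  have i2 : ∀ a, IntegrableOn (f2 a) S := fun a =>
    integrableOn_truncated hδ (continuousOn_finsetSum _ fun b _ =>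
      continuousOn_layer_deriv ((Params.logKernel_pd_pd_thetaZ hw b a).const_mul _) i j
        (hp.contDiff_mul j ((D.contDiff_deriv_curve j).of_le (by simp)) b).continuous s)
  have i3 : ∀ a, IntegrableOn (f3 a) S := fun a =>
    integrableOn_truncated hδ (continuousOn_finsetSum _ fun b _ =>
      continuousOn_layer_deriv (Params.logKernel_N23Z hw hne a b) i j
        (hp.contDiff_mul j (D.contDiff_normal j) b).continuous s)
  have e : ∀ t ∈ S, ∀ a,
      (p j t • P.kernelN2 k₁ k₂ (D.curve i s) (D.normal i s) (D.curve j t) (D.normal j t)) a =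
        f1 t a + f2 a t + f3 a t := by
    intro t ht a
    have hxy : D.curve i s ≠ D.curve j t := dist_pos.mp (hδ.trans ht.2)
    have hc : ∀ b, dirDeriv (deriv (D.curve i) s)
        (fun z => -P.constN2 k₁ k₂ * pd b (pd a (P.thetaZ k₁ k₂)) z) (D.curve i s - D.curve j t) =
        -P.constN2 k₁ k₂ * dirDeriv (deriv (D.curve i) s) (pd b (pd a (P.thetaZ k₁ k₂)))
          (D.curve i s - D.curve j t) := fun b => by
      simp only [dirDeriv, Fin.sum_univ_two, pd_const_mul
        (((Params.logKernel_pd_pd_thetaZ hw b a).contDiffAt _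
          (sub_ne_zero.mpr hxy)).differentiableAt (by simp))]
      ring
    simp only [Pi.smul_apply, smul_eq_mul, Params.kernelN2_eq_regularized hw hne hxy, hrot, hf1,
      hf2, hf3, hc, Fin.sum_univ_two, Matrix.cons_val_zero, Matrix.cons_val_one, (hd j t).1,
      (hd j t).2]
    ring
  have e' : ∀ a, Set.EqOn (fun t => (p j t • P.kernelN2 k₁ k₂ (D.curve i s) (D.normal i s)
      (D.curve j t) (D.normal j t)) a) (fun t => f1 t a + f2 a t + f3 a t) S := fun a t ht =>
    e t ht a
  have i12 : IntegrableOn (fun t => f1 t a + f2 a t) S := (i1 a).add (i2 a)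
  rw [eval_integral (μ := volume.restrict S) (fun a => by
      exact (((i1 a).add (i2 a)).add (i3 a)).congr_fun (e' a).symm hSm) a,
    eval_integral (μ := volume.restrict S) i1 a, setIntegral_congr_fun hSm (e' a),
    integral_add i12 (i3 a), integral_add (i1 a) (i2 a)]

/-- The regularized representation of the hypersingular operator block `N₂`. -/
theorem isN2_regularized (hw : P.IsWavePair k₁ k₂) (hne : k₁ ^ 2 ≠ k₂ ^ 2) {p : D.BdryFun ℂ}
    (hp : D.IsC1 p) :
    (∀ j, Differentiable ℝ (N22 P k₁ k₂ D (D.tderiv p) j)) ∧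
      (∀ j, Differentiable ℝ (N23 P k₁ k₂ D p j)) ∧
      IsN2 P k₁ k₂ D p
        (N21 P k₁ k₂ D p + D.tderiv (N22 P k₁ k₂ D (D.tderiv p)) + D.tderiv (N23 P k₁ k₂ D p)) := by
  choose v2 hv2 ht2 using fun (i : Fin D.num) (s : ℝ) (a : Fin 2) =>
    hasDerivAt_layer_sum (D := D)
      (M := fun b z => -P.constN2 k₁ k₂ * pd b (pd a (P.thetaZ k₁ k₂)) z)
      (fun b => (Params.logKernel_pd_pd_thetaZ hw b a).const_mul _)
      (w := fun j b t => ((deriv (D.curve j) t b : ℝ) : ℂ) * p j t)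
      (fun j b => hp.contDiff_mul j ((D.contDiff_deriv_curve j).of_le (by simp)) b)
      (fun j b t => by simp only [periodic_deriv (D.periodic j) t, (hp j).2 t]) i s
  choose v3 hv3 ht3 using fun (i : Fin D.num) (s : ℝ) (a : Fin 2) =>
    hasDerivAt_layer_sum (D := D) (M := P.N23Z k₁ k₂ a)
      (fun b => Params.logKernel_N23Z hw hne a b)
      (w := fun j b t => ((D.normal j t b : ℝ) : ℂ) * p j t)
      (fun j b => hp.contDiff_mul j (D.contDiff_normal j) b)
      (fun j b t => by simp only [D.normal_periodic j t, (hp j).2 t]) i s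
  have h2 : ∀ i s, HasDerivAt (N22 P k₁ k₂ D (D.tderiv p) i) (v2 i s) s := fun i s =>
    hasDerivAt_pi.mpr fun a => by
      simp only [N22_tderiv_apply hw hp]
      exact hv2 i s a
  have h3 : ∀ i s, HasDerivAt (N23 P k₁ k₂ D p i) (v3 i s) s := fun i s =>
    hasDerivAt_pi.mpr fun a => by
      simp only [N23_apply hw hne hp]
      exact hv3 i s a
  -- Both divergence coefficients are zero: each of the three truncated integrals converges, so
  -- nothing has to be discarded.
  refine ⟨fun i s => (h2 i s).differentiableAt, fun i s => (h3 i s).differentiableAt,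
    fun i s => ⟨0, 0, ?_⟩⟩
  simp only [smul_zero, sub_zero, Pi.add_apply, tderiv]
  refine tendsto_pi_nhds.mpr fun a => ?_
  rw [(h2 i s).deriv, (h3 i s).deriv]
  have t1 := tendsto_pi_nhds.mp (tendsto_truncInt_kernelN21 hw hp i s) a
  refine ((t1.add (ht2 i s a)).add (ht3 i s a)).congr' ?_
  filter_upwards [self_mem_nhdsWithin] with δ hδ
  exact (truncInt_kernelN2_apply hw hne hp i s hδ a).symm

end SmoothDomain

end Poroelastic

end

theorem mainTheorem4 (P : Poroelastic.Params) (k₁ k₂ : ℂ) (hk : P.IsWavePair k₁ k₂)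
    (hne : k₁ ^ 2 ≠ k₂ ^ 2) (D : Poroelastic.SmoothDomain) :
    D.WeaklySingular (P.kernelN21 k₁ k₂) ∧
    D.WeaklySingular (P.kernelN22 k₁ k₂) ∧
    D.WeaklySingular (P.kernelN23 k₁ k₂) ∧
    ∀ p : D.BdryFun ℂ, D.IsC1 p →
      (∀ j, Differentiable ℝ (Poroelastic.N22 P k₁ k₂ D (D.tderiv p) j)) ∧
      (∀ j, Differentiable ℝ (Poroelastic.N23 P k₁ k₂ D p j)) ∧
      Poroelastic.IsN2 P k₁ k₂ D p
        (Poroelastic.N21 P k₁ k₂ D p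
          + D.tderiv (Poroelastic.N22 P k₁ k₂ D (D.tderiv p))
          + D.tderiv (Poroelastic.N23 P k₁ k₂ D p)) :=
  ⟨Poroelastic.SmoothDomain.weaklySingular_kernelN21 hk,
    Poroelastic.SmoothDomain.weaklySingular_kernelN22 hk,
    Poroelastic.SmoothDomain.weaklySingular_kernelN23 hk hne,
    fun _ hp => Poroelastic.SmoothDomain.isN2_regularized hk hne hp⟩
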